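/- **Floats.** Fix integers $p,q$ with $2\le p\le 2^{q-1}-3$ and put $e_{\min}=-2^{q-1}+2$, $e_{\max}=2^{q-1}-1$. Let $\mathbb F\subset\mathbb R$ be the finite set of numbers $\pm(1.m_1\cdots m_p)_2\,2^{e}$ with $e_{\min}\le e\le e_{\max}$, together with the numbers $\pm(0.m_1\cdots m_p)_2\,2^{e_{\min}}$, where $m_i\in\{0,1\}$. Let $\overline{\mathbb F}=\mathbb F\cup\{\infty,-\infty,\mathrm{NaN}\}$ and $\Omega=\max\mathbb F=(2-2^{-p})2^{e_{\max}}$; for $t\in\mathbb F$ with $t<\Omega$ let $t^+$ be the smallest element of $\mathbb F$ greater than $t$. A real $x$ is rounded to $\infty$ if $x\ge\Omega+2^{e_{\max}-p-1}$, to $-\infty$ if $x\le-\Omega-2^{e_{\max}-p-1}$, and otherwise to the nearest element of $\mathbb F$, ties going to the float whose last mantissa bit $m_p$ is $0$; $\pm\infty$ and $\mathrm{NaN}$ are rounded to themselves. For $x,y\in\overline{\mathbb F}$, $x\oplus y$ and $x\otimes y$ are the roundings of $x+y$ and $x\times y$, computed in $\mathbb R\cup\{\pm\infty,\mathrm{NaN}\}$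 with the usual rules ($\infty+(-\infty)$, $0\times(\pm\infty)$ and every operation involving $\mathrm{NaN}$ give $\mathrm{NaN}$). **Reduction orders.** For $n\ge1$, an order $o$ for $n$ summands is a sequence of $n-1$ pairs; if $n\ge2$, its first pair $(i,j)$ satisfies $1\le i<j\le n$ and the remaining pairs form an order $o'$ for $n-1$ summands. Put $\Sigma(x_1;o)=x_1$ if $n=1$; if $n\ge2$, $\Sigma(x_1,\dots,x_n;o)=\Sigma(\hat x;o')$, where $\hat x$ is the $(n-1)$-tuple whose first entry is $x_i\oplus x_j$ and whose other entries are the $x_k$ with $k\ne i,j$ in their original order. A *reduction order* $\mathcal S=\{o_1,o_2,\dots\}$ consists of one order $o_n$ for $n$ summands for every $n\ge1$. **Networks.** A *floating-point affine transformation under $\mathcal S$* is a map $\overline{\mathbb F}^{m}\to\overline{\mathbb F}^{n}$ ($m,n\ge1$) whose $i$-th coordinate is $\Sigma(w_{i,1}\otimes x_1,\dots,w_{i,m}\otimes x_m;o_m)\oplus b_i$ with $w_{i,j},b_i\in\mathbb F$. For $\sigma:\overline{\mathbb F}\to\overline{\mathbb F}$, applied coordinatewise, an *$L$-layer $\sigma$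 network under $\mathcal S$* is a map $\mathrm{aff}_L\circ\sigma\circ\mathrm{aff}_{L-1}\circ\cdots\circ\sigma\circ\mathrm{aff}_1$ with floating-point affine transformations $\mathrm{aff}_\ell$ under $\mathcal S$ of arbitrary compatible positive dimensions. **Distinguishability.** For $\mathcal X\subset\mathbb F^{d}$ and $\mathcal Y\subset\overline{\mathbb F}$, $\mathcal X$ is *$\sigma$-distinguishable with range $\mathcal Y$ under $\mathcal S$* if for all $x\ne x'$ in $\mathcal X$ there is a floating-point affine transformation $\phi:\overline{\mathbb F}^{d}\to\overline{\mathbb F}$ under $\mathcal S$ with $\sigma(\phi(x))\ne\sigma(\phi(x'))$ and $\sigma(\phi(\mathcal X))\subset\mathcal Y$. **Theorem.** Let $\mathcal S$ be a reduction order, $\sigma:\overline{\mathbb F}\to\overline{\mathbb F}$, $d_{\mathrm{in}},d_{\mathrm{out}}\ge1$, $\mathcal X\subset\mathbb F^{d_{\mathrm{in}}}$ and $f:\mathcal X\to(\mathbb F\cup\{-\infty,\infty\})^{d_{\mathrm{out}}}$. Suppose that there exist $C_0,C_1,C_2\in\mathbb F$ with $|C_i|\le2^{e_{\max}}$ and $|C_i-C_j|\le2^{e_{\max}}$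 for all $0\le i,j\le2$ such that $\sigma(C_0),\sigma(C_1),\sigma(C_2)$ are finite (i.e. in $\mathbb F$) and $$\sigma(C_0)=0,\qquad 2^{e_{\min}}\le|\sigma(C_1)|<\tfrac54,\qquad |\sigma(C_2)|>(2^{-p-2})^+,$$ and that $\mathcal X$ is $\sigma$-distinguishable with range $[-2^{e_{\max}},2^{e_{\max}}]\cap\mathbb F$ under $\mathcal S$. Then there exists a four-layer $\sigma$ network $g$ under $\mathcal S$ such that $g(x)=f(x)$ for all $x\in\mathcal X$. -/

import Mathlib

/-- A floating-point format: `p` mantissa bits and `q` exponent bits, `2 ≤ p ≤ 2 ^ (q - 1) - 3`. -/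
structure FloatFormat where
  p : ℕ
  q : ℕ
  two_le_p : 2 ≤ p
  p_le : p + 3 ≤ 2 ^ (q - 1)

namespace FloatFormat

/-- The smallest exponent. -/
def emin (F : FloatFormat) : ℤ := -2 ^ (F.q - 1) + 2

/-- The largest exponent. -/
def emax (F : FloatFormat) : ℤ := 2 ^ (F.q - 1) - 1

/-- `x` is a finite float whose mantissa bits `m₁ … mₚ` spell the natural number `m < 2 ^ p` in
binary: `x = ± (1.m₁…mₚ) * 2 ^ e` with `emin ≤ e ≤ emax`, or `x = ± (0.m₁…mₚ) * 2 ^ emin`.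
The last mantissa bit `mₚ` is zero iff `m` is even. -/
def HasMantissa (F : FloatFormat) (m : ℕ) (x : ℝ) : Prop :=
  m < 2 ^ F.p ∧ ∃ s : ℝ, (s = -1 ∨ s = 1) ∧
    ((∃ e : ℤ, F.emin ≤ e ∧ e ≤ F.emax ∧ x = s * (1 + (m : ℝ) / 2 ^ F.p) * (2 : ℝ) ^ e) ∨
      x = s * ((m : ℝ) / 2 ^ F.p) * (2 : ℝ) ^ F.emin)

/-- `x` is a finite float of the format. -/
def IsFloat (F : FloatFormat) (x : ℝ) : Prop := ∃ m : ℕ, F.HasMantissa m x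

/-- `x` is a finite float whose last mantissa bit is zero. -/
def IsEvenFloat (F : FloatFormat) (x : ℝ) : Prop := ∃ m : ℕ, Even m ∧ F.HasMantissa m x

/-- The set `𝔽` of finite floats. -/
def Fl (F : FloatFormat) : Type := {x : ℝ // F.IsFloat x}

/-- The real value of a finite float. -/
def Fl.val {F : FloatFormat} (x : F.Fl) : ℝ := Subtype.val x

/-- The largest finite float `Ω = (2 - 2 ^ (-p)) * 2 ^ emax`. -/
noncomputable def Omega (F : FloatFormat) : ℝ :=
  (2 - (2 : ℝ) ^ (-(F.p : ℤ))) * (2 : ℝ) ^ F.emax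

/-- `y` is the nearest float to the real number `x`, ties being broken to the float whose last
mantissa bit is zero. -/
def IsNearestEven (F : FloatFormat) (x : ℝ) (y : F.Fl) : Prop :=
  (∀ z : F.Fl, |x - y.val| ≤ |x - z.val|) ∧
    ((∃ z : F.Fl, z ≠ y ∧ |x - z.val| = |x - y.val|) → F.IsEvenFloat y.val)

/-! ### A nearest float with ties to even exists -/

theorem emin_le_emax (F : FloatFormat) : F.emin ≤ F.emax := by
  have h := F.p_le
  have h2 := F.two_le_p
  have : (5 : ℤ) ≤ 2 ^ (F.q - 1) := by exact_mod_cast (by omega : 5 ≤ 2 ^ (F.q - 1))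
  unfold emin emax
  omega

theorem HasMantissa.exists_int {F : FloatFormat} {m : ℕ} {x : ℝ} (h : F.HasMantissa m x) :
    ∃ n k : ℤ, F.emin - F.p ≤ k ∧ k ≤ F.emax - F.p ∧ |n| < 2 ^ (F.p + 1) ∧
      (k = F.emin - F.p ∨ 2 ^ F.p ≤ |n|) ∧ x = n * (2 : ℝ) ^ k ∧ (Even n ↔ Even m) := by
  obtain ⟨hm, s, hs, h⟩ := h
  have hm' : (m : ℤ) < 2 ^ F.p := by exact_mod_cast hm
  have hp2 : (2 : ℤ) ^ (F.p + 1) = 2 * 2 ^ F.p := by ring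
  have hpe : Even ((2 : ℤ) ^ F.p) :=
    (even_two).pow_of_ne_zero (by have := F.two_le_p; omega)
  have key : ∀ e : ℤ, (2 : ℝ) ^ (e - F.p) = (2 : ℝ) ^ e / 2 ^ F.p := fun e => by
    rw [zpow_sub₀ (by norm_num), zpow_natCast]
  obtain ⟨t, ht, hst⟩ : ∃ t : ℤ, (t = -1 ∨ t = 1) ∧ s = t := by
    rcases hs with rfl | rfl
    · exact ⟨-1, Or.inl rfl, by simp⟩
    · exact ⟨1, Or.inr rfl, by simp⟩
  have habs : ∀ a : ℤ, |t * a| = |a| := fun a => by rcases ht with rfl | rfl <;> simp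
  have hev : ∀ a : ℤ, Even (t * a) ↔ Even a := fun a => by rcases ht with rfl | rfl <;> simp
  rcases h with ⟨e, he1, he2, hx⟩ | hx
  · refine ⟨t * (2 ^ F.p + m), e - F.p, by omega, by omega, ?_, Or.inr ?_, ?_, ?_⟩
    · rw [habs, abs_of_nonneg (by positivity)]; omega
    · rw [habs, abs_of_nonneg (by positivity)]; omega
    · rw [hx, key, hst]; push_cast; field_simp
    · rw [hev, Int.even_add]; simp [hpe]
  · refine ⟨t * m, F.emin - F.p, le_rfl, by have := F.emin_le_emax; omega, ?_, Or.inl rfl, ?_, ?_⟩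
    · rw [habs, abs_of_nonneg (by positivity)]; omega
    · rw [hx, key, hst]; push_cast; field_simp
    · rw [hev]; simp

theorem isFloat_int {F : FloatFormat} (n k : ℤ) (h1 : F.emin - F.p ≤ k) (h2 : k ≤ F.emax - F.p)
    (hn : |n| < 2 ^ (F.p + 1)) : F.IsFloat (n * (2 : ℝ) ^ k) := by
  obtain ⟨j, hj⟩ : ∃ j : ℕ, k = F.emin - F.p + j := ⟨(k - (F.emin - F.p)).toNat, by omega⟩
  induction j generalizing n k with
  | zero | succ j ih =>
    have hp2 : (2 : ℤ) ^ (F.p + 1) = 2 * 2 ^ F.p := by ring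
    have key : (2 : ℝ) ^ k = (2 : ℝ) ^ (k + F.p) / 2 ^ F.p := by
      rw [zpow_add₀ (by norm_num), zpow_natCast]; field_simp
    obtain ⟨t, ht, hnt⟩ : ∃ t : ℝ, (t = -1 ∨ t = 1) ∧ (n : ℝ) = t * ((n.natAbs : ℕ) : ℝ) := by
      rcases le_total 0 n with h | h
      · refine ⟨1, Or.inr rfl, ?_⟩
        rw [Nat.cast_natAbs, abs_of_nonneg h]; simp
      · refine ⟨-1, Or.inl rfl, ?_⟩
        rw [Nat.cast_natAbs, abs_of_nonpos h]; simp
    by_cases hb : 2 ^ F.p ≤ |n|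
    · have hb' : 2 ^ F.p ≤ n.natAbs := by zify; exact hb
      refine ⟨n.natAbs - 2 ^ F.p, by zify [hb']; omega, t, ht,
        Or.inl ⟨k + F.p, by omega, by omega, ?_⟩⟩
      rw [hnt, key, Nat.cast_sub hb']; push_cast; field_simp; ring
    · first
      | refine ⟨n.natAbs, by zify; omega, t, ht, Or.inr ?_⟩
        have hk : F.emin = k + F.p := by simp at hj; omega
        rw [hnt, key, hk]; field_simp
      | have := ih (2 * n) (k - 1) (by push_cast at hj; omega) (by omega)
          (by rw [abs_mul]; norm_num; omega) (by push_cast at hj; omega)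
        convert this using 1
        rw [zpow_sub₀ (by norm_num)]; push_cast; field_simp

theorem exists_between_odd {F : FloatFormat} (n k n' k' : ℤ)
    (h1 : F.emin - F.p ≤ k) (hn : |n| < 2 ^ (F.p + 1))
    (h2' : k' ≤ F.emax - F.p) (hn' : |n'| < 2 ^ (F.p + 1))
    (hnorm' : k' = F.emin - F.p ∨ 2 ^ F.p ≤ |n'|)
    (ho : ¬ Even n) (ho' : ¬ Even n') (hk : k ≤ k')
    (hlt : (n : ℝ) * (2 : ℝ) ^ k < n' * (2 : ℝ) ^ k') :
    ∃ w, F.IsFloat w ∧ (n : ℝ) * (2 : ℝ) ^ k < w ∧ w < n' * (2 : ℝ) ^ k' := by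
  obtain ⟨j, rfl⟩ : ∃ j : ℕ, k' = k + j := ⟨(k' - k).toNat, by omega⟩
  have hp2 : (2 : ℤ) ^ (F.p + 1) = 2 * 2 ^ F.p := by ring
  have hpe : Even ((2 : ℤ) ^ F.p) :=
    (even_two).pow_of_ne_zero (by have := F.two_le_p; omega)
  have hpos : (0 : ℝ) < (2 : ℝ) ^ k := by positivity
  have hz : (n' : ℝ) * (2 : ℝ) ^ (k + (j : ℤ)) = ((n' * 2 ^ j : ℤ) : ℝ) * (2 : ℝ) ^ k := by
    rw [zpow_add₀ (by norm_num), zpow_natCast]; push_cast; ring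
  rw [hz] at hlt ⊢
  have hlt' : n < n' * 2 ^ j := by exact_mod_cast lt_of_mul_lt_mul_right hlt hpos.le
  rw [abs_lt] at hn hn'
  have hne : n + 1 ≠ n' * 2 ^ j := by
    intro he
    rcases Nat.eq_zero_or_pos j with rfl | hj
    · rw [pow_zero, mul_one] at he
      rw [← he] at ho'
      exact ho' (by rw [Int.even_add_one]; exact ho)
    · have hb : 2 ^ F.p ≤ |n'| := by rcases hnorm' with h | h <;> omega
      obtain ⟨i, rfl⟩ : ∃ i, j = i + 1 := ⟨j - 1, by omega⟩
      have hi : (1 : ℤ) ≤ 2 ^ i := one_le_pow₀ (by norm_num)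
      rw [pow_succ] at he
      rcases le_total 0 n' with hs | hs
      · rw [abs_of_nonneg hs] at hb
        have : n' = 2 ^ F.p := by nlinarith
        exact ho' (this ▸ hpe)
      · rw [abs_of_nonpos hs] at hb
        nlinarith
  refine ⟨((n + 1 : ℤ) : ℝ) * (2 : ℝ) ^ k, ?_, ?_, ?_⟩
  · by_cases hcase : n + 1 = 2 ^ (F.p + 1)
    · have hkk : k + 1 ≤ F.emax - F.p := by
        by_contra hcon
        have : j = 0 := by omega
        subst this
        rw [pow_zero, mul_one] at hlt'
        omega
      have := isFloat_int (F := F) (2 ^ F.p) (k + 1) (by omega) hkk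
        (by rw [abs_of_nonneg (by positivity)]; have : (0 : ℤ) < 2 ^ F.p := by positivity
            omega)
      convert this using 1
      rw [hcase, zpow_add₀ (by norm_num)]; push_cast; ring
    · exact isFloat_int _ _ h1 (by omega) (by rw [abs_lt]; omega)
  · have : n < n + 1 := by omega
    exact mul_lt_mul_of_pos_right (by exact_mod_cast this) hpos
  · have : n + 1 < n' * 2 ^ j := by omega
    exact mul_lt_mul_of_pos_right (by exact_mod_cast this) hpos

theorem IsFloat.neg {F : FloatFormat} {x : ℝ} (h : F.IsFloat x) : F.IsFloat (-x) := by
  obtain ⟨m, hm, s, hs, h⟩ := h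
  refine ⟨m, hm, -s, by rcases hs with rfl | rfl <;> simp, ?_⟩
  rcases h with ⟨e, he1, he2, rfl⟩ | rfl
  · exact Or.inl ⟨e, he1, he2, by ring⟩
  · exact Or.inr (by ring)

/-- Strictly between two distinct floats with odd mantissa there is another float. -/
theorem exists_between_of_not_even {F : FloatFormat} {y z : ℝ} (hy : F.IsFloat y)
    (hz : F.IsFloat z) (hyo : ¬ F.IsEvenFloat y) (hzo : ¬ F.IsEvenFloat z) (hlt : y < z) :
    ∃ w, F.IsFloat w ∧ y < w ∧ w < z := by
  obtain ⟨m, hm⟩ := hy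
  obtain ⟨m', hm'⟩ := hz
  have ho : ¬ Even m := fun h => hyo ⟨m, h, hm⟩
  have ho' : ¬ Even m' := fun h => hzo ⟨m', h, hm'⟩
  obtain ⟨n, k, h1, h2, h3, h4, rfl, h6⟩ := hm.exists_int
  obtain ⟨n', k', h1', h2', h3', h4', rfl, h6'⟩ := hm'.exists_int
  rw [← h6] at ho
  rw [← h6'] at ho'
  rcases le_total k k' with hk | hk
  · exact exists_between_odd n k n' k' h1 h3 h2' h3' h4' ho ho' hk hlt
  · obtain ⟨w, hw, hw1, hw2⟩ := exists_between_odd (F := F) (-n') k' (-n) k h1'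
      (by rwa [abs_neg]) h2 (by rwa [abs_neg]) (by rwa [abs_neg]) (by simpa using ho')
      (by simpa using ho) hk (by push_cast; linarith)
    push_cast at hw1 hw2
    exact ⟨-w, hw.neg, by linarith, by linarith⟩

theorem isFloat_zero (F : FloatFormat) : F.IsFloat 0 :=
  ⟨0, by positivity, 1, Or.inr rfl, Or.inr (by simp)⟩

theorem finite_isFloat (F : FloatFormat) : {x : ℝ | F.IsFloat x}.Finite := by
  have hfin : (Set.Icc (-(2 : ℤ) ^ (F.p + 1)) (2 ^ (F.p + 1)) ×ˢ
      Set.Icc (F.emin - F.p) (F.emax - F.p)).Finite :=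
    (Set.finite_Icc _ _).prod (Set.finite_Icc _ _)
  refine (hfin.image (fun a : ℤ × ℤ => (a.1 : ℝ) * (2 : ℝ) ^ a.2)).subset ?_
  rintro x ⟨m, hm⟩
  obtain ⟨n, k, h1, h2, h3, -, rfl, -⟩ := hm.exists_int
  rw [abs_lt] at h3
  exact ⟨(n, k), ⟨⟨h3.1.le, h3.2.le⟩, h1, h2⟩, rfl⟩

theorem exists_isNearestEven (F : FloatFormat) (x : ℝ) : ∃ y : F.Fl, F.IsNearestEven x y := by
  obtain ⟨y, hy, hmin⟩ := Set.exists_min_image _ (fun y => |x - y|) F.finite_isFloat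
    ⟨0, F.isFloat_zero⟩
  by_cases hye : F.IsEvenFloat y
  · exact ⟨⟨y, hy⟩, fun z => hmin _ z.2, fun _ => hye⟩
  by_cases hex : ∃ z : F.Fl, z ≠ ⟨y, hy⟩ ∧ |x - z.val| = |x - y|
  · obtain ⟨z, hzy, hz⟩ := hex
    refine ⟨z, fun t => hz ▸ hmin _ t.2, fun _ => ?_⟩
    by_contra hzo
    have hne : z.val ≠ y := fun h => hzy (Subtype.ext h)
    have hmid : x - z.val = -(x - y) := by
      rcases abs_eq_abs.mp hz with h | h
      · exact absurd (by linarith) hne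
      · exact h
    rcases lt_or_gt_of_ne hne with hlt | hlt
    · obtain ⟨w, hw, h1, h2⟩ := exists_between_of_not_even z.2 hy hzo hye hlt
      have := hmin w hw
      have h3 : |x - w| < |x - y| := by
        rw [abs_lt, abs_of_nonpos (by linarith : x - y ≤ 0)]
        change z.val < w at h1
        constructor <;> linarith
      exact absurd this (not_le.mpr h3)
    · obtain ⟨w, hw, h1, h2⟩ := exists_between_of_not_even hy z.2 hye hzo hlt
      have := hmin w hw
      have h3 : |x - w| < |x - y| := by
        rw [abs_lt, abs_of_nonneg (by linarith : 0 ≤ x - y)]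
        change w < z.val at h2
        constructor <;> linarith
      exact absurd this (not_le.mpr h3)
  · exact ⟨⟨y, hy⟩, fun z => hmin _ z.2, fun h => absurd h hex⟩

end FloatFormat

/-- `α` together with `∞`, `-∞` and `NaN`. -/
inductive WithInfNaN (α : Type) : Type
  | fin (a : α) : WithInfNaN α
  | posInf : WithInfNaN α
  | negInf : WithInfNaN α
  | nan : WithInfNaN α

namespace WithInfNaN

/-- Apply a function to the finite values. -/
def map {α β : Type} (f : α → β) : WithInfNaN α → WithInfNaN β
  | fin a => fin (f a)
  | posInf => posInf
  | negInf => negInf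
  | nan => nan

/-- Exact addition on `ℝ ∪ {∞, -∞, NaN}`. -/
noncomputable def add : WithInfNaN ℝ → WithInfNaN ℝ → WithInfNaN ℝ
  | fin a, fin b => fin (a + b)
  | fin _, posInf => posInf
  | fin _, negInf => negInf
  | posInf, fin _ => posInf
  | posInf, posInf => posInf
  | posInf, negInf => nan
  | negInf, fin _ => negInf
  | negInf, posInf => nan
  | negInf, negInf => negInf
  | nan, _ => nan
  | _, nan => nan

open Classical in
/-- `∞` times the sign of a real number, `∞ * 0` being `NaN`. -/
noncomputable def infMul (a : ℝ) : WithInfNaN ℝ :=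
  if 0 < a then posInf else if a < 0 then negInf else nan

/-- Exact multiplication on `ℝ ∪ {∞, -∞, NaN}`. -/
noncomputable def mul : WithInfNaN ℝ → WithInfNaN ℝ → WithInfNaN ℝ
  | fin a, fin b => fin (a * b)
  | fin a, posInf => infMul a
  | fin a, negInf => infMul (-a)
  | posInf, fin b => infMul b
  | posInf, posInf => posInf
  | posInf, negInf => negInf
  | negInf, fin b => infMul (-b)
  | negInf, posInf => negInf
  | negInf, negInf => posInf
  | nan, _ => nan
  | _, nan => nan

end WithInfNaN

namespace FloatFormat

/-- The set of all floats `𝔽 ∪ {∞, -∞, NaN}`. -/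
abbrev FlBar (F : FloatFormat) : Type := WithInfNaN F.Fl

/-- The value of a float in `ℝ ∪ {∞, -∞, NaN}`. -/
def FlBar.toExt {F : FloatFormat} (x : F.FlBar) : WithInfNaN ℝ := WithInfNaN.map Fl.val x

/-- A float is not `NaN`, i.e. it belongs to `𝔽 ∪ {-∞, ∞}`. -/
def FlInf (F : FloatFormat) : Type := {x : F.FlBar // x ≠ WithInfNaN.nan}

/-- The float nearest to a real number, with ties to even. -/
noncomputable def nearest (F : FloatFormat) (x : ℝ) : F.Fl :=
  Classical.choose (F.exists_isNearestEven x)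

open Classical in
/-- The rounding function `ℝ ∪ {∞, -∞, NaN} → 𝔽 ∪ {∞, -∞, NaN}`. -/
noncomputable def round (F : FloatFormat) : WithInfNaN ℝ → F.FlBar
  | .fin x =>
    if |x| < F.Omega + (2 : ℝ) ^ (F.emax - F.p - 1) then .fin (F.nearest x)
    else if 0 < x then .posInf else .negInf
  | .posInf => .posInf
  | .negInf => .negInf
  | .nan => .nan

/-- Floating-point addition `x ⊕ y`. -/
noncomputable def fadd {F : FloatFormat} (x y : F.FlBar) : F.FlBar :=
  F.round (WithInfNaN.add (FlBar.toExt x) (FlBar.toExt y))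

/-- Floating-point multiplication `x ⊗ y`. -/
noncomputable def fmul {F : FloatFormat} (x y : F.FlBar) : F.FlBar :=
  F.round (WithInfNaN.mul (FlBar.toExt x) (FlBar.toExt y))

end FloatFormat

/-- The set of reduction orders for summing `n` floats: a sequence of `n - 1` pairs, the first one
a pair of positions `i < j` among `n`, the following ones a reduction order for `n - 1` floats. -/
inductive RedOrder : ℕ → Type
  | one : RedOrder 1
  | step {n : ℕ} (i j : Fin (n + 2)) (hij : i < j) (o : RedOrder (n + 1)) : RedOrder (n + 2)

/-- The tuple `(x i ⊕ x j, x₁, …, xₙ)`, with the entries `i` and `j` left out of the tail. -/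
noncomputable def reducePair {F : FloatFormat} {n : ℕ} (x : Fin (n + 2) → F.FlBar)
    (i j : Fin (n + 2)) (hij : i < j) : Fin (n + 1) → F.FlBar :=
  Fin.cons (FloatFormat.fadd (x i) (x j))
    (fun k : Fin n => x (j.succAbove ((i.castLT (by omega)).succAbove k)))

/-- The sum of a tuple of floats according to a reduction order. -/
noncomputable def RedOrder.sum {F : FloatFormat} :
    {n : ℕ} → RedOrder n → (Fin n → F.FlBar) → F.FlBar
  | _, .one, x => x 0
  | _, .step i j hij o, x => o.sum (reducePair x i j hij)

/-- A reduction order `S = {o₁, o₂, …}`: one order for each number `n ≥ 1` of summands. -/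
def ReductionOrder : Type := ∀ n : ℕ+, RedOrder n

/-- The parameters (finite weights and biases) of a floating-point affine transformation. -/
structure FlAffine (F : FloatFormat) (m n : ℕ+) where
  w : Fin n → Fin m → F.Fl
  b : Fin n → F.Fl

/-- The affine transformation under `S`: products, reduced according to `S`, then the bias. -/
noncomputable def FlAffine.eval {F : FloatFormat} {m n : ℕ+} (A : FlAffine F m n)
    (S : ReductionOrder) (x : Fin m → F.FlBar) : Fin n → F.FlBar := fun i =>
  FloatFormat.fadd ((S m).sum (fun j => FloatFormat.fmul (.fin (A.w i j)) (x j))) (.fin (A.b i))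

/-- The parameters of a network with input dimension `m`, output dimension `n` and a given number
of layers (affine transformations). -/
inductive FlNetwork (F : FloatFormat) : ℕ+ → ℕ+ → ℕ → Type
  | last {m n : ℕ+} (A : FlAffine F m n) : FlNetwork F m n 1
  | cons {m k n : ℕ+} {L : ℕ} (A : FlAffine F m k) (N : FlNetwork F k n L) :
      FlNetwork F m n (L + 1)

/-- The function `aff_L ∘ σ ∘ ⋯ ∘ σ ∘ aff_1` computed by a `σ` network under `S`. -/
noncomputable def FlNetwork.eval {F : FloatFormat} (σ : F.FlBar → F.FlBar) (S : ReductionOrder) :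
    {m n : ℕ+} → {L : ℕ} → FlNetwork F m n L → (Fin m → F.FlBar) → (Fin n → F.FlBar)
  | _, _, _, .last A, x => A.eval S x
  | _, _, _, .cons A N, x => N.eval σ S (fun i => σ (A.eval S x i))

/-- A vector of finite floats as a vector of floats. -/
def flVec {F : FloatFormat} {d : ℕ+} (x : Fin d → F.Fl) : Fin d → F.FlBar := fun i => .fin (x i)

/-- `X` is `σ`-distinguishable with range `Y` under `S`. -/
def Distinguishable {F : FloatFormat} (S : ReductionOrder) (σ : F.FlBar → F.FlBar) {d : ℕ+}
    (X : Set (Fin d → F.Fl)) (Y : Set F.FlBar) : Prop :=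
  ∀ x ∈ X, ∀ x' ∈ X, x ≠ x' → ∃ φ : FlAffine F d 1,
    σ (φ.eval S (flVec x) 0) ≠ σ (φ.eval S (flVec x') 0) ∧
      ∀ z ∈ X, σ (φ.eval S (flVec z) 0) ∈ Y

/-- The floats in the interval `[-2 ^ emax, 2 ^ emax]`. -/
def boundedRange (F : FloatFormat) : Set F.FlBar :=
  {y | ∃ v : F.Fl, y = .fin v ∧ |v.val| ≤ (2 : ℝ) ^ F.emax}

/-- There are finite floats `C 0, C 1, C 2` with `|C i| ≤ 2 ^ emax`, `|C i - C j| ≤ 2 ^ emax`,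
`σ (C 0) = 0`, `2 ^ emin ≤ |σ (C 1)| < 5 / 4` and `|σ (C 2)| > (2 ^ (-p - 2))⁺`, the values
`σ (C i)` being finite; here `t⁺` is the smallest float greater than `t`. -/
def ProperActivation {F : FloatFormat} (σ : F.FlBar → F.FlBar) : Prop :=
  ∃ C v : Fin 3 → F.Fl,
    (∀ i, |(C i).val| ≤ (2 : ℝ) ^ F.emax) ∧
    (∀ i j, |(C i).val - (C j).val| ≤ (2 : ℝ) ^ F.emax) ∧
    (∀ i, σ (.fin (C i)) = .fin (v i)) ∧
    (v 0).val = 0 ∧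
    (2 : ℝ) ^ F.emin ≤ |(v 1).val| ∧ |(v 1).val| < 5 / 4 ∧
    ∃ t : ℝ, IsLeast {y : ℝ | F.IsFloat y ∧ (2 : ℝ) ^ (-(F.p : ℤ) - 2) < y} t ∧ t < |(v 2).val|

/-!
# Four-layer floating-point networks realize every function on a distinguishable set

Floating-point arithmetic is used as a machine whose program is a sequence of rounded additions.

*Reduction orders.* Rounded addition is not associative, but zero is neutral for it. In any binary
summation tree with `2 ^ N` leaves there are at least `N + 1` leaves which, all other leaves being
zero, are added one after the other (`RedOrder.exists_sequential`). Hence, whatever the reduction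
order, a wide affine layer computes any prescribed sequential sum
`(⋯((w₁ ⊗ h₁) ⊕ (w₂ ⊗ h₂)) ⊕ ⋯) ⊕ b` of multiples of hidden functions (`exists_affine`), and it
suffices to construct such sums (`Reach`, `exists_network`).

*Steps.* The conditions on `σ (C 1)` and `σ (C 2)` ensure that for every exponent `i` of a gap
between floats some rounded product `w ⊗ σ (C j)` is a float `a i` in `(2 ^ i / 2, 2 ^ i]`
(`exists_stepSeq`). Adding `a i` moves a float to its successor at distance `2 ^ i`, whereas it
leaves unchanged many floats with a larger gap. So a number can be walked along the floats, and one
value can be moved while another is stuck.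

*Layers.* The first layer computes the distinguishing features. Let `M = 2 ^ emax`.
* A function with values in `[-M, M]` is brought to the two values `0` and `M`, according to a
  threshold (`separate`): values from the threshold on are raised to `M`, then to a float above `M`
  at which they are stuck, while the others are collected at `-M` and return to `0`. From `0` and
  `M`, steps and a bias lead to any two floats `c < d` in `[-M, M]` with `d - c ≤ M`
  (`exists_steps_twoVal`), in particular to `C 0` and `C j`. Hence for any two points of `X` the
  second layer has a function with values `0` and `σ (C j)` which tells them apart (`exists_bit`).
* Multiples of these functions are steps that do not move a given point `x`. With them, the third
  layer raises all other points from `0` up to `M`, where they are stuck (`reach_twoVal_compl`), and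
  thus obtains the function with value `σ (C j)` at `x` and `0` elsewhere (`exists_indicator`).
* With multiples of these indicators the last layer walks the value at each point separately from
  `0` to the prescribed one (`exists_reach_point`); infinite values are reached by a last step
  beyond the largest float.
-/

namespace FloatFormat

variable {F : FloatFormat}

/-! ### Floats as multiples of powers of two -/

/-- The exponent of the smallest positive float `2 ^ imin`. -/
def imin (F : FloatFormat) : ℤ := F.emin - F.p

/-- The exponent of the gap `2 ^ imax` between the largest floats. -/
def imax (F : FloatFormat) : ℤ := F.emax - F.p

theorem imin_add_four_le_imax (F : FloatFormat) : F.imin + 4 ≤ F.imax := by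
  have h := F.p_le
  have h2 := F.two_le_p
  have : (5 : ℤ) ≤ 2 ^ (F.q - 1) := by exact_mod_cast (by omega : 5 ≤ 2 ^ (F.q - 1))
  unfold imin imax emin emax
  omega

theorem four_le_two_pow_p (F : FloatFormat) : (4 : ℝ) ≤ 2 ^ F.p := by
  calc (4 : ℝ) = 2 ^ 2 := by norm_num
    _ ≤ 2 ^ F.p := pow_le_pow_right₀ (by norm_num) F.two_le_p

theorem four_le_two_pow_p_int (F : FloatFormat) : (4 : ℤ) ≤ 2 ^ F.p := by
  exact_mod_cast F.four_le_two_pow_p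

theorem zpow_add_p (F : FloatFormat) (i : ℤ) : (2 : ℝ) ^ (i + F.p) = 2 ^ F.p * 2 ^ i := by
  rw [zpow_add₀ (by norm_num), zpow_natCast, mul_comm]

theorem two_zpow_pos (i : ℤ) : (0 : ℝ) < (2 : ℝ) ^ i := by positivity

theorem two_zpow_succ (i : ℤ) : (2 : ℝ) ^ (i + 1) = 2 * (2 : ℝ) ^ i := by
  rw [zpow_add_one₀ (by norm_num), mul_comm]

theorem two_zpow_pred (i : ℤ) : (2 : ℝ) ^ (i - 1) = (2 : ℝ) ^ i / 2 := by
  rw [zpow_sub_one₀ (by norm_num), div_eq_mul_inv]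

theorem two_zpow_eq_mul {i j : ℤ} (h : i ≤ j) :
    ∃ m : ℕ, j = i + m ∧ (2 : ℝ) ^ j = (2 : ℝ) ^ m * (2 : ℝ) ^ i := by
  refine ⟨(j - i).toNat, by omega, ?_⟩
  rw [← zpow_natCast, ← zpow_add₀ (by norm_num)]
  congr 1; omega

theorem IsFloat.exists_zpow {x : ℝ} (h : F.IsFloat x) :
    ∃ n i : ℤ, F.imin ≤ i ∧ i ≤ F.imax ∧ |n| < 2 ^ (F.p + 1) ∧
      (i = F.imin ∨ 2 ^ F.p ≤ |n|) ∧ x = n * (2 : ℝ) ^ i := by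
  obtain ⟨m, hm⟩ := h
  obtain ⟨n, k, h1, h2, h3, h4, h5, -⟩ := hm.exists_int
  exact ⟨n, k, h1, h2, h3, h4, h5⟩

theorem isFloat_zpow {n i : ℤ} (h1 : F.imin ≤ i) (h2 : i ≤ F.imax) (hn : |n| < 2 ^ (F.p + 1)) :
    F.IsFloat (n * (2 : ℝ) ^ i) := isFloat_int n i h1 h2 hn

theorem isFloat_zpow_of_lt {n i : ℤ} (h1 : F.imin ≤ i) (h2 : i < F.imax)
    (hn : |n| ≤ 2 ^ (F.p + 1)) : F.IsFloat (n * (2 : ℝ) ^ i) := by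
  rcases hn.lt_or_eq with h | h
  · exact isFloat_zpow h1 h2.le h
  · have hp : (0 : ℤ) < 2 ^ F.p := by positivity
    have hp2 : (2 : ℤ) ^ (F.p + 1) = 2 * 2 ^ F.p := by ring
    rcases abs_eq (by positivity : (0 : ℤ) ≤ 2 ^ (F.p + 1)) |>.mp h with h | h
    · have := isFloat_zpow (F := F) (n := 2 ^ F.p) (i := i + 1) (by omega) (by omega)
        (by rw [abs_of_pos hp]; omega)
      convert this using 1
      rw [two_zpow_succ, h]; push_cast; ring
    · have := isFloat_zpow (F := F) (n := -2 ^ F.p) (i := i + 1) (by omega) (by omega)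
        (by rw [abs_neg, abs_of_pos hp]; omega)
      convert this using 1
      rw [two_zpow_succ, h]; push_cast; ring

theorem isFloat_two_zpow {i : ℤ} (h1 : F.imin ≤ i) (h2 : i ≤ F.imax + F.p) :
    F.IsFloat ((2 : ℝ) ^ i) := by
  by_cases h : i ≤ F.imax
  · have := isFloat_zpow (F := F) (n := 1) (i := i) h1 h
      (by have := F.four_le_two_pow_p_int; rw [abs_one, pow_succ]; omega)
    simpa using this
  · have := isFloat_zpow (F := F) (n := 2 ^ (i - F.imax).toNat) (i := F.imax)
      (by have := F.imin_add_four_le_imax; omega) le_rfl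
      (by rw [abs_of_pos (by positivity)]; exact pow_lt_pow_right₀ (by norm_num) (by omega))
    convert this using 1
    push_cast
    rw [← zpow_natCast, ← zpow_add₀ (by norm_num)]
    congr 1; omega

/-- Floats of absolute value at least `2 ^ p * 2 ^ k` are multiples of `2 ^ k`. -/
theorem IsFloat.exists_multiple {y : ℝ} (hy : F.IsFloat y) {k : ℤ}
    (hk : k = F.imin ∨ (2 : ℝ) ^ F.p * (2 : ℝ) ^ k ≤ |y|) : ∃ n : ℤ, y = n * (2 : ℝ) ^ k := by
  obtain ⟨n, i, h1, h2, h3, h4, rfl⟩ := hy.exists_zpow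
  by_cases hik : k ≤ i
  · obtain ⟨m, -, hm⟩ := two_zpow_eq_mul hik
    exact ⟨n * 2 ^ m, by rw [hm]; push_cast; ring⟩
  · exfalso
    rcases hk with rfl | hk
    · omega
    · have h5 : (|(n : ℝ)|) < 2 ^ (F.p + 1) := by exact_mod_cast h3
      have h6 : (2 : ℝ) ^ (i + 1) ≤ (2 : ℝ) ^ k := zpow_le_zpow_right₀ (by norm_num) (by omega)
      rw [two_zpow_succ] at h6
      rw [abs_mul, abs_of_pos (two_zpow_pos i)] at hk
      rw [pow_succ] at h5
      have := two_zpow_pos i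
      have hp : (0 : ℝ) < 2 ^ F.p := by positivity
      nlinarith [mul_le_mul_of_nonneg_left h6 hp.le, mul_lt_mul_of_pos_right h5 this]

theorem Omega_eq (F : FloatFormat) : F.Omega = (2 * 2 ^ F.p - 1) * (2 : ℝ) ^ F.imax := by
  have h : (2 : ℝ) ^ F.emax = 2 ^ F.p * 2 ^ F.imax := by
    rw [← zpow_add_p]; congr 1; unfold imax; omega
  unfold Omega
  rw [h, zpow_neg, zpow_natCast]
  field_simp

theorem IsFloat.abs_le_Omega {x : ℝ} (h : F.IsFloat x) : |x| ≤ F.Omega := by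
  obtain ⟨n, i, h1, h2, h3, -, rfl⟩ := h.exists_zpow
  rw [Omega_eq, abs_mul, abs_of_pos (two_zpow_pos i)]
  have h4 : |n| ≤ 2 * 2 ^ F.p - 1 := by rw [pow_succ] at h3; omega
  have h5 : |(n : ℝ)| ≤ 2 * 2 ^ F.p - 1 := by exact_mod_cast h4
  exact mul_le_mul h5 (zpow_le_zpow_right₀ (by norm_num) h2) (two_zpow_pos i).le
    ((abs_nonneg _).trans h5)

theorem isFloat_Omega (F : FloatFormat) : F.IsFloat F.Omega := by
  have := isFloat_zpow (F := F) (n := 2 * 2 ^ F.p - 1) (i := F.imax)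
    (by have := F.imin_add_four_le_imax; omega) le_rfl
    (by have := F.four_le_two_pow_p_int; rw [abs_of_pos (by omega), pow_succ]; omega)
  rw [Omega_eq]; convert this using 1; push_cast; ring

/-- A normalized odd mantissa is not that of an even float. -/
theorem not_isEvenFloat {n i : ℤ} (h1 : F.imin ≤ i) (hn : |n| < 2 ^ (F.p + 1))
    (hi : i = F.imin ∨ 2 ^ F.p ≤ |n|) (ho : Odd n) : ¬ F.IsEvenFloat (n * (2 : ℝ) ^ i) := by
  rintro ⟨m, hm, h⟩
  obtain ⟨n', k, h1', -, h3', h4', h5', h6⟩ := h.exists_int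
  rw [← h6] at hm
  have hp2 : (2 : ℤ) ^ (F.p + 1) = 2 * 2 ^ F.p := by ring
  rw [← Int.not_even_iff_odd] at ho
  rcases lt_trichotomy i k with hlt | rfl | hlt
  · obtain ⟨d, hd, he⟩ := two_zpow_eq_mul hlt.le
    rw [he, ← mul_assoc] at h5'
    have h7 := mul_right_cancel₀ (two_zpow_pos i).ne' h5'
    have h8 : n = n' * 2 ^ d := by exact_mod_cast h7
    exact ho (h8 ▸ hm.mul_right _)
  · have h7 := mul_right_cancel₀ (two_zpow_pos i).ne' h5'
    exact ho ((by exact_mod_cast h7 : n = n') ▸ hm)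
  · obtain ⟨d, hd, he⟩ := two_zpow_eq_mul hlt.le
    rw [he, ← mul_assoc] at h5'
    have h7 := mul_right_cancel₀ (two_zpow_pos k).ne' h5'
    have h8 : n * 2 ^ d = n' := by exact_mod_cast h7
    have hd1 : (2 : ℤ) ≤ 2 ^ d := by
      calc (2 : ℤ) = 2 ^ 1 := by norm_num
        _ ≤ 2 ^ d := pow_le_pow_right₀ (by norm_num) (by omega)
    have hb : 2 ^ F.p ≤ |n| := by
      rcases hi with h | h
      · unfold imin at h; omega
      · exact h
    have : |n| * 2 ^ d = |n'| := by rw [← h8, abs_mul, abs_of_pos (by positivity : (0 : ℤ) < 2 ^ d)]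
    nlinarith [abs_nonneg n]

/-! ### Consecutive floats -/

/-- `x < z` are consecutive floats. -/
structure Adj (F : FloatFormat) (x z : ℝ) : Prop where
  left : F.IsFloat x
  right : F.IsFloat z
  lt : x < z
  le_or_le : ∀ w, F.IsFloat w → w ≤ x ∨ z ≤ w

theorem Adj.neg {x z : ℝ} (h : F.Adj x z) : F.Adj (-z) (-x) :=
  ⟨h.right.neg, h.left.neg, neg_lt_neg h.lt, fun w hw => by
    rcases h.le_or_le (-w) hw.neg with h | h
    · right; linarith
    · left; linarith⟩

theorem adj_zpow {n i : ℤ} (h1 : F.imin ≤ i) (h2 : i ≤ F.imax) (hn0 : 0 ≤ n)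
    (hn : n + 1 ≤ 2 ^ (F.p + 1)) (hi : i = F.imin ∨ 2 ^ F.p ≤ n)
    (htop : n + 1 < 2 ^ (F.p + 1) ∨ i < F.imax) :
    F.Adj (n * (2 : ℝ) ^ i) ((n + 1) * (2 : ℝ) ^ i) := by
  have hpos := two_zpow_pos i
  refine ⟨isFloat_zpow h1 h2 (by rw [abs_of_nonneg hn0]; omega), ?_, by nlinarith, ?_⟩
  · have : ((n : ℝ) + 1) = ((n + 1 : ℤ) : ℝ) := by push_cast; ring
    rw [this]
    rcases htop with h | h
    · exact isFloat_zpow h1 h2 (by rw [abs_of_nonneg (by omega)]; omega)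
    · exact isFloat_zpow_of_lt h1 h (by rw [abs_of_nonneg (by omega)]; omega)
  · intro w hw
    by_cases hwx : w ≤ n * (2 : ℝ) ^ i
    · exact Or.inl hwx
    · right
      push Not at hwx
      have hn0' : (0 : ℝ) ≤ n := by exact_mod_cast hn0
      obtain ⟨m, rfl⟩ : ∃ m : ℤ, w = m * (2 : ℝ) ^ i := by
        refine hw.exists_multiple (hi.imp_right fun h => ?_)
        have h' : (2 : ℝ) ^ F.p ≤ n := by exact_mod_cast h
        refine le_trans (mul_le_mul_of_nonneg_right h' hpos.le) (hwx.le.trans (le_abs_self _))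
      have : (n : ℝ) < m := lt_of_mul_lt_mul_right hwx hpos.le
      have : n + 1 ≤ m := by exact_mod_cast this
      have : (n : ℝ) + 1 ≤ m := by exact_mod_cast this
      exact mul_le_mul_of_nonneg_right this hpos.le

theorem Adj.exists_zpow {x z : ℝ} (h : F.Adj x z) (hx : 0 ≤ x) :
    ∃ n i : ℤ, F.imin ≤ i ∧ i ≤ F.imax ∧ 0 ≤ n ∧ n < 2 ^ (F.p + 1) ∧
      (i = F.imin ∨ 2 ^ F.p ≤ n) ∧ x = n * (2 : ℝ) ^ i ∧ z = (n + 1) * (2 : ℝ) ^ i := by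
  obtain ⟨n, i, h1, h2, h3, h4, hxe⟩ := h.left.exists_zpow
  have hpos := two_zpow_pos i
  have hn0 : 0 ≤ n := by
    have : (0 : ℝ) ≤ n := by
      by_contra hc
      push Not at hc
      nlinarith
    exact_mod_cast this
  rw [abs_of_nonneg hn0] at h3 h4
  refine ⟨n, i, h1, h2, hn0, h3, h4, hxe, ?_⟩
  by_cases htop : n + 1 < 2 ^ (F.p + 1) ∨ i < F.imax
  · have ha := adj_zpow h1 h2 hn0 (by omega) h4 htop
    apply le_antisymm
    · rcases h.le_or_le _ ha.right with h' | h'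
      · exact absurd (hxe ▸ h') (not_le.mpr ha.lt)
      · exact h'
    · rcases ha.le_or_le _ h.right with h' | h'
      · exact absurd (hxe ▸ h') (not_le.mpr h.lt)
      · exact h'
  · exfalso
    push Not at htop
    have hi : i = F.imax := by omega
    have hn : n = 2 * 2 ^ F.p - 1 := by
      have := htop.1; rw [pow_succ] at this h3; omega
    have : x = F.Omega := by rw [hxe, Omega_eq, hi, hn]; push_cast; ring
    have h5 := h.right.abs_le_Omega
    have := h.lt
    linarith [le_abs_self z]

theorem Adj.exists_gap {x z : ℝ} (h : F.Adj x z) :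
    ∃ i : ℤ, F.imin ≤ i ∧ i ≤ F.imax ∧ z = x + (2 : ℝ) ^ i := by
  rcases le_or_gt 0 x with hx | hx
  · obtain ⟨n, i, h1, h2, -, -, -, rfl, rfl⟩ := h.exists_zpow hx
    exact ⟨i, h1, h2, by ring⟩
  · have hz : 0 ≤ -z := by
      rcases h.le_or_le 0 F.isFloat_zero with h | h <;> linarith
    obtain ⟨n, i, h1, h2, -, -, -, h3, h4⟩ := h.neg.exists_zpow hz
    refine ⟨i, h1, h2, by linarith⟩

/-- The gap between consecutive floats in `[-2 ^ (j + p + 1), 2 ^ (j + p + 1)]` is at most `2 ^ j`. -/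
theorem Adj.exists_gap_le {x z : ℝ} (h : F.Adj x z) {j : ℤ} (hj : F.imin ≤ j)
    (hx : -(2 * 2 ^ F.p * (2 : ℝ) ^ j) ≤ x) (hz : z ≤ 2 * 2 ^ F.p * (2 : ℝ) ^ j) :
    ∃ i : ℤ, F.imin ≤ i ∧ i ≤ F.imax ∧ i ≤ j ∧ z = x + (2 : ℝ) ^ i := by
  have key : ∀ {x z : ℝ}, F.Adj x z → 0 ≤ x → z ≤ 2 * 2 ^ F.p * (2 : ℝ) ^ j →
      ∃ i : ℤ, F.imin ≤ i ∧ i ≤ F.imax ∧ i ≤ j ∧ z = x + (2 : ℝ) ^ i := by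
    intro x z h hx hz
    obtain ⟨n, i, h1, h2, -, -, h5, rfl, rfl⟩ := h.exists_zpow hx
    refine ⟨i, h1, h2, ?_, by ring⟩
    rcases h5 with h5 | h5
    · omega
    · by_contra hij
      have h6 : (2 : ℝ) ^ (j + 1) ≤ (2 : ℝ) ^ i := zpow_le_zpow_right₀ (by norm_num) (by omega)
      rw [two_zpow_succ] at h6
      have h7 : (2 : ℝ) ^ F.p ≤ n := by exact_mod_cast h5
      have hp : (0 : ℝ) < 2 ^ F.p := by positivity
      nlinarith [two_zpow_pos i, mul_le_mul_of_nonneg_left h6 hp.le]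
  rcases le_or_gt 0 x with hx0 | hx0
  · exact key h hx0 hz
  · have hz0 : 0 ≤ -z := by
      rcases h.le_or_le 0 F.isFloat_zero with h | h <;> linarith
    obtain ⟨i, h1, h2, h3, h4⟩ := key h.neg hz0 (by linarith)
    exact ⟨i, h1, h2, h3, by linarith⟩

/-- Induction along the floats of an interval. -/
theorem up_induction {P : ℝ → Prop} {x y : ℝ} (hx : F.IsFloat x) (hy : F.IsFloat y) (hxy : x ≤ y)
    (base : P x) (step : ∀ w z, F.Adj w z → x ≤ w → z ≤ y → P w → P z) : P y := by
  obtain ⟨w, ⟨hw, hxw, hwy, hPw⟩, hmax⟩ := Set.exists_max_image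
    {w | F.IsFloat w ∧ x ≤ w ∧ w ≤ y ∧ P w} id
    (F.finite_isFloat.subset fun w hw => hw.1) ⟨x, hx, le_rfl, hxy, base⟩
  rcases hwy.eq_or_lt with rfl | hlt
  · exact hPw
  obtain ⟨z, ⟨hz, hwz⟩, hmin⟩ := Set.exists_min_image {z | F.IsFloat z ∧ w < z} id
    (F.finite_isFloat.subset fun w hw => hw.1) ⟨y, hy, hlt⟩
  have hzy : z ≤ y := hmin y ⟨hy, hlt⟩
  have hadj : F.Adj w z := ⟨hw, hz, hwz, fun v hv => by
    by_cases h : v ≤ w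
    · exact Or.inl h
    · exact Or.inr (hmin v ⟨hv, not_le.mp h⟩)⟩
  have := hmax z ⟨hz, hxw.trans hwz.le, hzy, step w z hadj hxw hzy hPw⟩
  exact absurd this (not_le.mpr hwz)

/-! ### Rounding -/

/-- The rounding of a real number to a finite float, as a real number. -/
noncomputable def rd (F : FloatFormat) (x : ℝ) : ℝ := (F.nearest x).val

theorem isNearestEven_nearest (F : FloatFormat) (x : ℝ) : F.IsNearestEven x (F.nearest x) :=
  Classical.choose_spec (F.exists_isNearestEven x)

theorem isFloat_rd (F : FloatFormat) (x : ℝ) : F.IsFloat (F.rd x) := (F.nearest x).2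

theorem abs_sub_rd_le (x : ℝ) {z : ℝ} (hz : F.IsFloat z) : |x - F.rd x| ≤ |x - z| :=
  (F.isNearestEven_nearest x).1 ⟨z, hz⟩

theorem isEvenFloat_rd {x z : ℝ} (hz : F.IsFloat z) (hne : z ≠ F.rd x)
    (h : |x - z| = |x - F.rd x|) : F.IsEvenFloat (F.rd x) :=
  (F.isNearestEven_nearest x).2 ⟨⟨z, hz⟩, fun h => hne (congrArg Subtype.val h), h⟩

theorem rd_of_isFloat {x : ℝ} (hx : F.IsFloat x) : F.rd x = x := by
  have := abs_sub_rd_le x hx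
  rw [sub_self, abs_zero] at this
  have := abs_nonpos_iff.mp this
  linarith

theorem nearest_val (x : F.Fl) : F.nearest x.val = x :=
  Subtype.ext (rd_of_isFloat x.2)

theorem nearest_rd (x : ℝ) : F.nearest (F.rd x) = F.nearest x := nearest_val _

theorem rd_mono : Monotone F.rd := by
  intro x y hxy
  by_contra h
  push Not at h
  have h1 := abs_sub_rd_le x (F.isFloat_rd y)
  have h2 := abs_sub_rd_le y (F.isFloat_rd x)
  rcases hxy.eq_or_lt with rfl | hlt
  · exact lt_irrefl _ h
  · have h3 := sq_le_sq.mpr h1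
    have h4 := sq_le_sq.mpr h2
    nlinarith

theorem rd_le {x z : ℝ} (hz : F.IsFloat z) (h : x ≤ z) : F.rd x ≤ z :=
  (rd_mono h).trans_eq (rd_of_isFloat hz)

theorem le_rd {x z : ℝ} (hz : F.IsFloat z) (h : z ≤ x) : z ≤ F.rd x :=
  (rd_of_isFloat hz).symm.le.trans (rd_mono h)

theorem Adj.le_rd {x z s : ℝ} (h : F.Adj x z) (hs : (x + z) / 2 < s) : z ≤ F.rd s := by
  rcases h.le_or_le _ (F.isFloat_rd s) with h' | h'
  · exfalso
    have h1 := sq_le_sq.mpr (abs_sub_rd_le s h.right)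
    have h2 := h.lt
    nlinarith
  · exact h'

theorem Adj.rd_le {x z s : ℝ} (h : F.Adj x z) (hs : s < (x + z) / 2) : F.rd s ≤ x := by
  rcases h.le_or_le _ (F.isFloat_rd s) with h' | h'
  · exact h'
  · exfalso
    have h1 := sq_le_sq.mpr (abs_sub_rd_le s h.left)
    have h2 := h.lt
    nlinarith

theorem Adj.le_rd_of_not_even {x z s : ℝ} (h : F.Adj x z) (ho : ¬ F.IsEvenFloat x)
    (hs : (x + z) / 2 ≤ s) : z ≤ F.rd s := by
  rcases hs.eq_or_lt with rfl | hs
  · rcases h.le_or_le _ (F.isFloat_rd ((x + z) / 2)) with h' | h'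
    · exfalso
      have hx := FloatFormat.le_rd h.left (show x ≤ (x + z) / 2 by linarith [h.lt])
      have he : F.rd ((x + z) / 2) = x := le_antisymm h' hx
      apply ho
      have := isEvenFloat_rd (x := (x + z) / 2) h.right (by rw [he]; exact h.lt.ne')
        (by rw [he, abs_of_nonpos (by linarith [h.lt]), abs_of_nonneg (by linarith [h.lt])]; ring)
      rwa [he] at this
    · exact h'
  · exact h.le_rd hs

theorem Adj.rd_le_of_not_even {x z s : ℝ} (h : F.Adj x z) (ho : ¬ F.IsEvenFloat z)
    (hs : s ≤ (x + z) / 2) : F.rd s ≤ x := by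
  rcases hs.eq_or_lt with rfl | hs
  · rcases h.le_or_le _ (F.isFloat_rd ((x + z) / 2)) with h' | h'
    · exact h'
    · exfalso
      have hx := FloatFormat.rd_le h.right (show (x + z) / 2 ≤ z by linarith [h.lt])
      have he : F.rd ((x + z) / 2) = z := le_antisymm hx h'
      apply ho
      have := isEvenFloat_rd (x := (x + z) / 2) h.left (by rw [he]; exact h.lt.ne)
        (by rw [he, abs_of_nonpos (by linarith [h.lt] : (x + z) / 2 - z ≤ 0),
              abs_of_nonneg (by linarith [h.lt])]; ring)
      rwa [he] at this
  · exact h.rd_le hs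

theorem IsEvenFloat.neg {x : ℝ} (h : F.IsEvenFloat x) : F.IsEvenFloat (-x) := by
  obtain ⟨m, hm, hlt, s, hs, h⟩ := h
  refine ⟨m, hm, hlt, -s, by rcases hs with rfl | rfl <;> simp, ?_⟩
  rcases h with ⟨e, he1, he2, rfl⟩ | rfl
  · exact Or.inl ⟨e, he1, he2, by ring⟩
  · exact Or.inr (by ring)

/-- Two consecutive floats are not both even, so ties are broken unambiguously. -/
theorem Adj.not_even {x z : ℝ} (h : F.Adj x z) : ¬ F.IsEvenFloat x ∨ ¬ F.IsEvenFloat z := by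
  have key : ∀ {x z : ℝ}, F.Adj x z → 0 ≤ x → ¬ F.IsEvenFloat x ∨ ¬ F.IsEvenFloat z := by
    intro x z h hx
    obtain ⟨n, i, h1, h2, h3, h4, h5, rfl, rfl⟩ := h.exists_zpow hx
    have hp2 : (2 : ℤ) ^ (F.p + 1) = 2 * 2 ^ F.p := by ring
    rcases Int.even_or_odd n with he | ho
    · right
      have : ((n : ℝ) + 1) = ((n + 1 : ℤ) : ℝ) := by push_cast; ring
      rw [this]
      have hlt : n + 1 < 2 ^ (F.p + 1) := by
        obtain ⟨c, rfl⟩ := he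
        omega
      refine not_isEvenFloat h1 (by rw [abs_of_nonneg (by omega)]; exact hlt) ?_ he.add_one
      rw [abs_of_nonneg (by omega)]; omega
    · left
      exact not_isEvenFloat h1 (by rwa [abs_of_nonneg h3]) (by rwa [abs_of_nonneg h3]) ho
  rcases le_or_gt 0 x with hx | hx
  · exact key h hx
  · have hz : 0 ≤ -z := by
      rcases h.le_or_le 0 F.isFloat_zero with h | h <;> linarith
    rcases key h.neg hz with h' | h'
    · exact Or.inr fun he => h' he.neg
    · exact Or.inl fun he => h' he.neg

theorem IsNearestEven.neg {x : ℝ} {y : F.Fl} (h : F.IsNearestEven x y) :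
    F.IsNearestEven (-x) ⟨-y.val, y.2.neg⟩ := by
  have e : ∀ a b : ℝ, |(-a) - (-b)| = |a - b| := fun a b => by rw [← abs_neg]; ring_nf
  have e' : ∀ a b : ℝ, |(-a) - b| = |a - -b| := fun a b => by rw [← abs_neg]; ring_nf
  refine ⟨fun z => ?_, ?_⟩
  · change |(-x) - (-y.val)| ≤ _
    rw [e, e']
    exact h.1 ⟨-z.val, z.2.neg⟩
  · rintro ⟨z, hz, hd⟩
    change _ = |(-x) - (-y.val)| at hd
    rw [e, e'] at hd
    refine (h.2 ⟨⟨-z.val, z.2.neg⟩, fun hc => hz ?_, hd⟩).neg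
    apply Subtype.ext
    have : -z.val = y.val := congrArg Subtype.val hc
    change z.val = -y.val
    linarith

theorem IsNearestEven.val_le {x : ℝ} {y z : F.Fl} (hy : F.IsNearestEven x y)
    (hz : F.IsNearestEven x z) : y.val ≤ z.val := by
  by_contra hlt
  push Not at hlt
  have heq : |x - y.val| = |x - z.val| := le_antisymm (hy.1 z) (hz.1 y)
  have hadj : F.Adj z.val y.val := by
    refine ⟨z.2, y.2, hlt, fun w hw => ?_⟩
    by_contra hc
    push Not at hc
    have h3 : |x - z.val| ≤ |x - w| := hz.1 ⟨w, hw⟩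
    rcases abs_cases (x - y.val) with h | h <;> rcases abs_cases (x - z.val) with h' | h' <;>
      rcases abs_cases (x - w) with h'' | h'' <;> linarith
  have hne : z ≠ y := fun h => hlt.ne (congrArg Fl.val h)
  rcases hadj.not_even with h | h
  · exact h (hz.2 ⟨y, hne.symm, heq⟩)
  · exact h (hy.2 ⟨z, hne, heq.symm⟩)

theorem rd_neg (x : ℝ) : F.rd (-x) = -F.rd x :=
  le_antisymm ((F.isNearestEven_nearest (-x)).val_le (F.isNearestEven_nearest x).neg)
    ((F.isNearestEven_nearest x).neg.val_le (F.isNearestEven_nearest (-x)))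

/-- A power of two is the rounding of all numbers within half of the gaps around it. -/
theorem rd_pow_eq {i : ℤ} (h1 : F.imin < i) (h2 : i ≤ F.imax) {s : ℝ}
    (hs1 : 2 ^ F.p * (2 : ℝ) ^ i - (2 : ℝ) ^ i / 4 ≤ s)
    (hs2 : s ≤ 2 ^ F.p * (2 : ℝ) ^ i + (2 : ℝ) ^ i / 2) : F.rd s = 2 ^ F.p * (2 : ℝ) ^ i := by
  have hP := F.four_le_two_pow_p_int
  have hp2 : (2 : ℤ) ^ (F.p + 1) = 2 * 2 ^ F.p := by ring
  have hev : Even ((2 : ℤ) ^ F.p) := even_two.pow_of_ne_zero (by have := F.two_le_p; omega)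
  have hi : (2 : ℝ) ^ i = 2 * (2 : ℝ) ^ (i - 1) := by rw [two_zpow_pred]; ring
  have hup := adj_zpow (F := F) (n := 2 ^ F.p) h1.le h2 (by omega) (by omega) (Or.inr le_rfl)
    (Or.inl (by omega))
  have hdown := adj_zpow (F := F) (n := 2 * 2 ^ F.p - 1) (i := i - 1) (by omega) (by omega)
    (by omega) (by omega) (Or.inr (by omega)) (Or.inr (by omega))
  push_cast at hup hdown
  apply le_antisymm
  · refine hup.rd_le_of_not_even ?_ (by linarith)
    have := not_isEvenFloat (F := F) (n := 2 ^ F.p + 1) h1.le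
      (by rw [abs_of_nonneg (by omega)]; omega) (Or.inr (by rw [abs_of_nonneg (by omega)]; omega))
      hev.add_one
    push_cast at this; exact this
  · have he : 2 ^ F.p * (2 : ℝ) ^ i = (2 * 2 ^ F.p - 1 + 1) * (2 : ℝ) ^ (i - 1) := by rw [hi]; ring
    rw [he]
    refine hdown.le_rd_of_not_even ?_ (by rw [hi] at hs1; linarith)
    have := not_isEvenFloat (F := F) (n := 2 * 2 ^ F.p - 1) (i := i - 1) (by omega)
      (by rw [abs_of_nonneg (by omega)]; omega) (Or.inr (by rw [abs_of_nonneg (by omega)]; omega))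
      ⟨2 ^ F.p - 1, by ring⟩
    push_cast at this; exact this

/-- The float with the even mantissa `2 ^ p + 2` is the rounding of all numbers within half of the
gaps around it. -/
theorem rd_pow_add_two_eq {i : ℤ} (h1 : F.imin ≤ i) (h2 : i ≤ F.imax) {s : ℝ}
    (hs1 : (2 ^ F.p + 2) * (2 : ℝ) ^ i - (2 : ℝ) ^ i / 2 ≤ s)
    (hs2 : s ≤ (2 ^ F.p + 2) * (2 : ℝ) ^ i + (2 : ℝ) ^ i / 2) :
    F.rd s = (2 ^ F.p + 2) * (2 : ℝ) ^ i := by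
  have hP := F.four_le_two_pow_p_int
  have hp2 : (2 : ℤ) ^ (F.p + 1) = 2 * 2 ^ F.p := by ring
  have hev : Even ((2 : ℤ) ^ F.p) := even_two.pow_of_ne_zero (by have := F.two_le_p; omega)
  have hup := adj_zpow (F := F) (n := 2 ^ F.p + 2) h1 h2 (by omega) (by omega) (Or.inr (by omega))
    (Or.inl (by omega))
  have hdown := adj_zpow (F := F) (n := 2 ^ F.p + 1) h1 h2 (by omega) (by omega) (Or.inr (by omega))
    (Or.inl (by omega))
  push_cast at hup hdown
  have hodd : ∀ c : ℤ, 0 ≤ c → c ≤ 3 → Odd c →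
      ¬ F.IsEvenFloat ((2 ^ F.p + c : ℤ) * (2 : ℝ) ^ i) := fun c hc0 hc ho =>
    not_isEvenFloat h1 (by rw [abs_of_nonneg (by omega)]; omega)
      (Or.inr (by rw [abs_of_nonneg (by omega)]; omega)) (hev.add_odd ho)
  apply le_antisymm
  · refine hup.rd_le_of_not_even ?_ (by linarith)
    have := hodd 3 (by norm_num) le_rfl (by decide)
    push_cast at this
    convert this using 2; ring
  · have he : (2 ^ F.p + 2) * (2 : ℝ) ^ i = (2 ^ F.p + 1 + 1) * (2 : ℝ) ^ i := by ring
    rw [he]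
    refine hdown.le_rd_of_not_even ?_ (by linarith)
    have := hodd 1 (by norm_num) (by norm_num) (by decide)
    push_cast at this
    exact this

/-! ### Steps -/

theorem two_zpow_sub_two (i : ℤ) : (2 : ℝ) ^ (i - 2) = (2 : ℝ) ^ i / 4 := by
  rw [show i - 2 = i - 1 - 1 by ring, two_zpow_pred, two_zpow_pred]; ring

/-- One positive float `a i` in each interval `(2 ^ (i - 1), 2 ^ i]`. -/
structure StepSeq (F : FloatFormat) (a : ℤ → ℝ) : Prop where
  isFloat : ∀ i, F.imin ≤ i → i ≤ F.imax → F.IsFloat (a i)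
  half_lt : ∀ i, F.imin ≤ i → i ≤ F.imax → (2 : ℝ) ^ i / 2 < a i
  le : ∀ i, F.imin ≤ i → i ≤ F.imax → a i ≤ (2 : ℝ) ^ i

/-- One rounded addition of `a i` or `-a i` to all values of a function. The bound on the values
ensures that nothing overflows. -/
def Step (F : FloatFormat) (a : ℤ → ℝ) {ι : Type} (g g' : ι → ℝ) : Prop :=
  ∃ (i : ℤ) (ε : ℝ), F.imin ≤ i ∧ i ≤ F.imax ∧ (ε = 1 ∨ ε = -1) ∧
    (∀ s, |g s| ≤ (2 ^ F.p + 2) * (2 : ℝ) ^ F.imax) ∧ g' = fun s => F.rd (g s + ε * a i)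

/-- A sequence of rounded additions of constants `± a i`. -/
def Steps (F : FloatFormat) (a : ℤ → ℝ) {ι : Type} : (ι → ℝ) → (ι → ℝ) → Prop :=
  Relation.ReflTransGen (F.Step a)

open Classical in
/-- The function with value `y` on `U` and `x` elsewhere. -/
noncomputable def twoVal {ι : Type} (U : Set ι) (x y : ℝ) : ι → ℝ := fun s => if s ∈ U then y else x

section

variable {ι : Type} {U : Set ι} {a : ℤ → ℝ} {g g' : ι → ℝ}

theorem twoVal_mem {x y : ℝ} {s : ι} (h : s ∈ U) : twoVal U x y s = y := if_pos h

theorem twoVal_not_mem {x y : ℝ} {s : ι} (h : s ∉ U) : twoVal U x y s = x := if_neg h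

theorem eq_twoVal {x y : ℝ} (h1 : ∀ s ∈ U, g s = y) (h2 : ∀ s ∉ U, g s = x) :
    g = twoVal U x y := by
  funext s
  by_cases h : s ∈ U
  · rw [twoVal_mem h, h1 s h]
  · rw [twoVal_not_mem h, h2 s h]

theorem neg_twoVal (x y : ℝ) : -twoVal U x y = twoVal U (-x) (-y) :=
  eq_twoVal (fun s h => by rw [Pi.neg_apply, twoVal_mem h])
    (fun s h => by rw [Pi.neg_apply, twoVal_not_mem h])

theorem twoVal_compl (x y : ℝ) : twoVal Uᶜ x y = twoVal U y x :=
  eq_twoVal (fun s h => twoVal_not_mem (by simpa using h)) (fun s h => twoVal_mem h)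

theorem Steps.neg (h : F.Steps a g g') : F.Steps a (-g) (-g') := by
  induction h with
  | refl => exact .refl
  | tail _ h ih =>
    refine ih.tail ?_
    obtain ⟨i, ε, h1, h2, hε, hb, rfl⟩ := h
    refine ⟨i, -ε, h1, h2, by rcases hε with rfl | rfl <;> simp,
      fun s => by rw [Pi.neg_apply, abs_neg]; exact hb s, ?_⟩
    funext s
    rw [Pi.neg_apply, ← rd_neg, Pi.neg_apply]
    congr 1; ring

theorem step_up {i : ℤ} (h1 : F.imin ≤ i) (h2 : i ≤ F.imax)
    (hg : ∀ s, |g s| ≤ (2 ^ F.p + 2) * (2 : ℝ) ^ F.imax) :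
    F.Steps a g (fun s => F.rd (g s + a i)) :=
  .single ⟨i, 1, h1, h2, Or.inl rfl, hg, by simp⟩

theorem step_down {i : ℤ} (h1 : F.imin ≤ i) (h2 : i ≤ F.imax)
    (hg : ∀ s, |g s| ≤ (2 ^ F.p + 2) * (2 : ℝ) ^ F.imax) :
    F.Steps a g (fun s => F.rd (g s - a i)) :=
  .single ⟨i, -1, h1, h2, Or.inr rfl, hg, by funext s; congr 1; ring⟩

theorem step_up_twoVal {i : ℤ} (h1 : F.imin ≤ i) (h2 : i ≤ F.imax) {x y : ℝ}
    (hx : |x| ≤ (2 ^ F.p + 2) * (2 : ℝ) ^ F.imax) (hy : |y| ≤ (2 ^ F.p + 2) * (2 : ℝ) ^ F.imax) :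
    F.Steps a (twoVal U x y) (twoVal U (F.rd (x + a i)) (F.rd (y + a i))) := by
  have := step_up (a := a) (g := twoVal U x y) h1 h2 (fun s => by
    by_cases h : s ∈ U
    · rwa [twoVal_mem h]
    · rwa [twoVal_not_mem h])
  rwa [eq_twoVal (g := fun s => F.rd (twoVal U x y s + a i)) (U := U)
    (fun s h => by rw [twoVal_mem h]) (fun s h => by rw [twoVal_not_mem h])] at this

theorem step_down_twoVal {i : ℤ} (h1 : F.imin ≤ i) (h2 : i ≤ F.imax) {x y : ℝ}
    (hx : |x| ≤ (2 ^ F.p + 2) * (2 : ℝ) ^ F.imax) (hy : |y| ≤ (2 ^ F.p + 2) * (2 : ℝ) ^ F.imax) :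
    F.Steps a (twoVal U x y) (twoVal U (F.rd (x - a i)) (F.rd (y - a i))) := by
  have := step_down (a := a) (g := twoVal U x y) h1 h2 (fun s => by
    by_cases h : s ∈ U
    · rwa [twoVal_mem h]
    · rwa [twoVal_not_mem h])
  rwa [eq_twoVal (g := fun s => F.rd (twoVal U x y s - a i)) (U := U)
    (fun s h => by rw [twoVal_mem h]) (fun s h => by rw [twoVal_not_mem h])] at this

/-! ### Moving along the floats -/

theorem StepSeq.pos (ha : F.StepSeq a) {i : ℤ} (h1 : F.imin ≤ i) (h2 : i ≤ F.imax) : 0 < a i :=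
  (by positivity : (0 : ℝ) < (2 : ℝ) ^ i / 2).trans (ha.half_lt i h1 h2)

theorem StepSeq.le_of_le (ha : F.StepSeq a) {i j : ℤ} (h1 : F.imin ≤ i) (h2 : j ≤ F.imax)
    (hij : i ≤ j) : a i ≤ (2 : ℝ) ^ j :=
  (ha.le i h1 (hij.trans h2)).trans (zpow_le_zpow_right₀ (by norm_num) hij)

theorem StepSeq.rd_add (ha : F.StepSeq a) {i : ℤ} (h1 : F.imin ≤ i) (h2 : i ≤ F.imax) {w z : ℝ}
    (h : F.Adj w z) (hz : z = w + (2 : ℝ) ^ i) : F.rd (w + a i) = z := by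
  have h3 := ha.half_lt i h1 h2
  have h4 := ha.le i h1 h2
  exact le_antisymm (FloatFormat.rd_le h.right (by linarith)) (h.le_rd (by linarith))

theorem StepSeq.rd_sub (ha : F.StepSeq a) {i : ℤ} (h1 : F.imin ≤ i) (h2 : i ≤ F.imax) {w z : ℝ}
    (h : F.Adj w z) (hz : z = w + (2 : ℝ) ^ i) : F.rd (z - a i) = w := by
  have h3 := ha.half_lt i h1 h2
  have h4 := ha.le i h1 h2
  exact le_antisymm (h.rd_le (by linarith)) (FloatFormat.le_rd h.left (by linarith))

/-- The step that raises `w` to the next float does not raise a smaller float above `w`. -/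
theorem StepSeq.rd_add_le (ha : F.StepSeq a) {i : ℤ} (h1 : F.imin ≤ i) (h2 : i ≤ F.imax) {w z x : ℝ}
    (h : F.Adj w z) (hz : z = w + (2 : ℝ) ^ i) (hx : F.IsFloat x) (hxw : x < w) :
    F.rd (x + a i) ≤ w := by
  have h4 := ha.le i h1 h2
  have hpos := two_zpow_pos i
  by_cases hc : x ≤ w - (2 : ℝ) ^ i
  · exact FloatFormat.rd_le h.left (by linarith)
  push Not at hc
  rcases le_or_gt 0 w with hw | hw
  · obtain ⟨n, k, h5, h6, h7, h8, h9, rfl, hz'⟩ := h.exists_zpow hw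
    have hik : (2 : ℝ) ^ k = (2 : ℝ) ^ i := by linarith
    have hik : k = i := zpow_right_injective₀ (by norm_num) (by norm_num) hik
    subst hik
    -- If `x` were a multiple of the gap, it would lie at least one gap below `w`.
    have hmul : ¬ ∃ m : ℤ, x = m * (2 : ℝ) ^ k := by
      rintro ⟨m, rfl⟩
      have e1 : m < n := by exact_mod_cast lt_of_mul_lt_mul_right hxw hpos.le
      have e2 : n - 1 < m := by
        have : ((n - 1 : ℤ) : ℝ) * (2 : ℝ) ^ k < m * (2 : ℝ) ^ k := by push_cast; linarith
        exact_mod_cast lt_of_mul_lt_mul_right this hpos.le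
      omega
    have hk : F.imin < k := by
      by_contra hk
      exact hmul (hx.exists_multiple (Or.inl (by omega)))
    have hn : n = 2 ^ F.p := by
      by_contra hn
      have : 2 ^ F.p ≤ n - 1 := by omega
      have : (2 : ℝ) ^ F.p ≤ n - 1 := by exact_mod_cast this
      refine hmul (hx.exists_multiple (Or.inr ?_))
      have := mul_le_mul_of_nonneg_right this hpos.le
      exact le_trans (by linarith) (le_abs_self x)
    subst hn
    push_cast at *
    have hP := F.four_le_two_pow_p
    have hk1 := two_zpow_pred k
    have : ∃ m : ℤ, x = m * (2 : ℝ) ^ (k - 1) := by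
      refine hx.exists_multiple (Or.inr (le_trans ?_ (le_abs_self x)))
      rw [hk1]
      nlinarith
    obtain ⟨m, rfl⟩ := this
    have e1 : m < 2 * 2 ^ F.p := by
      have : (m : ℝ) * (2 : ℝ) ^ (k - 1) < (2 * 2 ^ F.p : ℤ) * (2 : ℝ) ^ (k - 1) := by
        push_cast; rw [hk1] at hxw ⊢; linarith
      exact_mod_cast lt_of_mul_lt_mul_right this (two_zpow_pos _).le
    have e2 : (m : ℝ) ≤ 2 * 2 ^ F.p - 1 := by
      have : m ≤ 2 * 2 ^ F.p - 1 := by omega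
      exact_mod_cast this
    have e3 := mul_le_mul_of_nonneg_right e2 (two_zpow_pos (k - 1)).le
    rw [← rd_pow_eq hk h2 (s := 2 ^ F.p * (2 : ℝ) ^ k + (2 : ℝ) ^ k / 2) (by linarith) le_rfl]
    apply rd_mono
    rw [hk1] at e3 ⊢
    linarith
  · exfalso
    have hz0 : 0 ≤ -z := by
      rcases h.le_or_le 0 F.isFloat_zero with h | h <;> linarith
    obtain ⟨n, k, h5, h6, h7, h8, h9, h10, h11⟩ := h.neg.exists_zpow hz0
    have hik : (2 : ℝ) ^ k = (2 : ℝ) ^ i := by linarith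
    have hik : k = i := zpow_right_injective₀ (by norm_num) (by norm_num) hik
    subst hik
    obtain ⟨m, hm⟩ : ∃ m : ℤ, -x = m * (2 : ℝ) ^ k := by
      refine hx.neg.exists_multiple (h9.imp_right fun h => ?_)
      have : (2 : ℝ) ^ F.p ≤ n := by exact_mod_cast h
      have := mul_le_mul_of_nonneg_right this hpos.le
      exact le_trans (by linarith) (le_abs_self _)
    have e1 : n + 1 < m := by
      have : ((n + 1 : ℤ) : ℝ) * (2 : ℝ) ^ k < m * (2 : ℝ) ^ k := by push_cast; linarith
      exact_mod_cast lt_of_mul_lt_mul_right this hpos.le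
    have e2 : m < n + 2 := by
      have : (m : ℝ) * (2 : ℝ) ^ k < (n + 2 : ℤ) * (2 : ℝ) ^ k := by push_cast; linarith
      exact_mod_cast lt_of_mul_lt_mul_right this hpos.le
    omega

/-- The value off `U` is walked up along the floats while the value on `U` is stuck. -/
theorem walk_up (ha : F.StepSeq a) {j : ℤ} (hj : F.imin ≤ j) (hj' : j < F.imax) {x x' y : ℝ}
    (hx : F.IsFloat x) (hx' : F.IsFloat x') (hxx' : x ≤ x')
    (hlo : -(2 * 2 ^ F.p * (2 : ℝ) ^ j) ≤ x) (hhi : x' ≤ 2 * 2 ^ F.p * (2 : ℝ) ^ j)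
    (hy : |y| ≤ (2 ^ F.p + 2) * (2 : ℝ) ^ F.imax)
    (hyj : ∀ i, F.imin ≤ i → i ≤ j → F.rd (y + a i) = y) :
    F.Steps a (twoVal U x y) (twoVal U x' y) := by
  have hP := F.four_le_two_pow_p
  have hB : 2 * 2 ^ F.p * (2 : ℝ) ^ j ≤ (2 ^ F.p + 2) * (2 : ℝ) ^ F.imax := by
    have : (2 : ℝ) ^ (j + 1) ≤ (2 : ℝ) ^ F.imax := zpow_le_zpow_right₀ (by norm_num) (by omega)
    rw [two_zpow_succ] at this
    nlinarith [two_zpow_pos F.imax]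
  refine up_induction (P := fun z => F.Steps a (twoVal U x y) (twoVal U z y)) hx hx' hxx' .refl ?_
  intro w z hadj hxw hzx h
  obtain ⟨i, h1, h2, h3, h4⟩ := hadj.exists_gap_le hj (hlo.trans hxw) (hzx.trans hhi)
  have hs := step_up_twoVal (F := F) (a := a) (U := U) (x := w) (y := y) h1 h2
    (abs_le.mpr ⟨by linarith, by linarith [hadj.lt]⟩) hy
  rw [ha.rd_add h1 h2 hadj h4, hyj i h1 h3] at hs
  exact h.trans hs

theorem walk_down (ha : F.StepSeq a) {j : ℤ} (hj : F.imin ≤ j) (hj' : j < F.imax) {x x' y : ℝ}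
    (hx : F.IsFloat x) (hx' : F.IsFloat x') (hxx' : x' ≤ x)
    (hlo : -(2 * 2 ^ F.p * (2 : ℝ) ^ j) ≤ x') (hhi : x ≤ 2 * 2 ^ F.p * (2 : ℝ) ^ j)
    (hy : |y| ≤ (2 ^ F.p + 2) * (2 : ℝ) ^ F.imax)
    (hyj : ∀ i, F.imin ≤ i → i ≤ j → F.rd (y - a i) = y) :
    F.Steps a (twoVal U x y) (twoVal U x' y) := by
  have := (walk_up (U := U) ha hj hj' hx.neg hx'.neg (by linarith) (by linarith) (by linarith)
    (y := -y) (by rwa [abs_neg]) (fun i h1 h2 => by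
      rw [show -y + a i = -(y - a i) by ring, rd_neg, hyj i h1 h2])).neg
  rwa [neg_twoVal, neg_twoVal, neg_neg, neg_neg, neg_neg] at this

/-- `2 ^ emax = 2 ^ p * 2 ^ imax` is a float. -/
theorem isFloat_top (F : FloatFormat) : F.IsFloat (2 ^ F.p * (2 : ℝ) ^ F.imax) := by
  have := isFloat_two_zpow (F := F) (i := F.imax + F.p)
    (by have := F.imin_add_four_le_imax; omega) le_rfl
  rwa [zpow_add_p] at this

/-- Rounded additions of small constants keep floats in `[-2 ^ emax, 2 ^ emax]`. -/
theorem StepSeq.rd_add_mem (ha : F.StepSeq a) {i : ℤ} (h1 : F.imin ≤ i) (h2 : i < F.imax) {x : ℝ}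
    (hx : |x| ≤ 2 ^ F.p * (2 : ℝ) ^ F.imax) :
    |F.rd (x + a i)| ≤ 2 ^ F.p * (2 : ℝ) ^ F.imax := by
  have h3 := F.imin_add_four_le_imax
  have h4 := ha.le_of_le h1 (j := F.imax - 1) (by omega) (by omega)
  rw [two_zpow_pred] at h4
  have h5 := ha.pos h1 h2.le
  have hM := F.isFloat_top
  obtain ⟨h6, h7⟩ := abs_le.mp hx
  refine abs_le.mpr ⟨le_rd hM.neg (by linarith), ?_⟩
  have hpos := two_zpow_pos F.imax
  rw [← rd_pow_eq (F := F) (i := F.imax) (by omega) le_rfl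
    (s := 2 ^ F.p * (2 : ℝ) ^ F.imax + (2 : ℝ) ^ F.imax / 2) (by linarith) le_rfl]
  exact rd_mono (by linarith)

theorem two_mul_pow_mul_pred (i : ℤ) :
    2 * 2 ^ F.p * (2 : ℝ) ^ (i - 1) = 2 ^ F.p * (2 : ℝ) ^ i := by
  rw [two_zpow_pred]; ring

/-- All values off `U` are collected at `2 ^ emax` while the value on `U` is stuck. -/
theorem sweep_up (ha : F.StepSeq a) {y : ℝ} (hgU : ∀ s ∈ U, g s = y)
    (hg : ∀ s ∉ U, |g s| ≤ 2 ^ F.p * (2 : ℝ) ^ F.imax)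
    (hy : |y| ≤ (2 ^ F.p + 2) * (2 : ℝ) ^ F.imax)
    (hyj : ∀ i, F.imin ≤ i → i < F.imax → F.rd (y + a i) = y) :
    F.Steps a g (twoVal U (2 ^ F.p * (2 : ℝ) ^ F.imax) y) := by
  have hM := F.isFloat_top
  have hT := two_zpow_pos F.imax
  have h3 := F.imin_add_four_le_imax
  set M : ℝ := 2 ^ F.p * (2 : ℝ) ^ F.imax with hMdef
  have hM0 : 0 ≤ M := by positivity
  obtain ⟨g', h1, h2, h3⟩ := up_induction (F := F) (x := -M) (y := M)
    (P := fun z => ∃ g', F.Steps a g g' ∧ (∀ s ∈ U, g' s = y) ∧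
      ∀ s ∉ U, |g' s| ≤ M ∧ z ≤ g' s) hM.neg hM (by linarith)
    ⟨g, .refl, hgU, fun s hs => ⟨hg s hs, (abs_le.mp (hg s hs)).1⟩⟩ (by
      rintro w z hadj hxw hzx ⟨g', hg', hU', hL'⟩
      obtain ⟨i, h1, h2, h4, h5⟩ := hadj.exists_gap_le (j := F.imax - 1) (by omega)
        (by rwa [two_mul_pow_mul_pred]) (by rwa [two_mul_pow_mul_pred])
      refine ⟨_, hg'.trans (step_up (i := i) h1 h2 fun s => ?_), fun s hs => ?_, fun s hs => ?_⟩
      · by_cases hs : s ∈ U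
        · rwa [hU' s hs]
        · refine (hL' s hs).1.trans ?_
          rw [hMdef]; linarith
      · rw [hU' s hs, hyj i h1 (by omega)]
      · refine ⟨ha.rd_add_mem h1 (by omega) (hL' s hs).1, ?_⟩
        rw [← ha.rd_add h1 h2 hadj h5]
        exact rd_mono (by linarith [(hL' s hs).2]))
  rw [← eq_twoVal h2 fun s hs => le_antisymm (abs_le.mp (h3 s hs).1).2 (h3 s hs).2]
  exact h1

theorem sweep_down (ha : F.StepSeq a) {y : ℝ} (hgU : ∀ s ∈ U, g s = y)
    (hg : ∀ s ∉ U, |g s| ≤ 2 ^ F.p * (2 : ℝ) ^ F.imax)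
    (hy : |y| ≤ (2 ^ F.p + 2) * (2 : ℝ) ^ F.imax)
    (hyj : ∀ i, F.imin ≤ i → i < F.imax → F.rd (y - a i) = y) :
    F.Steps a g (twoVal U (-(2 ^ F.p * (2 : ℝ) ^ F.imax)) y) := by
  have := (sweep_up (g := -g) (U := U) ha (y := -y) (fun s hs => by rw [Pi.neg_apply, hgU s hs])
    (fun s hs => by rw [Pi.neg_apply, abs_neg]; exact hg s hs) (by rwa [abs_neg])
    (fun i h1 h2 => by
      rw [show -y + a i = -(y - a i) by ring, rd_neg, hyj i h1 h2])).neg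
  rwa [neg_twoVal, neg_neg, neg_neg] at this

theorem adj_pow_add {i : ℤ} (h1 : F.imin ≤ i) (h2 : i ≤ F.imax) {n : ℤ} (hn0 : 0 ≤ n)
    (hn : n < 2 ^ F.p) (htop : n + 1 < 2 ^ F.p ∨ i < F.imax) :
    F.Adj ((2 ^ F.p + n) * (2 : ℝ) ^ i) ((2 ^ F.p + n + 1) * (2 : ℝ) ^ i) := by
  have hp2 : (2 : ℤ) ^ (F.p + 1) = 2 * 2 ^ F.p := by ring
  have := adj_zpow (F := F) (n := 2 ^ F.p + n) h1 h2 (by positivity) (by omega)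
    (Or.inr (by omega)) (by omega)
  push_cast at this
  exact this

/-! ### Separating the values of a function at a threshold -/

/-- The values from a threshold on are raised to `2 ^ emax`, the others being kept below. -/
theorem exists_steps_upper (ha : F.StepSeq a) (hg : ∀ s, F.IsFloat (g s))
    (hgM : ∀ s, |g s| ≤ 2 ^ F.p * (2 : ℝ) ^ F.imax) {t : ℝ} (ht : F.IsFloat t)
    (htM : |t| ≤ 2 ^ F.p * (2 : ℝ) ^ F.imax) :
    ∃ g', F.Steps a g g' ∧ (∀ s, F.IsFloat (g' s) ∧ |g' s| ≤ 2 ^ F.p * (2 : ℝ) ^ F.imax) ∧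
      (∀ s, t ≤ g s → g' s = 2 ^ F.p * (2 : ℝ) ^ F.imax) ∧
      ∀ s, g s < t → g' s < 2 ^ F.p * (2 : ℝ) ^ F.imax := by
  have hM := F.isFloat_top
  have hT := two_zpow_pos F.imax
  have h3 := F.imin_add_four_le_imax
  set M : ℝ := 2 ^ F.p * (2 : ℝ) ^ F.imax with hMdef
  obtain ⟨g', h1, h2⟩ := up_induction (F := F) (x := t) (y := M)
    (P := fun z => ∃ g', F.Steps a g g' ∧ ∀ s, F.IsFloat (g' s) ∧ |g' s| ≤ M ∧
      (t ≤ g s → z ≤ g' s) ∧ (g s < t → g' s < z)) ht hM (abs_le.mp htM).2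
    ⟨g, .refl, fun s => ⟨hg s, hgM s, id, id⟩⟩ (by
      rintro w z hadj hxw hzx ⟨g', hg', hL'⟩
      obtain ⟨i, h1, h2, h4, h5⟩ := hadj.exists_gap_le (j := F.imax - 1) (by omega)
        (by rw [two_mul_pow_mul_pred]; exact (abs_le.mp htM).1.trans hxw)
        (by rwa [two_mul_pow_mul_pred])
      refine ⟨_, hg'.trans (step_up (i := i) h1 h2 fun s => (hL' s).2.1.trans ?_), fun s =>
        ⟨F.isFloat_rd _, ha.rd_add_mem h1 (by omega) (hL' s).2.1, fun hs => ?_, fun hs => ?_⟩⟩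
      · rw [hMdef]; linarith
      · rw [← ha.rd_add h1 h2 hadj h5]
        exact rd_mono (by linarith [(hL' s).2.2.1 hs])
      · exact (ha.rd_add_le h1 h2 hadj h5 (hL' s).1 ((hL' s).2.2.2 hs)).trans_lt hadj.lt)
  exact ⟨g', h1, fun s => ⟨(h2 s).1, (h2 s).2.1⟩,
    fun s hs => le_antisymm (abs_le.mp (h2 s).2.1).2 ((h2 s).2.2.1 hs), fun s => (h2 s).2.2.2⟩

/-- A function with values in `[-2 ^ emax, 2 ^ emax]` is brought by rounded additions of constants
to the two values `0` and `2 ^ emax`, according to whether it is below a threshold. -/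
theorem separate (ha : F.StepSeq a) (hg : ∀ s, F.IsFloat (g s))
    (hgM : ∀ s, |g s| ≤ 2 ^ F.p * (2 : ℝ) ^ F.imax) {t : ℝ} (ht : F.IsFloat t)
    (htM : |t| ≤ 2 ^ F.p * (2 : ℝ) ^ F.imax) :
    F.Steps a g (twoVal {s | t ≤ g s} 0 (2 ^ F.p * (2 : ℝ) ^ F.imax)) := by
  obtain ⟨g₁, hs₁, hfl₁, hU₁, hL₁⟩ := exists_steps_upper ha hg hgM ht htM
  have hP := F.four_le_two_pow_p
  have hPi := F.four_le_two_pow_p_int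
  have hM := F.isFloat_top
  have hT := two_zpow_pos F.imax
  have him := F.imin_add_four_le_imax
  have hTp := two_zpow_pred F.imax
  have hTpp := two_zpow_sub_two F.imax
  have hadj0 := adj_pow_add (F := F) (i := F.imax) (n := 0) (by omega) le_rfl le_rfl (by omega)
    (Or.inl (by omega))
  have hadj1 := adj_pow_add (F := F) (i := F.imax) (n := 1) (by omega) le_rfl (by omega) (by omega)
    (Or.inl (by omega))
  set U : Set ι := {s | t ≤ g s}
  have hl' : ∀ s, s ∉ U → g s < t := fun s h => not_le.mp h
  set T : ℝ := (2 : ℝ) ^ F.imax with hTdef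
  set P : ℝ := (2 : ℝ) ^ F.p
  have e0 : (P + ((0 : ℤ) : ℝ)) * T = P * T := by push_cast; ring
  have e1 : (P + ((0 : ℤ) : ℝ) + 1) * T = P * T + T := by push_cast; ring
  have e2 : (P + ((1 : ℤ) : ℝ)) * T = P * T + T := by push_cast; ring
  have e3 : (P + ((1 : ℤ) : ℝ) + 1) * T = P * T + 2 * T := by push_cast; ring
  rw [e0, e1] at hadj0
  rw [e2, e3] at hadj1
  have ht1 := ha.half_lt F.imax (by omega) le_rfl
  have ht2 := ha.le F.imax (by omega) le_rfl
  -- Raise `2 ^ emax` to the next float; the values below do not pass `2 ^ emax`.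
  have hs₂ := hs₁.trans (step_up (a := a) (i := F.imax) (by omega) le_rfl
    fun s => (hfl₁ s).2.trans (by linarith))
  have hU₂ : ∀ s ∈ U, F.rd (g₁ s + a F.imax) = P * T + T := fun s hs => by
    rw [hU₁ s hs]; exact ha.rd_add (by omega) le_rfl hadj0 rfl
  have hL₂ : ∀ s ∉ U, |F.rd (g₁ s + a F.imax)| ≤ P * T := fun s hs => by
    refine abs_le.mpr ⟨le_rd hM.neg ?_, ?_⟩
    · linarith [(abs_le.mp (hfl₁ s).2).1]
    · exact ha.rd_add_le (by omega) le_rfl hadj0 rfl (hfl₁ s).1 (hL₁ s (hl' s hs))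
  set g₂ : ι → ℝ := fun s => F.rd (g₁ s + a F.imax)
  have hsmall : ∀ i, F.imin ≤ i → i < F.imax → i ≠ F.imax - 1 → a i ≤ T / 4 := fun i h1 h2 h3 => by
    rw [← hTpp]; exact ha.le_of_le h1 (by omega) (by omega)
  have hhalf := ha.le (F.imax - 1) (by omega) (by omega)
  rw [hTp] at hhalf
  -- The upper value becomes one that small steps do not change.
  obtain ⟨y, hy, g₃, hs₃, hU₃, hL₃, hyup, hydown⟩ : ∃ y, (y = P * T + T ∨ y = P * T + 2 * T) ∧
      ∃ g₃, F.Steps a g g₃ ∧ (∀ s ∈ U, g₃ s = y) ∧ (∀ s ∉ U, |g₃ s| ≤ P * T) ∧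
      (∀ i, F.imin ≤ i → i < F.imax → F.rd (y + a i) = y) ∧
      (∀ i, F.imin ≤ i → i < F.imax → F.rd (y - a i) = y) := by
    rcases hhalf.lt_or_eq with hlt | heq
    · have hlt' : ∀ i, F.imin ≤ i → i < F.imax → a i < T / 2 := fun i h1 h2 => by
        by_cases h : i = F.imax - 1
        · rw [h]; exact hlt
        · exact (hsmall i h1 h2 h).trans_lt (by linarith)
      refine ⟨_, Or.inl rfl, g₂, hs₂, hU₂, hL₂, fun i h1 h2 => ?_, fun i h1 h2 => ?_⟩
      · have := hlt' i h1 h2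
        have := ha.pos h1 h2.le
        exact le_antisymm (hadj1.rd_le (by linarith)) (le_rd hadj1.left (by linarith))
      · have := hlt' i h1 h2
        have := ha.pos h1 h2.le
        exact le_antisymm (rd_le hadj1.left (by linarith)) (hadj0.le_rd (by linarith))
    · have hle' : ∀ i, F.imin ≤ i → i < F.imax → a i ≤ T / 2 := fun i h1 h2 => by
        by_cases h : i = F.imax - 1
        · rw [h]; exact heq.le
        · exact (hsmall i h1 h2 h).trans (by linarith)
      have hodd : ¬ F.IsEvenFloat (P * T + T) := by
        have := not_isEvenFloat (F := F) (n := 2 ^ F.p + 1) (i := F.imax) (by omega)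
          (by rw [abs_of_nonneg (by omega), pow_succ]; omega)
          (Or.inr (by rw [abs_of_nonneg (by omega)]; omega))
          (Even.add_one (even_two.pow_of_ne_zero (by have := F.two_le_p; omega)))
        push_cast at this
        convert this using 2
        change P * T + T = (P + 1) * T
        ring
      refine ⟨_, Or.inr rfl, _, hs₂.trans (step_up (a := a) (i := F.imax - 1) (by omega) (by omega)
        fun s => ?_), fun s hs => ?_, fun s hs => ?_, fun i h1 h2 => ?_, fun i h1 h2 => ?_⟩
      · by_cases hs : s ∈ U
        · rw [show g₂ s = _ from hU₂ s hs, abs_of_nonneg (by positivity)]; linarith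
        · exact (hL₂ s hs).trans (by linarith)
      · rw [show g₂ s = _ from hU₂ s hs, heq]
        exact le_antisymm (rd_le hadj1.right (by linarith))
          (hadj1.le_rd_of_not_even hodd (by linarith))
      · exact ha.rd_add_mem (by omega) (by omega) (hL₂ s hs)
      · have := hle' i h1 h2
        have := ha.pos h1 h2.le
        rw [show P * T + 2 * T = (P + 2) * T by ring]
        exact rd_pow_add_two_eq (by omega) le_rfl (by linarith) (by linarith)
      · have := hle' i h1 h2
        have := ha.pos h1 h2.le
        rw [show P * T + 2 * T = (P + 2) * T by ring]
        exact rd_pow_add_two_eq (by omega) le_rfl (by linarith) (by linarith)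
  have hyB : |y| ≤ (P + 2) * T := by
    rcases hy with rfl | rfl
    · rw [abs_of_nonneg (by positivity)]; linarith
    · rw [abs_of_nonneg (by positivity)]; linarith
  have hPT : 0 ≤ P * T := by positivity
  have hs₄ := hs₃.trans (sweep_down ha hU₃ hL₃ hyB hydown)
  have hs₅ := hs₄.trans (walk_up (U := U) ha (j := F.imax - 1) (by omega) (by omega) hM.neg
    F.isFloat_zero (by linarith) (by rw [two_mul_pow_mul_pred]) (by positivity) hyB
    fun i h1 h2 => hyup i h1 (by omega))
  -- Lower the upper value to `2 ^ emax`, and return to `0` below.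
  obtain ⟨x, hx, hx1, hx2, hs₆⟩ : ∃ x, F.IsFloat x ∧ -(2 * T) ≤ x ∧ x ≤ 0 ∧
      F.Steps a g (twoVal U x (P * T)) := by
    have h2T : F.IsFloat (2 * T) := by
      rw [hTdef, ← two_zpow_succ]; exact isFloat_two_zpow (by omega) (by have := F.two_le_p; omega)
    have h1T : F.IsFloat T := isFloat_two_zpow (by omega) (by have := F.two_le_p; omega)
    have hb : F.rd (0 - a F.imax) ≤ 0 := rd_le F.isFloat_zero (by linarith)
    have hb' : -T ≤ F.rd (0 - a F.imax) := le_rd h1T.neg (by linarith)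
    rcases hy with rfl | rfl
    · have h := hs₅.trans (step_down_twoVal (a := a) (i := F.imax) (by omega) le_rfl
        (by rw [abs_zero]; positivity) hyB)
      rw [ha.rd_sub (by omega) le_rfl hadj0 rfl] at h
      exact ⟨_, F.isFloat_rd _, by linarith, hb, h⟩
    · have h := hs₅.trans (step_down_twoVal (a := a) (i := F.imax) (by omega) le_rfl
        (by rw [abs_zero]; positivity) hyB)
      rw [ha.rd_sub (by omega) le_rfl hadj1 (by ring)] at h
      have h := h.trans (step_down_twoVal (a := a) (i := F.imax) (by omega) le_rfl
        (abs_le.mpr ⟨by linarith, by linarith⟩)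
        (by rw [abs_of_nonneg (by positivity)]; linarith))
      rw [ha.rd_sub (by omega) le_rfl hadj0 (by ring)] at h
      exact ⟨_, F.isFloat_rd _, le_rd h2T.neg (by linarith), rd_le F.isFloat_zero (by linarith), h⟩
  refine hs₆.trans (walk_up ha (j := F.imax - 1) (by omega) (by omega) hx F.isFloat_zero hx2
    (by rw [two_mul_pow_mul_pred]; nlinarith) (by positivity)
    (by rw [abs_of_nonneg hPT]; linarith) fun i h1 h2 => ?_)
  have h3 := ha.le_of_le h1 (j := F.imax - 1) (by omega) h2
  rw [hTp] at h3
  have := ha.pos h1 (by omega)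
  exact rd_pow_eq (by omega) le_rfl (by linarith) (by linarith)

end

/-! ### Bringing two values to two prescribed ones -/

section

variable {ι : Type} {U : Set ι} {a : ℤ → ℝ}

theorem StepSeq.rd_pow_add (ha : F.StepSeq a) {i j : ℤ} (h1 : F.imin ≤ j) (h2 : j < i)
    (h3 : i ≤ F.imax) : F.rd (2 ^ F.p * (2 : ℝ) ^ i + a j) = 2 ^ F.p * (2 : ℝ) ^ i := by
  have h4 := ha.le_of_le h1 (j := i - 1) (by omega) (by omega)
  rw [two_zpow_pred] at h4
  have h5 := ha.pos h1 (by omega)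
  have := two_zpow_pos i
  exact rd_pow_eq (by omega) h3 (by linarith) (by linarith)

theorem StepSeq.rd_pow_sub (ha : F.StepSeq a) {i j : ℤ} (h1 : F.imin ≤ j) (h2 : j < i - 1)
    (h3 : i ≤ F.imax) : F.rd (2 ^ F.p * (2 : ℝ) ^ i - a j) = 2 ^ F.p * (2 : ℝ) ^ i := by
  have h4 := ha.le_of_le h1 (j := i - 2) (by omega) (by omega)
  rw [two_zpow_sub_two] at h4
  have h5 := ha.pos h1 (by omega)
  have := two_zpow_pos i
  exact rd_pow_eq (by omega) h3 (by linarith) (by linarith)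

theorem isFloat_pow_mul {i : ℤ} (h1 : F.imin ≤ i) (h2 : i ≤ F.imax) :
    F.IsFloat (2 ^ F.p * (2 : ℝ) ^ i) := by
  rw [← zpow_add_p]
  exact isFloat_two_zpow (by omega) (by omega)

theorem pow_mul_le {i : ℤ} (h2 : i ≤ F.imax) :
    2 ^ F.p * (2 : ℝ) ^ i ≤ 2 ^ F.p * (2 : ℝ) ^ F.imax :=
  mul_le_mul_of_nonneg_left (zpow_le_zpow_right₀ (by norm_num) h2) (by positivity)

/-- Halving the upper value. -/
theorem steps_halve (ha : F.StepSeq a) {i : ℤ} (h1 : F.imin < i) (h2 : i < F.imax) :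
    F.Steps a (twoVal U 0 (2 ^ F.p * (2 : ℝ) ^ (i + 1))) (twoVal U 0 (2 ^ F.p * (2 : ℝ) ^ i)) := by
  have hT := two_zpow_pos F.imax
  have hv := two_zpow_pos i
  have hP := F.four_le_two_pow_p
  have hle := pow_mul_le (F := F) (i := i + 1) (by omega)
  rw [two_zpow_succ] at hle ⊢
  -- The upper value takes `2 ^ p` steps down, which lower the other one by no more.
  have hs : ∀ m : ℕ, m ≤ 2 ^ F.p → ∃ x, F.IsFloat x ∧ -(m * (2 : ℝ) ^ i) ≤ x ∧ x ≤ 0 ∧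
      F.Steps a (twoVal U 0 (2 ^ F.p * (2 * (2 : ℝ) ^ i)))
        (twoVal U x ((2 * 2 ^ F.p - m) * (2 : ℝ) ^ i)) := by
    intro m
    induction m with
    | zero =>
      intro _
      refine ⟨0, F.isFloat_zero, by simp, le_rfl, ?_⟩
      rw [show (2 * 2 ^ F.p - ((0 : ℕ) : ℝ)) * (2 : ℝ) ^ i = 2 ^ F.p * (2 * (2 : ℝ) ^ i) by
        push_cast; ring]
      exact .refl
    | succ m ih =>
      intro hm
      obtain ⟨x, hx, hx1, hx2, h⟩ := ih (by omega)
      have hm' : (m : ℝ) + 1 ≤ 2 ^ F.p := by exact_mod_cast hm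
      have hm'' : (m : ℤ) + 1 ≤ 2 ^ F.p := by exact_mod_cast hm
      have hmv : ((m : ℝ) + 1) * (2 : ℝ) ^ i ≤ 2 ^ F.p * (2 : ℝ) ^ i :=
        mul_le_mul_of_nonneg_right hm' hv.le
      have hm0 : 0 ≤ (m : ℝ) * (2 : ℝ) ^ i := by positivity
      have hadj := adj_pow_add (F := F) (i := i) (n := 2 ^ F.p - m - 1) h1.le h2.le (by omega)
        (by omega) (Or.inr h2)
      have hs := h.trans (step_down_twoVal (a := a) (i := i) h1.le h2.le
        (abs_le.mpr ⟨by linarith, by linarith⟩)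
        (abs_le.mpr ⟨by linarith, by linarith⟩))
      have e1 : (2 ^ F.p + ((2 ^ F.p - m - 1 : ℤ) : ℝ)) * (2 : ℝ) ^ i =
        (2 * 2 ^ F.p - ((m + 1 : ℕ) : ℝ)) * (2 : ℝ) ^ i := by push_cast; ring
      have e2 : (2 ^ F.p + ((2 ^ F.p - m - 1 : ℤ) : ℝ) + 1) * (2 : ℝ) ^ i =
        (2 * 2 ^ F.p - (m : ℝ)) * (2 : ℝ) ^ i := by push_cast; ring
      rw [e1, e2] at hadj
      rw [ha.rd_sub h1.le h2.le hadj (by push_cast; ring)] at hs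
      have ha1 := ha.le i h1.le h2.le
      have ha2 := ha.pos h1.le h2.le
      refine ⟨_, F.isFloat_rd _, ?_, rd_le F.isFloat_zero (by linarith), hs⟩
      have hf : F.IsFloat (-(((m + 1 : ℕ) : ℝ) * (2 : ℝ) ^ i)) := by
        have := (isFloat_zpow (F := F) (n := (m + 1 : ℕ)) h1.le h2.le (by
          rw [abs_of_nonneg (by positivity), pow_succ]; push_cast; omega)).neg
        push_cast at this ⊢
        exact this
      exact le_rd hf (by push_cast; linarith)
  obtain ⟨x, hx, hx1, hx2, h⟩ := hs (2 ^ F.p) le_rfl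
  rw [show (2 * 2 ^ F.p - ((2 ^ F.p : ℕ) : ℝ)) * (2 : ℝ) ^ i = 2 ^ F.p * (2 : ℝ) ^ i by
    push_cast; ring] at h
  push_cast at hx1
  refine h.trans (walk_up ha (j := i - 1) (by omega) (by omega) hx F.isFloat_zero hx2
    (by rw [two_mul_pow_mul_pred]; exact hx1) (by positivity)
    (by rw [abs_of_nonneg (by positivity)]; linarith)
    fun l h3 h4 => ha.rd_pow_add h3 (by omega) h2.le)

/-- The upper value may be any power of two but the smallest ones. -/
theorem steps_scale (ha : F.StepSeq a) {i : ℤ} (h1 : F.imin < i) (h2 : i ≤ F.imax) :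
    F.Steps a (twoVal U 0 (2 ^ F.p * (2 : ℝ) ^ F.imax)) (twoVal U 0 (2 ^ F.p * (2 : ℝ) ^ i)) := by
  obtain ⟨m, hm⟩ : ∃ m : ℕ, i = F.imax - m := ⟨(F.imax - i).toNat, by omega⟩
  induction m generalizing i with
  | zero =>
    rw [show i = F.imax by simpa using hm]
    exact .refl
  | succ m ih =>
    push_cast at hm
    exact (ih (i := i + 1) (by omega) (by omega) (by omega)).trans (steps_halve ha h1 (by omega))

/-- The lower value may be any float between `-2 ^ k` and `2 ^ k = 2 ^ p * 2 ^ i`, the upper value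
being `2 ^ k`, except for the very least ones. -/
theorem steps_lower_value (ha : F.StepSeq a) {i : ℤ} (h1 : F.imin < i) (h2 : i ≤ F.imax) {x : ℝ}
    (hx : F.IsFloat x) (hx1 : -(2 ^ F.p * (2 : ℝ) ^ i) + (2 : ℝ) ^ i ≤ x)
    (hx2 : x ≤ 2 ^ F.p * (2 : ℝ) ^ i) :
    F.Steps a (twoVal U 0 (2 ^ F.p * (2 : ℝ) ^ F.imax)) (twoVal U x (2 ^ F.p * (2 : ℝ) ^ i)) := by
  refine (steps_scale ha h1 h2).trans ?_
  have hP := F.four_le_two_pow_p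
  have hPi := F.four_le_two_pow_p_int
  have hv := two_zpow_pos i
  have hvp := two_zpow_pred i
  have hB : (2 ^ F.p + 2) * (2 : ℝ) ^ i ≤ (2 ^ F.p + 2) * (2 : ℝ) ^ F.imax :=
    mul_le_mul_of_nonneg_left (zpow_le_zpow_right₀ (by norm_num) h2) (by positivity)
  have ha1 := ha.half_lt i h1.le h2
  have ha2 := ha.le i h1.le h2
  have hadj0 := adj_pow_add (F := F) (i := i) (n := 0) h1.le h2 le_rfl (by omega)
    (Or.inl (by omega))
  have hadj1 := adj_pow_add (F := F) (i := i) (n := 1) h1.le h2 (by omega) (by omega)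
    (Or.inl (by omega))
  have hfl : ∀ n : ℤ, |n| ≤ 2 * 2 ^ F.p → F.IsFloat (n * ((2 : ℝ) ^ i / 2)) := fun n hn => by
    rw [← hvp]
    exact isFloat_zpow_of_lt (by omega) (by omega) (by rw [pow_succ]; linarith)
  have hstk := @rd_pow_add_two_eq F i h1.le h2
  set u : ℝ := (2 : ℝ) ^ i with hu
  set P : ℝ := (2 : ℝ) ^ F.p with hPdef
  have e0 : (P + ((0 : ℤ) : ℝ)) * u = P * u := by push_cast; ring
  have e1 : (P + ((0 : ℤ) : ℝ) + 1) * u = P * u + u := by push_cast; ring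
  have e2 : (P + ((1 : ℤ) : ℝ)) * u = P * u + u := by push_cast; ring
  have e3 : (P + ((1 : ℤ) : ℝ) + 1) * u = P * u + 2 * u := by push_cast; ring
  rw [e0, e1] at hadj0
  rw [e2, e3] at hadj1
  have hPu : 4 * u ≤ P * u := mul_le_mul_of_nonneg_right hP hv.le
  have hf2 : F.IsFloat (2 * u) := by
    have := hfl 4 (by rw [abs_of_nonneg (by norm_num)]; omega)
    convert this using 1; push_cast; ring
  have hf0 : F.IsFloat (P * u) := hadj0.left
  have hfa : F.IsFloat (-(P * u) + 2 * u) := by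
    have := hfl (-(2 * 2 ^ F.p) + 4) (by rw [abs_le]; constructor <;> omega)
    convert this using 1; push_cast; ring
  have hfb : F.IsFloat (-(P * u) + 3 * (u / 2)) := by
    have := hfl (-(2 * 2 ^ F.p) + 3) (by rw [abs_le]; constructor <;> omega)
    convert this using 1; push_cast; ring
  have hfc : F.IsFloat (-(P * u) + u) := by
    have := hfl (-(2 * 2 ^ F.p) + 2) (by rw [abs_le]; constructor <;> omega)
    convert this using 1; push_cast; ring
  -- Raise the upper value to the float with the even mantissa `2 ^ p + 2`.
  have hs₁ := step_up_twoVal (F := F) (a := a) (U := U) (i := i) (x := 0) (y := P * u) h1.le h2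
    (by rw [abs_zero]; positivity) (abs_le.mpr ⟨by linarith, by linarith⟩)
  rw [ha.rd_add h1.le h2 hadj0 rfl, zero_add, rd_of_isFloat (ha.isFloat i h1.le h2)] at hs₁
  have hs₂ := hs₁.trans (step_up_twoVal (a := a) (i := i) h1.le h2
    (abs_le.mpr ⟨by linarith, by linarith⟩) (abs_le.mpr ⟨by linarith, by linarith⟩))
  rw [ha.rd_add h1.le h2 hadj1 (by ring)] at hs₂
  have hw1 : F.rd (a i + a i) ≤ 2 * u := rd_le hf2 (by linarith)
  have hw2 : 0 ≤ F.rd (a i + a i) := le_rd F.isFloat_zero (by linarith)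
  -- There it does not move while the lower value walks down.
  have hs₃ := hs₂.trans (walk_down (U := U) ha (j := i - 1) (by omega) (by omega) (F.isFloat_rd _)
    hfa (by linarith) (by rw [two_mul_pow_mul_pred]; linarith)
    (by rw [two_mul_pow_mul_pred]; linarith) (y := P * u + 2 * u)
    (abs_le.mpr ⟨by linarith, by linarith⟩) fun l h3 h4 => by
      have h5 := ha.le_of_le h3 (j := i - 1) (by omega) h4
      rw [hvp] at h5
      have h6 := ha.pos h3 (by omega)
      rw [show P * u + 2 * u = (P + 2) * u by ring]
      exact hstk (by linarith) (by linarith))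
  have hs₄ := hs₃.trans (step_down_twoVal (a := a) (i := i) h1.le h2
    (abs_le.mpr ⟨by linarith, by linarith⟩) (abs_le.mpr ⟨by linarith, by linarith⟩))
  rw [ha.rd_sub h1.le h2 hadj1 (by ring)] at hs₄
  have hz1 : -(P * u) + u ≤ F.rd (-(P * u) + 2 * u - a i) := le_rd hfc (by linarith)
  have hz2 : F.rd (-(P * u) + 2 * u - a i) ≤ -(P * u) + 3 * (u / 2) := rd_le hfb (by linarith)
  set z := F.rd (-(P * u) + 2 * u - a i)
  have hs₅ := hs₄.trans (step_down_twoVal (a := a) (i := i) h1.le h2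
    (abs_le.mpr ⟨by linarith, by linarith⟩) (abs_le.mpr ⟨by linarith, by linarith⟩))
  rw [ha.rd_sub h1.le h2 hadj0 rfl] at hs₅
  have hw1 : F.rd (z - a i) ≤ -(P * u) + u := rd_le hfc (by linarith)
  have hw2 : -(P * u) ≤ F.rd (z - a i) := le_rd hf0.neg (by linarith)
  refine hs₅.trans (walk_up ha (j := i - 1) (by omega) (by omega) (F.isFloat_rd _) hx
    (hw1.trans hx1) (by rw [two_mul_pow_mul_pred]; linarith)
    (by rw [two_mul_pow_mul_pred]; linarith) (abs_le.mpr ⟨by linarith, by linarith⟩)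
    fun l h3 h4 => ha.rd_pow_add h3 (by omega) h2)

/-- A number within `2 ^ i / 4` of a float with exponent `i` is rounded to it; at the bottom of a
binade this is half of the smaller gap. -/
theorem rd_eq_of_near {i n : ℤ} (h1 : F.imin < i) (h2 : i ≤ F.imax) (hn1 : 2 ^ F.p ≤ n)
    (hn2 : n < 2 ^ (F.p + 1)) (htop : n = 2 ^ F.p ∨ i < F.imax) {s : ℝ}
    (hs : |s - n * (2 : ℝ) ^ i| ≤ (2 : ℝ) ^ i / 4) : F.rd s = n * (2 : ℝ) ^ i := by
  have hP := F.four_le_two_pow_p_int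
  have hv := two_zpow_pos i
  obtain ⟨h3, h4⟩ := abs_le.mp hs
  rw [pow_succ] at hn2
  rcases hn1.eq_or_lt with rfl | hlt
  · push_cast at *
    exact rd_pow_eq h1 h2 (by linarith) (by linarith)
  · have hup := adj_zpow (F := F) (n := n) h1.le h2 (by omega) (by rw [pow_succ]; omega)
      (Or.inr hlt.le) (Or.inr (by omega))
    have hdown := adj_zpow (F := F) (n := n - 1) h1.le h2 (by omega) (by rw [pow_succ]; omega)
      (Or.inr (by omega)) (Or.inr (by omega))
    push_cast at hdown
    rw [sub_add_cancel] at hdown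
    exact le_antisymm (hup.rd_le (by linarith)) (hdown.le_rd (by linarith))

/-- The lower value may be any float in `[-2 ^ (e - 1), 2 ^ (e - 1)]`, the upper value being any
float in `[2 ^ e, 2 ^ (e + 1))`. -/
theorem steps_far_values (ha : F.StepSeq a) {i n : ℤ} (h1 : F.imin + 1 < i) (h2 : i ≤ F.imax)
    (hn1 : 2 ^ F.p ≤ n) (hn2 : n < 2 ^ (F.p + 1)) (htop : n = 2 ^ F.p ∨ i < F.imax) {x : ℝ}
    (hx : F.IsFloat x) (hxb : |x| ≤ 2 ^ F.p * (2 : ℝ) ^ i / 2) :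
    F.Steps a (twoVal U 0 (2 ^ F.p * (2 : ℝ) ^ F.imax)) (twoVal U x (n * (2 : ℝ) ^ i)) := by
  have hP := F.four_le_two_pow_p
  have hPi := F.four_le_two_pow_p_int
  have hT := two_zpow_pos F.imax
  have hv := two_zpow_pos i
  have hj : 2 * 2 ^ F.p * (2 : ℝ) ^ (i - 2) = 2 ^ F.p * (2 : ℝ) ^ i / 2 := by
    rw [two_zpow_sub_two]; ring
  have hjv : (2 : ℝ) ^ i ≤ 2 ^ F.p * (2 : ℝ) ^ i / 2 := by nlinarith
  have hstk : ∀ m : ℤ, 2 ^ F.p ≤ m → m < 2 ^ (F.p + 1) → (m = 2 ^ F.p ∨ i < F.imax) →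
      |(m : ℝ) * (2 : ℝ) ^ i| ≤ (2 ^ F.p + 2) * (2 : ℝ) ^ F.imax ∧
      ∀ l, F.imin ≤ l → l ≤ i - 2 → F.rd (m * (2 : ℝ) ^ i + a l) = m * (2 : ℝ) ^ i ∧
        F.rd (m * (2 : ℝ) ^ i - a l) = m * (2 : ℝ) ^ i := by
    intro m hm1 hm2 hm
    constructor
    · have hm0 : (0 : ℝ) ≤ m := by exact_mod_cast (by omega : 0 ≤ m)
      rw [abs_of_nonneg (by positivity)]
      rcases hm with rfl | hi
      · push_cast
        have := pow_mul_le (F := F) (i := i) h2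
        linarith
      · have hle := pow_mul_le (F := F) (i := i + 1) (by omega)
        rw [two_zpow_succ] at hle
        rw [pow_succ] at hm2
        have : (m : ℝ) ≤ 2 ^ F.p * 2 := by exact_mod_cast hm2.le
        nlinarith
    · intro l h3 h4
      have h5 := ha.le_of_le h3 (j := i - 2) (by omega) h4
      rw [two_zpow_sub_two] at h5
      have h6 := ha.pos h3 (by omega)
      constructor
      · exact rd_eq_of_near (by omega) h2 hm1 hm2 hm
          (by rw [add_sub_cancel_left, abs_of_pos h6]; exact h5)
      · exact rd_eq_of_near (by omega) h2 hm1 hm2 hm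
          (by rw [sub_sub_cancel_left, abs_neg, abs_of_pos h6]; exact h5)
  -- After each step up, the lower value returns from `a i` to `0`.
  have hup : ∀ m : ℕ, 2 ^ F.p + (m : ℤ) < 2 ^ (F.p + 1) → (m = 0 ∨ i < F.imax) →
      F.Steps a (twoVal U 0 (2 ^ F.p * (2 : ℝ) ^ F.imax))
        (twoVal U 0 ((2 ^ F.p + (m : ℤ) : ℤ) * (2 : ℝ) ^ i)) := by
    intro m
    induction m with
    | zero =>
      intro _ _
      have := steps_scale (U := U) ha (i := i) (by omega) h2
      push_cast
      rwa [add_zero]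
    | succ m ih =>
      intro hm hm'
      have hi : i < F.imax := by omega
      push_cast at hm
      have hs := ih (by omega) (Or.inr hi)
      obtain ⟨hb, -⟩ := hstk (2 ^ F.p + m) (by omega) (by omega) (Or.inr hi)
      obtain ⟨hb', hst⟩ := hstk (2 ^ F.p + m + 1) (by omega) (by omega) (Or.inr hi)
      have hs := hs.trans (step_up_twoVal (a := a) (i := i) (by omega) h2
        (by rw [abs_zero]; positivity) hb)
      rw [pow_succ] at hm
      have hadj := adj_pow_add (F := F) (i := i) (n := m) (by omega) h2 (by omega) (by omega)
        (Or.inr hi)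
      have e1 : ((2 ^ F.p + (m : ℤ) : ℤ) : ℝ) * (2 : ℝ) ^ i = (2 ^ F.p + ((m : ℤ) : ℝ)) * 2 ^ i := by
        push_cast; ring
      have e2 : ((2 ^ F.p + (m : ℤ) + 1 : ℤ) : ℝ) * (2 : ℝ) ^ i =
          (2 ^ F.p + ((m : ℤ) : ℝ) + 1) * 2 ^ i := by push_cast; ring
      rw [e1, ha.rd_add (by omega) h2 hadj (by ring), ← e2, zero_add,
        rd_of_isFloat (ha.isFloat i (by omega) h2)] at hs
      have h5 := ha.le i (by omega) h2
      have h6 := ha.pos (i := i) (by omega) h2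
      have hs := hs.trans (walk_down (U := U) ha (j := i - 2) (by omega) (by omega)
        (ha.isFloat i (by omega) h2) F.isFloat_zero h6.le
        (by rw [hj]; linarith) (by rw [hj]; linarith) hb'
        fun l h3 h4 => (hst l h3 h4).2)
      push_cast at hs ⊢
      rwa [← add_assoc]
  obtain ⟨m, rfl⟩ : ∃ m : ℕ, n = 2 ^ F.p + m := ⟨(n - 2 ^ F.p).toNat, by omega⟩
  obtain ⟨hb, hst⟩ := hstk (2 ^ F.p + m) (by omega) (by omega) htop
  refine (hup m hn2 (by omega)).trans ?_
  obtain ⟨h3, h4⟩ := abs_le.mp hxb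
  rcases le_total 0 x with h | h
  · exact walk_up ha (j := i - 2) (by omega) (by omega) F.isFloat_zero hx h
      (by rw [hj]; linarith) (by rw [hj]; linarith) hb fun l h3 h4 => (hst l h3 h4).1
  · exact walk_down ha (j := i - 2) (by omega) (by omega) F.isFloat_zero hx h
      (by rw [hj]; linarith) (by rw [hj]; linarith) hb fun l h3 h4 => (hst l h3 h4).2

/-- From the values `0` and `2 ^ emax` to the values `-2 ^ emax` and `0`. -/
theorem steps_flip (ha : F.StepSeq a) :
    F.Steps a (twoVal U 0 (2 ^ F.p * (2 : ℝ) ^ F.imax))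
      (twoVal U (-(2 ^ F.p * (2 : ℝ) ^ F.imax)) 0) := by
  have him := F.imin_add_four_le_imax
  have hP := F.four_le_two_pow_p
  obtain ⟨i, hi⟩ : ∃ i, i = F.imax - 1 := ⟨_, rfl⟩
  have hI : F.imax = i + 1 := by omega
  have hv := two_zpow_pos i
  have hB : 2 * 2 ^ F.p * (2 : ℝ) ^ i ≤ (2 ^ F.p + 2) * (2 : ℝ) ^ F.imax := by
    rw [hI, two_zpow_succ]; nlinarith
  have hT : 2 ^ F.p * (2 : ℝ) ^ F.imax = 2 * 2 ^ F.p * (2 : ℝ) ^ i := by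
    rw [hI, two_zpow_succ]; ring
  have hj : 2 * 2 ^ F.p * (2 : ℝ) ^ (i - 1) = 2 ^ F.p * (2 : ℝ) ^ i := two_mul_pow_mul_pred i
  have hf : F.IsFloat (2 ^ F.p * (2 : ℝ) ^ i) := isFloat_pow_mul (by omega) (by omega)
  -- The lower value walks to `-2 ^ (emax - 1)`, the upper one staying at `2 ^ emax`.
  have hs₁ := walk_down (U := U) ha (j := i - 1) (by omega) (by omega) F.isFloat_zero hf.neg
    (by linarith [show 0 ≤ 2 ^ F.p * (2 : ℝ) ^ i by positivity]) (by rw [hj]) (by positivity)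
    (y := 2 ^ F.p * (2 : ℝ) ^ F.imax)
    (by rw [hT, abs_of_nonneg (by positivity)]; exact hB)
    fun l h3 h4 => ha.rd_pow_sub h3 (by omega) le_rfl
  -- Then both values move down by `2 ^ (emax - 1)`.
  have hs₂ : ∀ m : ℕ, m ≤ 2 ^ F.p → F.Steps a (twoVal U 0 (2 ^ F.p * (2 : ℝ) ^ F.imax))
      (twoVal U (-((2 ^ F.p + m) * (2 : ℝ) ^ i)) ((2 * 2 ^ F.p - m) * (2 : ℝ) ^ i)) := by
    intro m
    induction m with
    | zero =>
      intro _
      rw [hT] at hs₁ ⊢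
      push_cast
      rwa [add_zero, sub_zero]
    | succ m ih =>
      intro hm
      have hs := ih (by omega)
      have hm' : (m : ℝ) + 1 ≤ 2 ^ F.p := by exact_mod_cast hm
      have hm'' : (m : ℤ) + 1 ≤ 2 ^ F.p := by exact_mod_cast hm
      have hmv : ((m : ℝ) + 1) * (2 : ℝ) ^ i ≤ 2 ^ F.p * (2 : ℝ) ^ i :=
        mul_le_mul_of_nonneg_right hm' hv.le
      have hm0 : 0 ≤ (m : ℝ) * (2 : ℝ) ^ i := by positivity
      have hs := hs.trans (step_down_twoVal (a := a) (i := i) (by omega) (by omega)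
        (abs_le.mpr ⟨by linarith, by linarith⟩) (abs_le.mpr ⟨by linarith, by linarith⟩))
      have hadj := adj_pow_add (F := F) (i := i) (n := 2 ^ F.p - m - 1) (by omega) (by omega)
        (by omega) (by omega) (Or.inr (by omega))
      have hadj' := adj_pow_add (F := F) (i := i) (n := m) (by omega) (by omega)
        (by omega) (by omega) (Or.inr (by omega))
      have e1 : (2 ^ F.p + ((2 ^ F.p - m - 1 : ℤ) : ℝ)) * (2 : ℝ) ^ i =
        (2 * 2 ^ F.p - ((m + 1 : ℕ) : ℝ)) * (2 : ℝ) ^ i := by push_cast; ring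
      have e2 : (2 ^ F.p + ((2 ^ F.p - m - 1 : ℤ) : ℝ) + 1) * (2 : ℝ) ^ i =
        (2 * 2 ^ F.p - (m : ℝ)) * (2 : ℝ) ^ i := by push_cast; ring
      rw [e1, e2] at hadj
      have e3 : (2 ^ F.p + ((m : ℤ) : ℝ) + 1) * (2 : ℝ) ^ i =
        (2 ^ F.p + ((m + 1 : ℕ) : ℝ)) * (2 : ℝ) ^ i := by push_cast; ring
      rw [e3, Int.cast_natCast] at hadj'
      rw [ha.rd_sub (by omega) (by omega) hadj (by push_cast; ring),
        show -((2 ^ F.p + (m : ℝ)) * (2 : ℝ) ^ i) - a i = -((2 ^ F.p + (m : ℝ)) * (2 : ℝ) ^ i + a i)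
          by ring, rd_neg, ha.rd_add (by omega) (by omega) hadj' (by push_cast; ring)] at hs
      exact hs
  have hs₃ := hs₂ (2 ^ F.p) le_rfl
  have e1 : (2 ^ F.p + ((2 ^ F.p : ℕ) : ℝ)) * (2 : ℝ) ^ i = 2 ^ F.p * (2 : ℝ) ^ F.imax := by
    rw [hT]; push_cast; ring
  have e2 : (2 * 2 ^ F.p - ((2 ^ F.p : ℕ) : ℝ)) * (2 : ℝ) ^ i = 2 ^ F.p * (2 : ℝ) ^ i := by
    push_cast; ring
  rw [e1, e2] at hs₃
  -- Finally the upper value walks to `0`, the lower one staying at `-2 ^ emax`.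
  have hs₄ := walk_down (U := Uᶜ) ha (j := i - 1) (by omega) (by omega) hf F.isFloat_zero
    (by positivity) (by linarith [show 0 ≤ 2 * 2 ^ F.p * (2 : ℝ) ^ (i - 1) by positivity])
    (by rw [hj]) (y := -(2 ^ F.p * (2 : ℝ) ^ F.imax))
    (by rw [abs_neg, hT, abs_of_nonneg (by positivity)]; exact hB)
    fun l h3 h4 => by
      rw [← neg_add', rd_neg, ha.rd_pow_add h3 (by omega) le_rfl]
  rw [twoVal_compl, twoVal_compl] at hs₄
  exact hs₃.trans hs₄

/-- The case `|c| ≤ d` of `exists_steps_twoVal`. -/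
theorem exists_steps_twoVal_of_abs_le (ha : F.StepSeq a) {c d : ℝ} (hc : F.IsFloat c)
    (hd : F.IsFloat d) (hcd : c < d) (hcd' : |c| ≤ d) (hdM : d ≤ 2 ^ F.p * (2 : ℝ) ^ F.imax)
    (hdiff : d - c ≤ 2 ^ F.p * (2 : ℝ) ^ F.imax) :
    ∃ x y b, F.IsFloat x ∧ F.IsFloat y ∧ F.IsFloat b ∧ x + b = c ∧ y + b = d ∧
      F.Steps a (twoVal U 0 (2 ^ F.p * (2 : ℝ) ^ F.imax)) (twoVal U x y) := by
  have him := F.imin_add_four_le_imax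
  have hPi := F.four_le_two_pow_p_int
  have hP := F.four_le_two_pow_p
  have hd0 : 0 < d := by
    obtain ⟨h1, h2⟩ := abs_le.mp hcd'
    linarith
  obtain ⟨n, i, h1, h2, h3, h4, rfl⟩ := hd.exists_zpow
  have hv := two_zpow_pos i
  have hn0 : 0 < n := by
    have : (0 : ℝ) < n := by
      by_contra hn
      push Not at hn
      nlinarith
    exact_mod_cast this
  rw [abs_of_pos hn0, pow_succ] at h3
  rw [abs_of_pos hn0] at h4
  have hlt : ∀ {m m' : ℤ} {k : ℤ}, (m : ℝ) * (2 : ℝ) ^ k < m' * (2 : ℝ) ^ k → m < m' := by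
    intro m m' k h
    exact_mod_cast lt_of_mul_lt_mul_right h (two_zpow_pos k).le
  have hle : ∀ {m m' : ℤ} {k : ℤ}, (m : ℝ) * (2 : ℝ) ^ k ≤ m' * (2 : ℝ) ^ k → m ≤ m' := by
    intro m m' k h
    exact_mod_cast le_of_mul_le_mul_right h (two_zpow_pos k)
  have hmono : ∀ {m m' : ℤ} {k : ℤ}, m ≤ m' → (m : ℝ) * (2 : ℝ) ^ k ≤ m' * (2 : ℝ) ^ k := by
    intro m m' k h
    exact mul_le_mul_of_nonneg_right (by exact_mod_cast h) (two_zpow_pos k).le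
  rcases h1.eq_or_lt with rfl | h1
  · -- Both values lie on the finest grid.
    obtain ⟨m, rfl⟩ := hc.exists_multiple (Or.inl rfl)
    have hmn : m < n := hlt hcd
    have hmn' : -n ≤ m := by
      apply hle (k := F.imin)
      have := (abs_le.mp hcd').1
      push_cast; linarith
    have e1 : ((2 * 2 ^ F.p - n + m : ℤ) : ℝ) * (2 : ℝ) ^ F.imin =
        2 ^ F.p * (2 : ℝ) ^ (F.imin + 1) - (n * (2 : ℝ) ^ F.imin - m * (2 : ℝ) ^ F.imin) := by
      rw [two_zpow_succ]; push_cast; ring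
    have hx : F.IsFloat (((2 * 2 ^ F.p - n + m : ℤ) : ℝ) * (2 : ℝ) ^ F.imin) :=
      isFloat_zpow_of_lt le_rfl (by omega) (by rw [abs_le, pow_succ]; constructor <;> omega)
    refine ⟨((2 * 2 ^ F.p - n + m : ℤ) : ℝ) * (2 : ℝ) ^ F.imin, 2 ^ F.p * (2 : ℝ) ^ (F.imin + 1),
      ((n - 2 * 2 ^ F.p : ℤ) : ℝ) * (2 : ℝ) ^ F.imin, hx, isFloat_pow_mul (by omega) (by omega),
      isFloat_zpow_of_lt le_rfl (by omega) (by rw [abs_le, pow_succ]; constructor <;> omega),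
      by push_cast; ring, by rw [two_zpow_succ]; push_cast; ring,
      steps_lower_value ha (by omega) (by omega) hx ?_ ?_⟩
    · have := hmono (k := F.imin) (show -(2 * 2 ^ F.p) + 2 ≤ 2 * 2 ^ F.p - n + m by omega)
      rw [two_zpow_succ]
      push_cast at this ⊢
      linarith
    · have := hmono (k := F.imin) (show 2 * 2 ^ F.p - n + m ≤ 2 * 2 ^ F.p by omega)
      rw [two_zpow_succ]
      push_cast at this ⊢
      linarith
  have hn1 : 2 ^ F.p ≤ n := by omega
  have hvp : (2 : ℝ) ^ i = 2 * (2 : ℝ) ^ (i - 1) := by rw [two_zpow_pred]; ring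
  by_cases hm : ∃ m : ℤ, c = m * (2 : ℝ) ^ (i - 1)
  · obtain ⟨m, rfl⟩ := hm
    have hmn : m < 2 * n := by
      apply hlt (k := i - 1)
      rw [hvp] at hcd; push_cast; linarith
    have hmn' : -(2 * n) ≤ m := by
      apply hle (k := i - 1)
      have := (abs_le.mp hcd').1
      rw [hvp] at this; push_cast; linarith
    by_cases hD : 2 * n - m ≤ 4 * 2 ^ F.p - 2
    · -- The upper value is `2 ^ e`, where `2 ^ e ≤ d < 2 ^ (e + 1)`.
      have hx : F.IsFloat (((2 * 2 ^ F.p - 2 * n + m : ℤ) : ℝ) * (2 : ℝ) ^ (i - 1)) :=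
        isFloat_zpow_of_lt (by omega) (by omega)
          (by rw [abs_le, pow_succ]; constructor <;> omega)
      refine ⟨((2 * 2 ^ F.p - 2 * n + m : ℤ) : ℝ) * (2 : ℝ) ^ (i - 1), 2 ^ F.p * (2 : ℝ) ^ i,
        ((n - 2 ^ F.p : ℤ) : ℝ) * (2 : ℝ) ^ i, hx, isFloat_pow_mul h1.le h2,
        isFloat_zpow h1.le h2 (by rw [abs_lt, pow_succ]; constructor <;> omega),
        by rw [hvp]; push_cast; ring, by push_cast; ring,
        steps_lower_value ha h1 h2 hx ?_ ?_⟩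
      · have := hmono (k := i - 1)
          (show -(2 * 2 ^ F.p) + 2 ≤ 2 * 2 ^ F.p - 2 * n + m by omega)
        rw [hvp]
        push_cast at this ⊢
        linarith
      · have := hmono (k := i - 1) (show 2 * 2 ^ F.p - 2 * n + m ≤ 2 * 2 ^ F.p by omega)
        rw [hvp]
        push_cast at this ⊢
        linarith
    · -- The upper value is `2 ^ (e + 1)`.
      push Not at hD
      have hi : i < F.imax := by
        rcases h2.eq_or_lt with rfl | h
        · exfalso
          have := hmono (k := F.imax - 1) (show 4 * 2 ^ F.p - 1 ≤ 2 * n - m by omega)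
          rw [hvp] at hdiff
          push_cast at this
          nlinarith [two_zpow_pos (F.imax - 1)]
        · exact h
      have hvs := two_zpow_succ i
      have hx : F.IsFloat (((4 * 2 ^ F.p - 2 * n + m : ℤ) : ℝ) * (2 : ℝ) ^ (i - 1)) := by
        by_cases hs : -(2 * 2 ^ F.p) ≤ 4 * 2 ^ F.p - 2 * n + m
        · exact isFloat_zpow_of_lt (by omega) (by omega)
            (by rw [abs_le, pow_succ]; constructor <;> omega)
        · -- Here `c` is so large that it is a multiple of `2 ^ i`.
          push Not at hs
          obtain ⟨m', hm'⟩ := hc.exists_multiple (k := i) (Or.inr (by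
            have := hmono (k := i - 1) (show 2 * 2 ^ F.p ≤ -m by omega)
            push_cast at this
            rw [hvp]
            exact le_trans (by linarith) (neg_le_abs _)))
          have hmm : m = 2 * m' := by
            rw [hvp, ← mul_assoc] at hm'
            have := mul_right_cancel₀ (two_zpow_pos (i - 1)).ne' hm'
            have : (m : ℝ) = 2 * m' := by linarith
            exact_mod_cast this
          have := isFloat_zpow_of_lt (F := F) (n := 2 * 2 ^ F.p - n + m') h1.le hi
            (by rw [abs_le, pow_succ]; constructor <;> omega)
          convert this using 1
          rw [hvp, hmm]; push_cast; ring
      refine ⟨((4 * 2 ^ F.p - 2 * n + m : ℤ) : ℝ) * (2 : ℝ) ^ (i - 1),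
        2 ^ F.p * (2 : ℝ) ^ (i + 1), ((n - 2 * 2 ^ F.p : ℤ) : ℝ) * (2 : ℝ) ^ i, hx,
        isFloat_pow_mul (by omega) (by omega),
        isFloat_zpow h1.le h2 (by rw [abs_lt, pow_succ]; constructor <;> omega),
        by rw [hvp]; push_cast; ring, by rw [hvs]; push_cast; ring,
        steps_lower_value ha (by omega) (by omega) hx ?_ ?_⟩
      · have := hmono (k := i - 1)
          (show -(4 * 2 ^ F.p) + 4 ≤ 4 * 2 ^ F.p - 2 * n + m by omega)
        rw [hvs, hvp]
        push_cast at this ⊢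
        linarith
      · have := hmono (k := i - 1) (show 4 * 2 ^ F.p - 2 * n + m ≤ 4 * 2 ^ F.p by omega)
        rw [hvs, hvp]
        push_cast at this ⊢
        linarith
  · -- Here `|c| < 2 ^ (e - 1)`, and no bias is needed.
    have hi : F.imin + 1 < i := by
      by_contra h
      exact hm (hc.exists_multiple (Or.inl (by omega)))
    have hcb : |c| ≤ 2 ^ F.p * (2 : ℝ) ^ i / 2 := by
      by_contra h
      push Not at h
      exact hm (hc.exists_multiple (Or.inr (by rw [two_zpow_pred]; linarith)))
    have htop : n = 2 ^ F.p ∨ i < F.imax := by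
      rcases h2.eq_or_lt with rfl | h
      · left
        have := hle (m := n) (m' := 2 ^ F.p) (k := F.imax) (by push_cast; exact hdM)
        omega
      · exact Or.inr h
    exact ⟨c, _, 0, hc, hd, F.isFloat_zero, add_zero _, add_zero _,
      steps_far_values ha hi h2 hn1 (by rw [pow_succ]; omega) htop hc hcb⟩

/-- From the two values `0 < 2 ^ emax`, rounded additions of constants and one exact addition of a
float `b` lead to any two floats `c < d` in `[-2 ^ emax, 2 ^ emax]` at distance at most
`2 ^ emax`. -/
theorem exists_steps_twoVal (ha : F.StepSeq a) {c d : ℝ} (hc : F.IsFloat c)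
    (hd : F.IsFloat d) (hcd : c < d) (hcM : |c| ≤ 2 ^ F.p * (2 : ℝ) ^ F.imax)
    (hdM : |d| ≤ 2 ^ F.p * (2 : ℝ) ^ F.imax) (hdiff : d - c ≤ 2 ^ F.p * (2 : ℝ) ^ F.imax) :
    ∃ x y b, F.IsFloat x ∧ F.IsFloat y ∧ F.IsFloat b ∧ x + b = c ∧ y + b = d ∧
      F.Steps a (twoVal U 0 (2 ^ F.p * (2 : ℝ) ^ F.imax)) (twoVal U x y) := by
  by_cases h : |c| ≤ d
  · exact exists_steps_twoVal_of_abs_le ha hc hd hcd h (abs_le.mp hdM).2 hdiff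
  · push Not at h
    have hc0 : |c| = -c := by
      rcases abs_cases c with h' | h' <;> linarith
    rw [hc0] at h hcM
    obtain ⟨x, y, b, hx, hy, hb, h1, h2, hs⟩ := exists_steps_twoVal_of_abs_le (U := Uᶜ) ha hd.neg
      hc.neg (by linarith) (by rw [abs_neg, abs_le]; constructor <;> linarith) hcM (by linarith)
    have hs := hs.neg
    rw [neg_twoVal, neg_twoVal, neg_zero, twoVal_compl, twoVal_compl] at hs
    exact ⟨-y, -x, -b, hy.neg, hx.neg, hb.neg, by linarith, by linarith, (steps_flip ha).trans hs⟩

end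

/-! ### Multiples of the values of the activation function -/

theorem emin_emax (F : FloatFormat) : F.emin = 1 - F.emax ∧ F.p + 2 ≤ F.emax := by
  have h := F.p_le
  have : (F.p : ℤ) + 3 ≤ 2 ^ (F.q - 1) := by exact_mod_cast h
  unfold emin emax
  constructor <;> omega

theorem isFloat_three_mul_zpow {j : ℤ} (h1 : F.imin ≤ j) (h2 : j < F.imax + F.p) :
    F.IsFloat (3 * (2 : ℝ) ^ j) := by
  have hp := F.two_le_p
  by_cases h : j ≤ F.imax
  · have := isFloat_zpow (F := F) (n := 3) (i := j) h1 h (by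
      have := F.four_le_two_pow_p_int
      rw [abs_of_nonneg (by norm_num), pow_succ]; omega)
    simpa using this
  · have hlt : (2 : ℤ) ^ (j - F.imax).toNat ≤ 2 ^ (F.p - 1) :=
      pow_le_pow_right₀ (by norm_num) (by omega)
    have hp' : (2 : ℤ) ^ (F.p + 1) = 4 * 2 ^ (F.p - 1) := by
      rw [show F.p + 1 = F.p - 1 + 2 by omega, pow_add]; ring
    have hpos : (0 : ℤ) < 2 ^ (F.p - 1) := by positivity
    have := isFloat_zpow (F := F) (n := 3 * 2 ^ (j - F.imax).toNat) (i := F.imax)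
      (by have := F.imin_add_four_le_imax; omega) le_rfl
      (by rw [abs_of_pos (by positivity)]; omega)
    convert this using 1
    push_cast
    rw [mul_assoc, ← zpow_natCast, ← zpow_add₀ (by norm_num)]
    congr 2; omega

/-- A number closer than `2 ^ i / 4` to `2 ^ i` is rounded into `(2 ^ i / 2, 2 ^ i]`, if it does not
exceed `2 ^ i` or if the next float after `2 ^ i` is at least `3 / 2 * 2 ^ i`. -/
theorem rd_mem_of_near {i : ℤ} (h1 : F.imin ≤ i) (h2 : i ≤ F.imax) {x : ℝ}
    (h : |x - (2 : ℝ) ^ i| < (2 : ℝ) ^ i / 4) (hi : i ≤ F.imin + 1 ∨ x ≤ (2 : ℝ) ^ i) :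
    (2 : ℝ) ^ i / 2 < F.rd x ∧ F.rd x ≤ (2 : ℝ) ^ i := by
  have hf : F.IsFloat ((2 : ℝ) ^ i) := isFloat_two_zpow h1 (by omega)
  have h3 := abs_sub_rd_le x hf
  obtain ⟨h4, h5⟩ := abs_lt.mp h
  obtain ⟨h6, h7⟩ := abs_le.mp h3
  have hlow : (2 : ℝ) ^ i / 2 < F.rd x := by linarith
  refine ⟨hlow, ?_⟩
  rcases hi with hi | hi
  · obtain ⟨m, hm⟩ := (F.isFloat_rd x).exists_multiple (k := F.imin) (Or.inl rfl)
    obtain ⟨j, -, hj⟩ := two_zpow_eq_mul h1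
    have hv := two_zpow_pos F.imin
    have hj' : i = F.imin ∨ i = F.imin + 1 := by omega
    have hup : F.rd x < 3 * (2 : ℝ) ^ i / 2 := by linarith
    rw [hm] at hup ⊢
    rcases hj' with rfl | rfl
    · have : (m : ℝ) < 3 / 2 := by nlinarith
      have : m < 2 := by
        have : (m : ℝ) < 2 := by linarith
        exact_mod_cast this
      have : (m : ℝ) ≤ 1 := by exact_mod_cast (by omega : m ≤ 1)
      nlinarith
    · rw [two_zpow_succ] at hup ⊢
      have : (m : ℝ) < 3 := by nlinarith
      have : m < 3 := by exact_mod_cast this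
      have : (m : ℝ) ≤ 2 := by exact_mod_cast (by omega : m ≤ 2)
      nlinarith
  · exact rd_le hf hi

/-- Multiples of a number in `[2 ^ emin, 5 / 4)` by floats reach all scales up to `1`. -/
theorem exists_rd_mul_mem_of_small {s : ℝ} (hs1 : (2 : ℝ) ^ F.emin ≤ s) (hs2 : s < 5 / 4) {i : ℤ}
    (h1 : F.imin ≤ i) (h2 : i ≤ 0) :
    ∃ w, F.IsFloat w ∧ (2 : ℝ) ^ i / 2 < F.rd (w * s) ∧ F.rd (w * s) ≤ (2 : ℝ) ^ i := by
  obtain ⟨hee, hpe⟩ := F.emin_emax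
  have hpi := F.two_le_p
  have him : F.imax = F.emax - F.p := rfl
  have him' : F.imin = F.emin - F.p := rfl
  have hs0 : 0 < s := (two_zpow_pos _).trans_le hs1
  have hu := two_zpow_pos i
  have hx0 : 0 < 5 / 4 * (2 : ℝ) ^ i / s := by positivity
  have hxlow : (2 : ℝ) ^ i < 5 / 4 * (2 : ℝ) ^ i / s := by
    rw [lt_div_iff₀ hs0]; nlinarith
  have hxup : 5 / 4 * (2 : ℝ) ^ i / s < (2 : ℝ) ^ (i - F.emin + 1) := by
    rw [div_lt_iff₀ hs0, two_zpow_succ, zpow_sub₀ (by norm_num)]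
    have he := two_zpow_pos F.emin
    have h3 : (2 : ℝ) ^ i ≤ (2 : ℝ) ^ i / (2 : ℝ) ^ F.emin * s := by
      rw [div_mul_eq_mul_div, le_div_iff₀ he]
      exact mul_le_mul_of_nonneg_left hs1 hu.le
    nlinarith
  -- Let `2 ^ k` be the largest power of two with `2 ^ k * s ≤ 5 / 4 * 2 ^ i`. If its product with
  -- `s` is unsuitable, then `3 / 4 * 2 ^ k` or `3 / 2 * 2 ^ k` serves instead. The two finest scales
  -- are treated apart: there the floats near `2 ^ i` are sparse, and `3 / 4 * 2 ^ k` need not be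
  -- a float.
  by_cases hi : F.imin + 2 ≤ i
  · obtain ⟨k, hk1, hk2⟩ := exists_mem_Ico_zpow hx0 (one_lt_two (α := ℝ))
    have hki : i < k + 1 := (zpow_lt_zpow_iff_right₀ one_lt_two).mp (hxlow.trans hk2)
    have hke : k < i - F.emin + 1 := (zpow_lt_zpow_iff_right₀ one_lt_two).mp (hk1.trans_lt hxup)
    rw [le_div_iff₀ hs0] at hk1
    rw [two_zpow_succ, div_lt_iff₀ hs0] at hk2
    rcases le_or_gt ((2 : ℝ) ^ k * s) ((2 : ℝ) ^ i) with hc | hc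
    · refine ⟨_, isFloat_two_zpow (i := k) (by omega) (by omega), ?_, rd_le
        (isFloat_two_zpow h1 (by omega)) hc⟩
      -- The float `3 / 4 * 2 ^ i` is closer than the floats up to `2 ^ i / 2`.
      have h34 := abs_sub_rd_le ((2 : ℝ) ^ k * s)
        (isFloat_three_mul_zpow (F := F) (j := i - 2) (by omega) (by omega))
      rw [two_zpow_sub_two] at h34
      by_contra hcon
      push Not at hcon
      rcases abs_cases ((2 : ℝ) ^ k * s - 3 * ((2 : ℝ) ^ i / 4)) with h | h <;>
        linarith [le_abs_self ((2 : ℝ) ^ k * s - F.rd ((2 : ℝ) ^ k * s))]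
    · have hw : 3 * (2 : ℝ) ^ (k - 2) * s = 3 / 4 * ((2 : ℝ) ^ k * s) := by
        rw [two_zpow_sub_two]; ring
      refine ⟨_, isFloat_three_mul_zpow (F := F) (j := k - 2) (by omega) (by omega), ?_⟩
      rw [hw]
      exact rd_mem_of_near h1 (by omega) (by rw [abs_lt]; constructor <;> linarith)
        (Or.inr (by linarith))
  · obtain ⟨k, hk1, hk2⟩ := exists_mem_Ioc_zpow hx0 (one_lt_two (α := ℝ))
    have hki : i < k + 1 := (zpow_lt_zpow_iff_right₀ one_lt_two).mp (hxlow.trans_le hk2)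
    have hke : k < i - F.emin + 1 := (zpow_lt_zpow_iff_right₀ one_lt_two).mp (hk1.trans hxup)
    rw [lt_div_iff₀ hs0] at hk1
    rw [two_zpow_succ, div_le_iff₀ hs0] at hk2
    have hkf : F.IsFloat ((2 : ℝ) ^ k) := isFloat_two_zpow (by omega) (by omega)
    rcases lt_or_ge (3 / 4 * (2 : ℝ) ^ i) ((2 : ℝ) ^ k * s) with hc | hc
    · exact ⟨_, hkf, rd_mem_of_near h1 (by omega) (by rw [abs_lt]; constructor <;> linarith)
        (Or.inl (by omega))⟩
    by_cases hi' : i = F.imin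
    · -- Here `2 ^ i` is the smallest positive float, and the only one near the product.
      have hf : F.IsFloat ((2 : ℝ) ^ i) := isFloat_two_zpow h1 (by omega)
      obtain ⟨h6, h7⟩ := abs_le.mp ((abs_sub_rd_le ((2 : ℝ) ^ k * s) hf).trans_eq
        (abs_of_nonpos (by linarith)))
      obtain ⟨m, hm⟩ := (F.isFloat_rd ((2 : ℝ) ^ k * s)).exists_multiple (k := i) (Or.inl hi')
      have hle : F.rd ((2 : ℝ) ^ k * s) ≤ (2 : ℝ) ^ i := rd_le hf (by linarith)
      refine ⟨_, hkf, ?_, hle⟩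
      rw [hm] at h6 h7 ⊢
      have : (0 : ℝ) < m := by
        by_contra hcon
        push Not at hcon
        nlinarith
      have : (1 : ℝ) ≤ m := by exact_mod_cast this
      nlinarith
    · have hw : 3 * (2 : ℝ) ^ (k - 1) * s = 3 / 2 * ((2 : ℝ) ^ k * s) := by
        rw [two_zpow_pred]; ring
      refine ⟨_, isFloat_three_mul_zpow (F := F) (j := k - 1) (by omega) (by omega), ?_⟩
      rw [hw]
      exact rd_mem_of_near h1 (by omega) (by rw [abs_lt]; constructor <;> linarith)
        (Or.inl (by omega))

/-- Multiples by floats of a float beyond the successor of `2 ^ (-p - 2)` reach all scales from `2`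
on. -/
theorem exists_rd_mul_mem_of_large {s t : ℝ} (hs : F.IsFloat s)
    (ht : F.IsFloat t) (ht' : (2 : ℝ) ^ (-(F.p : ℤ) - 2) < t) (hts : t < s) {i : ℤ}
    (h1 : 1 ≤ i) (h2 : i ≤ F.imax) :
    ∃ w, F.IsFloat w ∧ (2 : ℝ) ^ i / 2 < F.rd (w * s) ∧ F.rd (w * s) ≤ (2 : ℝ) ^ i := by
  obtain ⟨hee, hpe⟩ := F.emin_emax
  have hpi := F.two_le_p
  have him : F.imax = F.emax - F.p := rfl
  have him' : F.imin = F.emin - F.p := rfl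
  have hs0 : 0 < s := ((two_zpow_pos _).trans ht').trans hts
  have hu := two_zpow_pos i
  have hP := F.four_le_two_pow_p
  have hPi := F.four_le_two_pow_p_int
  have hf : F.IsFloat ((2 : ℝ) ^ i) := isFloat_two_zpow (by omega) (by omega)
  have hT := two_zpow_pos F.imax
  rcases le_or_gt (F.Omega * s) ((2 : ℝ) ^ i) with hc | hc
  · refine ⟨_, F.isFloat_Omega, ?_, rd_le hf hc⟩
    -- Both `t` and `s` are multiples of `2 ^ g`, where `g = -2 * p - 2`. As `2 ^ p * 2 ^ g < t < s`,
    -- it follows that `(2 ^ p + 2) * 2 ^ g ≤ s`, so `Ω * s` lies beyond the midpoint between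
    -- `2 ^ imax / 2` and the next float.
    obtain ⟨g, hg⟩ : ∃ g, g = -2 * (F.p : ℤ) - 2 := ⟨_, rfl⟩
    have hg0 := two_zpow_pos g
    have hPg : (2 : ℝ) ^ (-(F.p : ℤ) - 2) = 2 ^ F.p * (2 : ℝ) ^ g := by
      rw [← zpow_add_p]; congr 1; omega
    rw [hPg] at ht'
    obtain ⟨m, rfl⟩ := ht.exists_multiple (k := g) (Or.inr (ht'.le.trans (le_abs_self _)))
    obtain ⟨m', rfl⟩ := hs.exists_multiple (k := g)
      (Or.inr ((ht'.trans hts).le.trans (le_abs_self _)))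
    have hm : (2 : ℤ) ^ F.p < m := by exact_mod_cast lt_of_mul_lt_mul_right ht' hg0.le
    have hm' : m < m' := by exact_mod_cast lt_of_mul_lt_mul_right hts hg0.le
    have hm'' : (2 : ℝ) ^ F.p + 2 ≤ m' := by exact_mod_cast (by omega : 2 ^ F.p + 2 ≤ m')
    have hq : (2 : ℝ) ^ (F.imax - 1 - F.p) = 2 * 2 ^ F.p * (2 : ℝ) ^ F.imax * (2 : ℝ) ^ g := by
      have : (2 : ℝ) ^ (F.imax - 1 - F.p) = (2 : ℝ) ^ (F.imax + g + 1 + F.p) := by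
        congr 1; omega
      rw [this, zpow_add_p, two_zpow_succ, zpow_add₀ (by norm_num)]; ring
    have hh : 2 ^ F.p * (2 : ℝ) ^ (F.imax - 1 - F.p) = (2 : ℝ) ^ F.imax / 2 := by
      rw [← zpow_add_p, sub_add_cancel, two_zpow_pred]
    have hadj := adj_pow_add (F := F) (i := F.imax - 1 - F.p) (n := 0) (by omega) (by omega) le_rfl
      (by omega) (Or.inl (by omega))
    push_cast at hadj
    have hle : (2 : ℝ) ^ i ≤ (2 : ℝ) ^ F.imax := zpow_le_zpow_right₀ (by norm_num) h2
    have hq0 := two_zpow_pos (F.imax - 1 - F.p)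
    have := hadj.le_rd (s := F.Omega * (m' * (2 : ℝ) ^ g)) (by
      have hΩ : (0 : ℝ) ≤ 2 * 2 ^ F.p - 1 := by linarith
      have h3 : (2 * 2 ^ F.p - 1) * (2 ^ F.p + 2) * ((2 : ℝ) ^ F.imax * (2 : ℝ) ^ g) ≤
          F.Omega * (m' * (2 : ℝ) ^ g) := by
        rw [Omega_eq]
        have := mul_le_mul_of_nonneg_left hm'' hΩ
        have := mul_le_mul_of_nonneg_right this (mul_pos hT hg0).le
        linarith
      rw [hq]
      have h4 : 0 < (2 * 2 ^ F.p - 2) * ((2 : ℝ) ^ F.imax * (2 : ℝ) ^ g) :=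
        mul_pos (by linarith) (mul_pos hT hg0)
      nlinarith)
    linarith
  · -- The largest `2 ^ k * s ≤ 2 ^ i` is a float, and `2 ^ k` is one as `2 ^ i < Ω * s`.
    have hx0 : 0 < (2 : ℝ) ^ i / s := by positivity
    obtain ⟨k, hk1, hk2⟩ := exists_mem_Ico_zpow hx0 (one_lt_two (α := ℝ))
    have hΩ : F.Omega < (2 : ℝ) ^ (F.imax + 1 + F.p) := by
      rw [zpow_add_p, two_zpow_succ, Omega_eq]; linarith
    have hkup : k < F.imax + 1 + F.p := by
      have : (2 : ℝ) ^ k < F.Omega := hk1.trans_lt (by rwa [div_lt_iff₀ hs0])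
      exact (zpow_lt_zpow_iff_right₀ one_lt_two).mp (this.trans hΩ)
    have hklow : i - (F.imax + 1 + F.p) < k + 1 := by
      have : (2 : ℝ) ^ (i - (F.imax + 1 + F.p)) ≤ (2 : ℝ) ^ i / s := by
        rw [zpow_sub₀ (by norm_num)]
        exact div_le_div_of_nonneg_left hu.le hs0
          (((le_abs_self s).trans hs.abs_le_Omega).trans hΩ.le)
      exact (zpow_lt_zpow_iff_right₀ one_lt_two).mp (this.trans_lt hk2)
    rw [le_div_iff₀ hs0] at hk1
    rw [two_zpow_succ, div_lt_iff₀ hs0] at hk2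
    have hks : F.IsFloat ((2 : ℝ) ^ k * s) := by
      obtain ⟨n, j, h3, h4, h5, h6, rfl⟩ := hs.exists_zpow
      have e : (2 : ℝ) ^ k * (n * (2 : ℝ) ^ j) = n * (2 : ℝ) ^ (j + k) := by
        rw [zpow_add₀ (by norm_num)]; ring
      rw [e] at hk1 ⊢
      have hjk := two_zpow_pos (j + k)
      refine isFloat_zpow ?_ ?_ h5
      · have h7 : (n : ℝ) < 2 ^ (F.p + 1) := by exact_mod_cast (le_abs_self n).trans_lt h5
        have h8 : (1 : ℝ) ≤ (2 : ℝ) ^ i / 2 := by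
          rw [← two_zpow_pred]; exact one_le_zpow₀ (by norm_num) (by omega)
        have h9 : (2 : ℝ) ^ (0 : ℤ) < (2 : ℝ) ^ (j + k + 1 + F.p) := by
          rw [zpow_add_p, two_zpow_succ, zpow_zero]
          rw [pow_succ] at h7
          nlinarith
        have := (zpow_lt_zpow_iff_right₀ one_lt_two).mp h9
        omega
      · rcases h6 with rfl | h6
        · omega
        · have hn0 : (0 : ℝ) < n := by
            by_contra hcon
            push Not at hcon
            nlinarith [two_zpow_pos j]
          have h7 : (2 : ℝ) ^ F.p ≤ n := by
            have : (2 : ℤ) ^ F.p ≤ n := by rwa [abs_of_pos (by exact_mod_cast hn0)] at h6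
            exact_mod_cast this
          have h8 : (2 : ℝ) ^ (j + k + F.p) ≤ (2 : ℝ) ^ i := by
            rw [zpow_add_p]
            exact (mul_le_mul_of_nonneg_right h7 hjk.le).trans hk1
          have := (zpow_le_zpow_iff_right₀ one_lt_two).mp h8
          omega
    exact ⟨_, isFloat_two_zpow (i := k) (by omega) (by omega),
      by rw [rd_of_isFloat hks]; linarith, by rw [rd_of_isFloat hks]; exact hk1⟩

/-- At every scale, one of the two values of the activation function has a multiple that can serve
as a step. -/
theorem exists_stepSeq {v₁ v₂ : F.Fl} (h1 : (2 : ℝ) ^ F.emin ≤ |v₁.val|) (h1' : |v₁.val| < 5 / 4)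
    {t : ℝ} (ht : F.IsFloat t) (ht' : (2 : ℝ) ^ (-(F.p : ℤ) - 2) < t) (h2 : t < |v₂.val|) :
    ∃ a : ℤ → ℝ, F.StepSeq a ∧ ∀ i, F.imin ≤ i → i ≤ F.imax → ∃ w : F.Fl,
      F.rd (w.val * v₁.val) = a i ∨ F.rd (w.val * v₂.val) = a i := by
  have hsgn : ∀ {v : F.Fl} {l u : ℝ}, (∃ w, F.IsFloat w ∧ l < F.rd (w * |v.val|) ∧
      F.rd (w * |v.val|) ≤ u) → ∃ w : F.Fl, l < F.rd (w.val * v.val) ∧ F.rd (w.val * v.val) ≤ u := by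
    rintro v l u ⟨w, hw, h⟩
    rcases abs_cases v.val with h' | h'
    · rw [h'.1] at h
      exact ⟨⟨w, hw⟩, h⟩
    · rw [h'.1] at h
      refine ⟨⟨-w, hw.neg⟩, ?_⟩
      rwa [show (Fl.val ⟨-w, hw.neg⟩ : ℝ) * v.val = w * -v.val by
        change -w * v.val = _; ring]
  have habs : F.IsFloat |v₂.val| := by
    rcases abs_choice v₂.val with h | h
    · rw [h]; exact v₂.2
    · rw [h]; exact IsFloat.neg v₂.2
  have key : ∀ i : ℤ, ∃ r : ℝ, F.imin ≤ i → i ≤ F.imax →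
      ((2 : ℝ) ^ i / 2 < r ∧ r ≤ (2 : ℝ) ^ i ∧ F.IsFloat r ∧
        ∃ w : F.Fl, F.rd (w.val * v₁.val) = r ∨ F.rd (w.val * v₂.val) = r) := by
    intro i
    by_cases hi : F.imin ≤ i ∧ i ≤ F.imax
    · rcases le_or_gt i 0 with hi0 | hi0
      · obtain ⟨w, hw1, hw2⟩ := hsgn (exists_rd_mul_mem_of_small h1 h1' hi.1 hi0)
        exact ⟨_, fun _ _ => ⟨hw1, hw2, F.isFloat_rd _, w, Or.inl rfl⟩⟩
      · obtain ⟨w, hw1, hw2⟩ := hsgn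
          (exists_rd_mul_mem_of_large habs ht ht' h2 (by omega) hi.2)
        exact ⟨_, fun _ _ => ⟨hw1, hw2, F.isFloat_rd _, w, Or.inr rfl⟩⟩
    · exact ⟨0, fun h3 h4 => absurd ⟨h3, h4⟩ hi⟩
  choose a ha using key
  exact ⟨a, ⟨fun i h3 h4 => (ha i h3 h4).2.2.1, fun i h3 h4 => (ha i h3 h4).1,
    fun i h3 h4 => (ha i h3 h4).2.1⟩, fun i h3 h4 => (ha i h3 h4).2.2.2⟩

/-! ### Rounded operations on all floats -/

/-- The float nearest to a real number, as an element of `FlBar`. -/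
noncomputable def bar (F : FloatFormat) (x : ℝ) : F.FlBar := .fin (F.nearest x)

theorem bar_val (x : F.Fl) : F.bar x.val = .fin x := congrArg _ (nearest_val x)

theorem bar_rd (x : ℝ) : F.bar (F.rd x) = F.bar x :=
  congrArg WithInfNaN.fin (nearest_rd x)

theorem round_fin_of_lt {x : ℝ} (h : |x| < F.Omega + (2 : ℝ) ^ (F.imax - 1)) :
    F.round (.fin x) = F.bar x := if_pos h

theorem round_fin_val (x : F.Fl) : F.round (.fin x.val) = .fin x := by
  rw [round_fin_of_lt, bar_val]
  exact lt_of_le_of_lt (IsFloat.abs_le_Omega x.2) (lt_add_of_pos_right _ (two_zpow_pos _))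

theorem fadd_comm (x y : F.FlBar) : fadd x y = fadd y x := by
  unfold fadd
  congr 1
  cases x <;> cases y <;> simp [FlBar.toExt, WithInfNaN.map, WithInfNaN.add, add_comm]

theorem val_nearest {x : ℝ} (hx : F.IsFloat x) : (F.nearest x).val = x := rd_of_isFloat hx

theorem fadd_bar_zero (x : F.FlBar) : fadd x (F.bar 0) = x := by
  unfold fadd bar
  cases x with
  | fin x =>
    simp only [FlBar.toExt, WithInfNaN.map, WithInfNaN.add, val_nearest F.isFloat_zero, add_zero]
    exact round_fin_val x
  | posInf => rfl
  | negInf => rfl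
  | nan => rfl

theorem bar_zero_fadd (x : F.FlBar) : fadd (F.bar 0) x = x := by
  rw [fadd_comm, fadd_bar_zero]

theorem fadd_bar_bar {x y : ℝ} (hx : F.IsFloat x) (hy : F.IsFloat y) :
    fadd (F.bar x) (F.bar y) = F.round (.fin (x + y)) := by
  simp only [fadd, bar, FlBar.toExt, WithInfNaN.map, WithInfNaN.add, val_nearest hx,
    val_nearest hy]

theorem fadd_bar {x y : ℝ} (hx : F.IsFloat x) (hy : F.IsFloat y)
    (h : |x + y| < F.Omega + (2 : ℝ) ^ (F.imax - 1)) : fadd (F.bar x) (F.bar y) = F.bar (x + y) := by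
  rw [fadd_bar_bar hx hy, round_fin_of_lt h]

/-- A product whose rounding is not extreme does not overflow. -/
theorem fmul_fin {w v : F.Fl} (h : |F.rd (w.val * v.val)| < F.Omega) :
    fmul (.fin w) (.fin v) = F.bar (w.val * v.val) := by
  refine round_fin_of_lt (lt_of_not_ge fun hge => ?_)
  have hpos := two_zpow_pos (F.imax - 1)
  have hΩ := F.isFloat_Omega
  rw [abs_lt] at h
  rcases le_total 0 (w.val * v.val) with h0 | h0
  · rw [abs_of_nonneg h0] at hge
    have := le_rd hΩ (x := w.val * v.val) (by linarith)
    linarith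
  · rw [abs_of_nonpos h0] at hge
    have := rd_le hΩ.neg (x := w.val * v.val) (by linarith)
    linarith

theorem Omega_pos (F : FloatFormat) : 0 < F.Omega := by
  rw [Omega_eq]
  have := F.four_le_two_pow_p
  have := two_zpow_pos F.imax
  nlinarith

theorem rd_zero (F : FloatFormat) : F.rd 0 = 0 := rd_of_isFloat F.isFloat_zero

theorem zero_fmul_fin (v : F.Fl) : fmul (F.bar 0) (.fin v) = F.bar 0 := by
  have h : (F.nearest 0).val = 0 := F.rd_zero
  have := fmul_fin (w := F.nearest 0) (v := v) (by
    rw [h, zero_mul, rd_zero, abs_zero]; exact F.Omega_pos)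
  rw [h, zero_mul] at this
  exact this

theorem fmul_fin_zero (w : F.Fl) {v : F.Fl} (h : v.val = 0) : fmul (.fin w) (.fin v) = F.bar 0 := by
  have := fmul_fin (w := w) (v := v) (by
    rw [h, mul_zero, rd_zero, abs_zero]; exact F.Omega_pos)
  rwa [h, mul_zero] at this

end FloatFormat

/-! ### Sequential sums in a reduction order -/

open FloatFormat in
/-- In every binary summation tree on `n` leaves some sequence of leaves `k₀, k₁, …, kₗ` is summed
sequentially when all other leaves vanish. If the leaves are themselves weighted by depths `d k`,
the sequence can be taken at least as long as in a balanced tree; the depths serve to carry out the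
induction, in which a pair of leaves becomes a single deeper leaf. -/
theorem RedOrder.exists_sequential {n : ℕ} (o : RedOrder n) : ∀ d : Fin n → ℕ,
    ∃ (k₀ : Fin n) (r : List (Fin n)), (k₀ :: r).Nodup ∧
      ∑ k, 2 ^ d k ≤ 2 ^ (d k₀ + r.length) ∧
      ∀ (F : FloatFormat) (x : Fin n → F.FlBar), (∀ k, k ∉ k₀ :: r → x k = F.bar 0) →
        o.sum x = r.foldl (fun acc k => fadd acc (x k)) (x k₀) := by
  induction o with
  | one =>
    intro d
    exact ⟨0, [], by simp, by simp, fun F x _ => rfl⟩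
  | @step n i j hij o ih =>
    intro d
    have hi : (i : ℕ) < n + 1 := by have := j.2; have : (i : ℕ) < j := hij; omega
    set emb : Fin n → Fin (n + 2) := fun k => j.succAbove ((i.castLT hi).succAbove k) with hemb
    have hji : j.succAbove (i.castLT hi) = i := by
      rw [Fin.succAbove_of_castSucc_lt]
      · rfl
      · exact hij
    have hembi : ∀ k, emb k ≠ i := fun k h => by
      exact Fin.succAbove_ne _ _ (Fin.succAbove_right_injective (h.trans hji.symm))
    have hembj : ∀ k, emb k ≠ j := fun k => Fin.succAbove_ne _ _
    have hinj : Function.Injective emb := fun k l h =>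
      Fin.succAbove_right_injective (Fin.succAbove_right_injective h)
    set lift : Fin (n + 1) → Fin (n + 2) := Fin.cons i emb with hlift
    have hliftj : ∀ k, lift k ≠ j := fun k => by
      refine Fin.cases ?_ (fun k => ?_) k
      · exact hij.ne
      · exact hembj k
    have hlifti : ∀ k, lift k = i → k = 0 := fun k => by
      refine Fin.cases (fun _ => rfl) (fun k h => ?_) k
      exact absurd h (hembi k)
    have hliftinj : Function.Injective lift := by
      rw [hlift, Fin.cons_injective_iff]
      exact ⟨fun ⟨k, hk⟩ => hembi k hk, hinj⟩
    obtain ⟨k₀, r, hnd, hsum, hx⟩ := ih (Fin.cons (max (d i) (d j) + 1) (fun k => d (emb k)))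
    have hred : ∀ (F : FloatFormat) (x : Fin (n + 2) → F.FlBar) (k), k ≠ 0 →
        reducePair x i j hij k = x (lift k) := fun F x k => by
      refine Fin.cases (fun h => absurd rfl h) (fun k _ => ?_) k
      rfl
    have hred0 : ∀ (F : FloatFormat) (x : Fin (n + 2) → F.FlBar),
        reducePair x i j hij 0 = fadd (x i) (x j) := fun _ _ => rfl
    have hpow : 2 ^ d i + 2 ^ d j ≤ 2 ^ (max (d i) (d j) + 1) := by
      have h1 := Nat.pow_le_pow_right (n := 2) (by norm_num) (le_max_left (d i) (d j))
      have h2 := Nat.pow_le_pow_right (n := 2) (by norm_num) (le_max_right (d i) (d j))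
      rw [pow_succ]; omega
    have hsum' : ∑ k, 2 ^ d k ≤
        ∑ k, 2 ^ (Fin.cons (max (d i) (d j) + 1) (fun k => d (emb k)) : Fin (n + 1) → ℕ) k := by
      rw [Fin.sum_univ_succAbove _ j, Fin.sum_univ_succAbove _ (i.castLT hi), hji,
        Fin.sum_univ_succ]
      simp only [Fin.cons_zero, Fin.cons_succ]
      change 2 ^ d j + (2 ^ d i + ∑ k, 2 ^ d (emb k)) ≤ _
      omega
    have hfold : ∀ (F : FloatFormat) (y z : Fin (n + 1) → F.FlBar) (l : List (Fin (n + 1)))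
        (c : F.FlBar), (∀ k ∈ l, y k = z k) →
        l.foldl (fun acc k => fadd acc (y k)) c = l.foldl (fun acc k => fadd acc (z k)) c := by
      intro F y z l
      induction l with
      | nil => intro c _; rfl
      | cons k l ih =>
        intro c h
        rw [List.foldl_cons, List.foldl_cons, h k (by simp)]
        exact ih _ fun k hk => h k (by simp [hk])
    by_cases h0 : k₀ = 0
    · subst h0
      have h0r : (0 : Fin (n + 1)) ∉ r := (List.nodup_cons.mp hnd).1
      -- the deeper one of the two leaves of the pair starts the sum
      obtain ⟨h, l, hhl, hd, hset⟩ : ∃ h l, h ≠ l ∧ d h = max (d i) (d j) ∧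
          ((h = i ∧ l = j) ∨ (h = j ∧ l = i)) := by
        rcases le_total (d i) (d j) with hle | hle
        · exact ⟨j, i, hij.ne', (max_eq_right hle).symm, Or.inr ⟨rfl, rfl⟩⟩
        · exact ⟨i, j, hij.ne, (max_eq_left hle).symm, Or.inl ⟨rfl, rfl⟩⟩
      have hni : i ∉ r.map lift := fun hm => by
        obtain ⟨k, hk, hki⟩ := List.mem_map.mp hm
        exact h0r (hlifti k hki ▸ hk)
      have hnj : j ∉ r.map lift := fun hm => by
        obtain ⟨k, -, hkj⟩ := List.mem_map.mp hm
        exact hliftj k hkj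
      refine ⟨h, l :: r.map lift, ?_, ?_, ?_⟩
      · have := (List.nodup_cons.mp hnd).2.map hliftinj
        rcases hset with ⟨rfl, rfl⟩ | ⟨rfl, rfl⟩ <;> simp [hhl, hni, hnj, this]
      · refine hsum'.trans (hsum.trans_eq ?_)
        simp only [Fin.cons_zero, List.length_cons, List.length_map, hd]
        congr 1; omega
      · intro F x hxz
        have e1 : fadd (x i) (x j) = fadd (x h) (x l) := by
          rcases hset with ⟨rfl, rfl⟩ | ⟨rfl, rfl⟩
          · rfl
          · exact fadd_comm _ _
        have := hx F (reducePair x i j hij) (fun k hk => by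
          rw [List.mem_cons, not_or] at hk
          rw [hred F x k hk.1]
          refine hxz _ fun hm => ?_
          have hki : lift k ≠ i := fun h => hk.1 (hlifti k h)
          have hkj := hliftj k
          simp only [List.mem_cons] at hm
          rcases hm with hm | hm | hm
          · rcases hset with ⟨rfl, rfl⟩ | ⟨rfl, rfl⟩ <;> contradiction
          · rcases hset with ⟨rfl, rfl⟩ | ⟨rfl, rfl⟩ <;> contradiction
          · obtain ⟨k', hk', he⟩ := List.mem_map.mp hm
            exact hk.2 (hliftinj he ▸ hk'))
        rw [RedOrder.sum, this, List.foldl_cons, List.foldl_map, hred0, e1]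
        exact hfold F _ (fun k => x (lift k)) _ _ fun k hk =>
          hred F x k fun h => h0r (h ▸ hk)
    · refine ⟨lift k₀, r.map lift, ?_, ?_, ?_⟩
      · have := hnd.map hliftinj
        simpa using this
      · refine hsum'.trans (hsum.trans_eq ?_)
        rw [List.length_map]
        congr 2
        revert h0
        refine Fin.cases (fun h => absurd rfl h) (fun k _ => ?_) k₀
        rfl
      · intro F x hxz
        have hxj : x j = F.bar 0 := hxz j fun hm => by
          rw [← List.map_cons] at hm
          obtain ⟨k, -, hkj⟩ := List.mem_map.mp hm
          exact hliftj k hkj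
        have hred' : ∀ k, reducePair x i j hij k = x (lift k) := fun k => by
          by_cases hk : k = 0
          · rw [hk, hred0, hxj, fadd_bar_zero]; rfl
          · exact hred F x k hk
        have := hx F (reducePair x i j hij) (fun k hk => by
          rw [hred']
          refine hxz _ fun hm => hk ?_
          rw [← List.map_cons] at hm
          obtain ⟨k', hk', he⟩ := List.mem_map.mp hm
          exact hliftinj he ▸ hk')
        rw [RedOrder.sum, this, List.foldl_map, hred']
        exact hfold F _ (fun k => x (lift k)) _ _ fun k hk => hred' k

namespace FloatFormat

variable {F : FloatFormat} {ι : Type}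

theorem sum_bar_zero {n : ℕ} (o : RedOrder n) : o.sum (fun _ => F.bar 0) = F.bar 0 := by
  obtain ⟨k₀, r, -, -, h⟩ := o.exists_sequential fun _ => 0
  rw [h F _ fun _ _ => rfl]
  clear h
  induction r with
  | nil => rfl
  | cons k r ih => rwa [List.foldl_cons, fadd_bar_zero]

/-! ### Affine layers as sequential sums -/

/-- `G'` results from `G` by sequentially adding multiples `w ⊗ h` of functions in `H`. -/
def Reach (H : Set (ι → F.Fl)) : (ι → F.FlBar) → (ι → F.FlBar) → Prop :=
  Relation.ReflTransGen fun G G' => ∃ w : F.Fl, ∃ h ∈ H,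
    G' = fun s => fadd (G s) (fmul (.fin w) (.fin (h s)))

/-- The sequential sum of multiples of functions, started at `c`. -/
noncomputable def seqSum (L : List (F.Fl × (ι → F.Fl))) (s : ι) (c : F.FlBar) : F.FlBar :=
  L.foldl (fun acc q => fadd acc (fmul (.fin q.1) (.fin (q.2 s)))) c

theorem Reach.exists_list {H : Set (ι → F.Fl)} {G G' : ι → F.FlBar} (h : Reach H G G') :
    ∃ L : List (F.Fl × (ι → F.Fl)), (∀ q ∈ L, q.2 ∈ H) ∧ ∀ s, G' s = seqSum L s (G s) := by
  induction h with
  | refl => exact ⟨[], by simp, fun s => rfl⟩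
  | tail _ h ih =>
    obtain ⟨L, hL, hG⟩ := ih
    obtain ⟨w, g, hg, rfl⟩ := h
    refine ⟨L ++ [(w, g)], ?_, fun s => ?_⟩
    · intro q hq
      rcases List.mem_append.mp hq with hq | hq
      · exact hL q hq
      · rw [List.mem_singleton.mp hq]; exact hg
    · simp [seqSum, List.foldl_append, hG s]

/-- The sums of several lists are computed by one list whose entries carry one weight per sum. -/
theorem exists_common_list {T : Type} [Finite T] [DecidableEq T] {H : Set (ι → F.Fl)}
    (L : T → List (F.Fl × (ι → F.Fl))) (hL : ∀ τ, ∀ q ∈ L τ, q.2 ∈ H) :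
    ∃ K : List ((T → F.Fl) × (ι → F.Fl)), (∀ q ∈ K, q.2 ∈ H) ∧ ∀ τ s c,
      K.foldl (fun acc q => fadd acc (fmul (.fin (q.1 τ)) (.fin (q.2 s)))) c =
        seqSum (L τ) s c := by
  have := Fintype.ofFinite T
  suffices h : ∀ A : Finset T, ∃ K : List ((T → F.Fl) × (ι → F.Fl)), (∀ q ∈ K, q.2 ∈ H) ∧
      ∀ τ s c, K.foldl (fun acc q => fadd acc (fmul (.fin (q.1 τ)) (.fin (q.2 s)))) c =
        if τ ∈ A then seqSum (L τ) s c else c by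
    obtain ⟨K, hK, h⟩ := h Finset.univ
    exact ⟨K, hK, fun τ s c => by rw [h]; simp⟩
  intro A
  induction A using Finset.induction_on with
  | empty => exact ⟨[], by simp, fun τ s c => by simp⟩
  | insert τ₀ A hτ₀ ih =>
    obtain ⟨K, hK, h⟩ := ih
    refine ⟨(L τ₀).map (fun q => (fun τ => if τ = τ₀ then q.1 else F.nearest 0, q.2)) ++ K,
      ?_, fun τ s c => ?_⟩
    · intro q hq
      rcases List.mem_append.mp hq with hq | hq
      · obtain ⟨q', hq', rfl⟩ := List.mem_map.mp hq
        exact hL τ₀ q' hq'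
      · exact hK q hq
    · rw [List.foldl_append, List.foldl_map, h]
      -- The entries for `τ₀` have weight zero in the other sums.
      by_cases hτ : τ = τ₀
      · subst hτ
        simp [hτ₀, seqSum]
      · have hid : ∀ (l : List (F.Fl × (ι → F.Fl))) (c : F.FlBar), l.foldl (fun acc q =>
            fadd acc (fmul (.fin (if τ = τ₀ then q.1 else F.nearest 0)) (.fin (q.2 s)))) c = c := by
          intro l
          induction l with
          | nil => intro c; rfl
          | cons q l ih =>
            intro c
            rw [List.foldl_cons, ih, if_neg hτ]
            exact (congrArg _ (zero_fmul_fin _)).trans (fadd_bar_zero c)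
        rw [hid]
        simp [hτ]

/-- Sums reached by sequential addition are computed by an affine layer under any reduction
order. Its width is a large power of two, and its weights vanish outside a set of inputs which the
reduction order sums sequentially. -/
theorem exists_affine (S : ReductionOrder) {n : ℕ+} {H : Set (ι → F.Fl)}
    {z : F.Fl} (hz : (fun _ => z) ∈ H)
    {G : Fin n → ι → F.FlBar} (hG : ∀ τ, Reach H (fun _ => F.bar 0) (G τ)) (b : Fin n → F.Fl) :
    ∃ (m : ℕ+) (g : Fin m → ι → F.Fl), (∀ k, g k ∈ H) ∧ ∃ A : FlAffine F m n,
      ∀ s τ, A.eval S (fun k => .fin (g k s)) τ = fadd (G τ s) (.fin (b τ)) := by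
  choose L hL hGL using fun τ => (hG τ).exists_list
  obtain ⟨K, hK, hKL⟩ := exists_common_list L hL
  obtain ⟨m, hm⟩ : ∃ m : ℕ+, (m : ℕ) = 2 ^ K.length := ⟨⟨2 ^ K.length, by positivity⟩, rfl⟩
  obtain ⟨k₀, r, hnd, hlen, hseq⟩ := (S m).exists_sequential fun _ => 0
  have hlen' : K.length ≤ r.length := by
    simp only [hm, pow_zero, Finset.sum_const, Finset.card_univ, Fintype.card_fin, zero_add,
      smul_eq_mul, mul_one] at hlen
    exact (Nat.pow_le_pow_iff_right (by norm_num)).mp hlen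
  -- the `i`-th input in sequential order carries the `i`-th entry of the list
  let e : Fin m → Option ((Fin n → F.Fl) × (ι → F.Fl)) := fun k => K[(k₀ :: r).idxOf k]?
  let e' : Option ((Fin n → F.Fl) × (ι → F.Fl)) → (Fin n → F.Fl) × (ι → F.Fl) :=
    fun q => q.getD (fun _ => F.nearest 0, fun _ => z)
  have hmap : (k₀ :: r).map e = K.map some ++ List.replicate ((k₀ :: r).length - K.length) none := by
    refine List.ext_getElem? fun i => ?_
    rw [List.getElem?_map, List.getElem?_append, List.getElem?_map, List.getElem?_replicate,
      List.length_map]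
    by_cases hi : i < (k₀ :: r).length
    · rw [List.getElem?_eq_getElem hi, Option.map_some]
      have he : e (k₀ :: r)[i] = K[i]? := by simp only [e, hnd.idxOf_getElem]
      rw [he]
      by_cases hiK : i < K.length
      · rw [if_pos hiK, List.getElem?_eq_getElem hiK, Option.map_some]
      · rw [if_neg hiK, if_pos (by omega), List.getElem?_eq_none (by omega)]
    · rw [List.getElem?_eq_none (by omega), if_neg (by rw [List.length_cons] at hi; omega),
        if_neg (by omega)]
      rfl
  refine ⟨m, fun k => (e' (e k)).2, fun k => ?_, ⟨fun τ k => (e' (e k)).1 τ, b⟩, fun s τ => ?_⟩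
  · change (e' (e k)).2 ∈ H
    rcases hek : e k with _ | q
    · exact hz
    · exact hK q (List.mem_of_getElem? hek)
  · unfold FlAffine.eval
    congr 1
    have hvan : ∀ k, k ∉ k₀ :: r → e k = none := fun k hk =>
      List.getElem?_eq_none (by
        rw [List.idxOf_eq_length_iff.mpr hk, List.length_cons]; omega)
    have hnone : fmul (.fin ((e' none).1 τ)) (.fin ((e' none).2 s)) = F.bar 0 :=
      zero_fmul_fin _
    rw [hGL, ← hKL]
    refine (hseq F _ fun k hk => ?_).trans ?_
    · change fmul (.fin ((e' (e k)).1 τ)) (.fin ((e' (e k)).2 s)) = F.bar 0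
      rw [hvan k hk]
      exact hnone
    have hstart := List.foldl_cons (l := r) (a := k₀) (b := F.bar 0)
      (f := fun acc k => fadd acc (fmul (.fin ((e' (e k)).1 τ)) (.fin ((e' (e k)).2 s))))
    rw [bar_zero_fadd] at hstart
    refine hstart.symm.trans ?_
    have hcomp := List.foldl_map (f := e) (l := k₀ :: r) (init := F.bar 0)
      (g := fun acc q => fadd acc (fmul (.fin ((e' q).1 τ)) (.fin ((e' q).2 s))))
    refine hcomp.symm.trans ?_
    rw [hmap, List.foldl_append, List.foldl_map]
    have hrep : ∀ (N : ℕ) (c : F.FlBar), (List.replicate N none).foldl (fun acc q =>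
        fadd acc (fmul (.fin ((e' q).1 τ)) (.fin ((e' q).2 s)))) c = c := by
      intro N c
      induction N with
      | zero => rfl
      | succ N ih => rwa [List.replicate_succ, List.foldl_cons, hnone, fadd_bar_zero]
    exact hrep _ _

/-- The finite hidden functions computed by one more layer from the hidden functions in `H`. -/
def nextLayer (σ : F.FlBar → F.FlBar) (H : Set (ι → F.Fl)) : Set (ι → F.Fl) :=
  {h | ∃ G b, Reach H (fun _ => F.bar 0) G ∧ ∀ s, σ (fadd (G s) (.fin b)) = .fin (h s)}

/-- The finite hidden functions computed by the first layer. -/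
def firstLayer (S : ReductionOrder) (σ : F.FlBar → F.FlBar) {d : ℕ+} (X : Set (Fin d → F.Fl)) :
    Set (X → F.Fl) :=
  {h | ∃ φ : FlAffine F d 1, ∀ x : X, σ (φ.eval S (flVec x.val) 0) = .fin (h x)}

theorem const_mem_nextLayer {σ : F.FlBar → F.FlBar} (H : Set (ι → F.Fl)) {c v : F.Fl}
    (h : σ (.fin c) = .fin v) : (fun _ => v) ∈ nextLayer σ H :=
  ⟨fun _ => F.bar 0, c, .refl, fun _ => by rw [bar_zero_fadd, h]⟩

theorem const_mem_firstLayer {S : ReductionOrder} {σ : F.FlBar → F.FlBar} {d : ℕ+}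
    (X : Set (Fin d → F.Fl)) {c v : F.Fl} (h : σ (.fin c) = .fin v) :
    (fun _ => v) ∈ firstLayer S σ X := by
  refine ⟨⟨fun _ _ => F.nearest 0, fun _ => c⟩, fun x => ?_⟩
  have : (S d).sum (fun j => fmul (F.bar 0) (flVec x.val j)) = F.bar 0 :=
    (congrArg (S d).sum (funext fun j => zero_fmul_fin _)).trans (sum_bar_zero _)
  rw [← h, ← bar_zero_fadd (.fin c), ← this]
  rfl

/-- Finitely many functions of the next layer are computed jointly from functions in `H`. -/
theorem exists_layer {S : ReductionOrder} {σ : F.FlBar → F.FlBar} {H : Set (ι → F.Fl)} {z : F.Fl}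
    (hz : (fun _ => z) ∈ H) {n : ℕ+} {g : Fin n → ι → F.Fl} (hg : ∀ τ, g τ ∈ nextLayer σ H) :
    ∃ (m : ℕ+) (g' : Fin m → ι → F.Fl), (∀ k, g' k ∈ H) ∧ ∃ A : FlAffine F m n,
      ∀ s, (fun τ => σ (A.eval S (fun k => .fin (g' k s)) τ)) = fun τ => .fin (g τ s) := by
  choose G b hG hGb using hg
  obtain ⟨m, g', hg', A, hA⟩ := exists_affine S hz hG b
  exact ⟨m, g', hg', A, fun s => funext fun τ => by rw [hA, hGb]⟩

/-- Functions that can be summed from third layer hidden functions are computed by networks. -/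
theorem exists_network {S : ReductionOrder} {σ : F.FlBar → F.FlBar} {d n : ℕ+}
    {X : Set (Fin d → F.Fl)} {c z : F.Fl} (hc : σ (.fin c) = .fin z) {f : X → Fin n → F.FlBar}
    (hf : ∀ τ, Reach (nextLayer σ (nextLayer σ (firstLayer S σ X))) (fun _ => F.bar 0)
      (fun x => f x τ)) :
    ∃ N : FlNetwork F d n 4, ∀ (x : X) (τ : Fin n), N.eval σ S (flVec x.val) τ = f x τ := by
  have hz₁ := const_mem_firstLayer (S := S) X hc
  obtain ⟨m₃, g₃, hg₃, A₄, hA₄⟩ :=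
    exists_affine S (const_mem_nextLayer _ hc) hf fun _ => F.nearest 0
  obtain ⟨m₂, g₂, hg₂, A₃, hA₃⟩ := exists_layer (S := S) (const_mem_nextLayer _ hc) hg₃
  obtain ⟨m₁, g₁, hg₁, A₂, hA₂⟩ := exists_layer (S := S) hz₁ hg₂
  choose φ hφ using hg₁
  -- The rows of the first affine map are the features found for the single coordinates.
  refine ⟨.cons ⟨fun k => (φ k).w 0, fun k => (φ k).b 0⟩ (.cons A₂ (.cons A₃ (.last A₄))),
    fun x τ => ?_⟩
  have h₁ : (fun k => σ ((⟨fun k => (φ k).w 0, fun k => (φ k).b 0⟩ : FlAffine F d m₁).eval S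
      (flVec x.val) k)) = fun k => .fin (g₁ k x) := funext fun k => hφ k x
  simp only [FlNetwork.eval]
  rw [h₁, hA₂, hA₃, hA₄]
  exact fadd_bar_zero _

end FloatFormat

/-! ### The layers of the network -/

namespace FloatFormat

variable {F : FloatFormat} {ι : Type} {a : ℤ → ℝ} {H : Set (ι → F.Fl)} {V : Set F.Fl}
  {σ : F.FlBar → F.FlBar}

/-- Every step `± a i` is a rounded product `w ⊗ v` with `v` in `V`. -/
def HasProducts (V : Set F.Fl) (a : ℤ → ℝ) : Prop :=
  ∀ i, F.imin ≤ i → i ≤ F.imax → ∀ ε : ℝ, ε = 1 ∨ ε = -1 →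
    ∃ w : F.Fl, ∃ v ∈ V, fmul (.fin w) (.fin v) = F.bar (ε * a i)

/-- The constant functions `± a i` are multiples of functions in `H`. -/
def HasSteps (H : Set (ι → F.Fl)) (a : ℤ → ℝ) : Prop :=
  ∀ i, F.imin ≤ i → i ≤ F.imax → ∀ ε : ℝ, ε = 1 ∨ ε = -1 →
    ∃ w : F.Fl, ∃ h ∈ H, ∀ s, fmul (.fin w) (.fin (h s)) = F.bar (ε * a i)

/-- For any two points `x`, `z`, some multiple of a function in `H` has only the values `0` and
`± a i`, vanishes at `x` and does not vanish at `z`. -/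
def HasBits (H : Set (ι → F.Fl)) (a : ℤ → ℝ) : Prop :=
  ∀ x z, x ≠ z → ∀ i, F.imin ≤ i → i ≤ F.imax → ∀ ε : ℝ, ε = 1 ∨ ε = -1 →
    ∃ w : F.Fl, ∃ h ∈ H, ∃ u : ι → ℝ, (∀ s, u s = 0 ∨ u s = a i) ∧ u x = 0 ∧ u z = a i ∧
      ∀ s, fmul (.fin w) (.fin (h s)) = F.bar (ε * u s)

/-- For every point `x`, the function with value `± a i` at `x` and `0` elsewhere is a multiple of
a function in `H`. -/
def HasIndicators (H : Set (ι → F.Fl)) (a : ℤ → ℝ) : Prop :=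
  ∀ x, ∀ i, F.imin ≤ i → i ≤ F.imax → ∀ ε : ℝ, ε = 1 ∨ ε = -1 →
    ∃ w : F.Fl, ∃ h ∈ H, fmul (.fin w) (.fin (h x)) = F.bar (ε * a i) ∧
      ∀ s, s ≠ x → fmul (.fin w) (.fin (h s)) = F.bar 0

theorem top_lt_Omega (F : FloatFormat) : 2 ^ F.p * (2 : ℝ) ^ F.imax < F.Omega := by
  rw [Omega_eq]
  have := F.four_le_two_pow_p
  have := two_zpow_pos F.imax
  nlinarith

theorem zpow_emax (F : FloatFormat) : (2 : ℝ) ^ F.emax = 2 ^ F.p * (2 : ℝ) ^ F.imax := by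
  rw [← zpow_add_p]; congr 1; unfold imax; omega

theorem imin_le_imax (F : FloatFormat) : F.imin ≤ F.imax := by
  have := F.imin_add_four_le_imax; omega

theorem rd_sign_mul {ε : ℝ} (hε : ε = 1 ∨ ε = -1) (x : ℝ) : F.rd (ε * x) = ε * F.rd x := by
  rcases hε with rfl | rfl
  · simp
  · simp [rd_neg]

theorem IsFloat.sign_mul {ε x : ℝ} (hε : ε = 1 ∨ ε = -1) (hx : F.IsFloat x) :
    F.IsFloat (ε * x) := by
  rw [← rd_of_isFloat hx, ← rd_sign_mul hε]
  exact F.isFloat_rd _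

theorem abs_sign_mul {ε : ℝ} (hε : ε = 1 ∨ ε = -1) (x : ℝ) : |ε * x| = |x| := by
  rcases hε with rfl | rfl <;> simp

theorem StepSeq.isFloat_sign_mul (ha : F.StepSeq a) {i : ℤ} (h1 : F.imin ≤ i) (h2 : i ≤ F.imax)
    {ε : ℝ} (hε : ε = 1 ∨ ε = -1) : F.IsFloat (ε * a i) :=
  (ha.isFloat i h1 h2).sign_mul hε

theorem StepSeq.le_top (ha : F.StepSeq a) {i : ℤ} (h1 : F.imin ≤ i) (h2 : i ≤ F.imax) :
    a i ≤ (2 : ℝ) ^ F.imax :=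
  ha.le_of_le h1 le_rfl h2

theorem hasProducts (ha : F.StepSeq a) (hV : ∀ i, F.imin ≤ i → i ≤ F.imax →
    ∃ w : F.Fl, ∃ v ∈ V, F.rd (w.val * v.val) = a i) : HasProducts V a := by
  intro i h1 h2 ε hε
  obtain ⟨w, v, hv, hwv⟩ := hV i h1 h2
  obtain ⟨w', hw⟩ : ∃ w' : F.Fl, w'.val = ε * w.val := ⟨⟨_, IsFloat.sign_mul hε w.2⟩, rfl⟩
  refine ⟨w', v, hv, ?_⟩
  have hrd : F.rd (ε * w.val * v.val) = ε * a i := by rw [mul_assoc, rd_sign_mul hε, hwv]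
  rw [fmul_fin, hw, ← bar_rd, hrd]
  rw [hw, hrd, abs_sign_mul hε, abs_of_pos (ha.pos h1 h2)]
  refine lt_of_le_of_lt (ha.le_top h1 h2) (lt_of_le_of_lt ?_ F.top_lt_Omega)
  have := F.four_le_two_pow_p
  have := two_zpow_pos F.imax
  nlinarith

theorem HasProducts.hasSteps (hV : HasProducts V a) (hH : ∀ v ∈ V, (fun _ => v) ∈ H) :
    HasSteps H a := by
  intro i h1 h2 ε hε
  obtain ⟨w, v, hv, h⟩ := hV i h1 h2 ε hε
  exact ⟨w, _, hH v hv, fun _ => h⟩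

theorem HasProducts.hasBits (hV : HasProducts V a) {v₀ : F.Fl} (h₀ : v₀.val = 0)
    (hH : ∀ v ∈ V, v₀ ≠ v ∧ ∀ x z, x ≠ z →
      ∃ h ∈ H, (∀ s, h s = v₀ ∨ h s = v) ∧ h x = v₀ ∧ h z = v) :
    HasBits H a := by
  classical
  intro x z hxz i h1 h2 ε hε
  obtain ⟨w, v, hv, hwv⟩ := hV i h1 h2 ε hε
  obtain ⟨hv₀, hH⟩ := hH v hv
  obtain ⟨h, hh, hs, hx, hz⟩ := hH x z hxz
  refine ⟨w, h, hh, fun s => if h s = v then a i else 0, fun s => ?_, ?_, if_pos hz, fun s => ?_⟩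
  · dsimp only
    split_ifs <;> simp
  · exact if_neg (hx ▸ hv₀)
  · dsimp only
    split_ifs with h'
    · rw [h', hwv]
    · rw [mul_zero, (hs s).resolve_right h', fmul_fin_zero w h₀]

theorem HasProducts.hasIndicators (hV : HasProducts V a) {v₀ : F.Fl} (h₀ : v₀.val = 0)
    (hH : ∀ v ∈ V, ∀ x, ∃ h ∈ H, h x = v ∧ ∀ s, s ≠ x → h s = v₀) : HasIndicators H a := by
  intro x i h1 h2 ε hε
  obtain ⟨w, v, hv, hwv⟩ := hV i h1 h2 ε hε
  obtain ⟨h, hh, hx, hs⟩ := hH v hv x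
  exact ⟨w, h, hh, by rw [hx, hwv], fun s hsx => by rw [hs s hsx, fmul_fin_zero w h₀]⟩

/-- Adding a multiple of a function in `H` without overflow. -/
theorem Reach.tail_bar {G : ι → F.FlBar} {g u : ι → ℝ} (hG : Reach H G fun s => F.bar (g s))
    {w : F.Fl} {h : ι → F.Fl} (hh : h ∈ H) (hwh : ∀ s, fmul (.fin w) (.fin (h s)) = F.bar (u s))
    (hg : ∀ s, F.IsFloat (g s)) (hu : ∀ s, F.IsFloat (u s)) (hle : ∀ s, |g s + u s| ≤ F.Omega) :
    Reach H G fun s => F.bar (F.rd (g s + u s)) := by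
  refine Relation.ReflTransGen.tail hG ⟨w, h, hh, funext fun s => ?_⟩
  rw [hwh, bar_rd, fadd_bar (hg s) (hu s)]
  exact lt_of_le_of_lt (hle s) (lt_add_of_pos_right _ (two_zpow_pos _))

theorem Steps.reach (ha : F.StepSeq a) (hH : HasSteps H a) {g g' : ι → ℝ} (h : F.Steps a g g')
    {G : ι → F.FlBar} (hG : Reach H G fun s => F.bar (g s)) (hg : ∀ s, F.IsFloat (g s)) :
    Reach H G fun s => F.bar (g' s) := by
  suffices h : (Reach H G fun s => F.bar (g' s)) ∧ ∀ s, F.IsFloat (g' s) from h.1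
  induction h with
  | refl => exact ⟨hG, hg⟩
  | tail _ h ih =>
    obtain ⟨i, ε, h1, h2, hε, hb, rfl⟩ := h
    refine ⟨?_, fun s => F.isFloat_rd _⟩
    obtain ⟨w, h, hh, hwh⟩ := hH i h1 h2 ε hε
    refine ih.1.tail_bar hh hwh ih.2 (fun _ => ha.isFloat_sign_mul h1 h2 hε) fun s => ?_
    refine (abs_add_le _ _).trans ?_
    rw [abs_sign_mul hε, abs_of_pos (ha.pos h1 h2), Omega_eq]
    have := ha.le_top h1 h2
    have := hb s
    have := F.four_le_two_pow_p
    have := two_zpow_pos F.imax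
    nlinarith

/-- A function summable from `H` is thresholded by the next layer. -/
theorem exists_threshold (ha : F.StepSeq a) (hH : HasSteps H a) {g : ι → ℝ}
    (hg : ∀ s, F.IsFloat (g s)) (hgM : ∀ s, |g s| ≤ 2 ^ F.p * (2 : ℝ) ^ F.imax)
    (hG : Reach H (fun _ => F.bar 0) fun s => F.bar (g s)) {t : ℝ} (ht : F.IsFloat t)
    (htM : |t| ≤ 2 ^ F.p * (2 : ℝ) ^ F.imax) {c d v v' : F.Fl} (hcd : c.val < d.val)
    (hcM : |c.val| ≤ 2 ^ F.p * (2 : ℝ) ^ F.imax) (hdM : |d.val| ≤ 2 ^ F.p * (2 : ℝ) ^ F.imax)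
    (hdiff : |d.val - c.val| ≤ 2 ^ F.p * (2 : ℝ) ^ F.imax) (hv : σ (.fin c) = .fin v)
    (hv' : σ (.fin d) = .fin v') :
    ∃ h ∈ nextLayer σ H, (∀ s, t ≤ g s → h s = v') ∧ ∀ s, g s < t → h s = v := by
  classical
  obtain ⟨x, y, b, hx, hy, hb, hxb, hyb, hst⟩ := exists_steps_twoVal (U := {s | t ≤ g s}) ha c.2 d.2
    hcd hcM hdM ((le_abs_self _).trans hdiff)
  have hreach := Steps.reach ha hH ((separate ha hg hgM ht htM).trans hst) hG hg
  have hval : ∀ {r : ℝ} {e : F.Fl}, F.IsFloat r → r + b = e.val →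
      fadd (F.bar r) (.fin (F.nearest b)) = .fin e := fun hr he => by
    refine (fadd_bar_bar hr hb).trans ?_
    rw [he, round_fin_val]
  refine ⟨fun s => if t ≤ g s then v' else v, ⟨_, F.nearest b, hreach, fun s => ?_⟩,
    fun s hs => if_pos hs, fun s hs => if_neg hs.not_ge⟩
  dsimp only
  split_ifs with hs
  · rw [twoVal_mem (U := {s | t ≤ g s}) hs, hval hy hyb, hv']
  · rw [twoVal_not_mem (U := {s | t ≤ g s}) hs, hval hx hxb, hv]

/-- If a function in `H` distinguishes two points, then so does a function in the next layer with
two prescribed values of the activation function. -/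
theorem exists_bit (ha : F.StepSeq a) (hH : HasSteps H a) {h : ι → F.Fl} (hh : h ∈ H)
    (hM : ∀ s, |(h s).val| ≤ 2 ^ F.p * (2 : ℝ) ^ F.imax) {x z : ι} (hxz : h x ≠ h z)
    {c d v v' : F.Fl} (hcM : |c.val| ≤ 2 ^ F.p * (2 : ℝ) ^ F.imax)
    (hdM : |d.val| ≤ 2 ^ F.p * (2 : ℝ) ^ F.imax)
    (hdiff : |d.val - c.val| ≤ 2 ^ F.p * (2 : ℝ) ^ F.imax) (hv : σ (.fin c) = .fin v)
    (hv' : σ (.fin d) = .fin v') (hvv' : v ≠ v') :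
    ∃ h ∈ nextLayer σ H, (∀ s, h s = v ∨ h s = v') ∧ h x = v ∧ h z = v' := by
  -- the feature is taken with either sign, so as to be ordered as `c` and `d`
  have hG : ∀ ε : ℝ, ε = 1 ∨ ε = -1 →
      Reach H (fun _ => F.bar 0) fun s => F.bar (ε * (h s).val) := fun ε hε => by
    have h1 : F.IsFloat 1 := by
      have := isFloat_two_zpow (F := F) (i := 0)
      have h1 := F.emin_emax
      have h2 := F.two_le_p
      rw [zpow_zero] at this
      unfold imin imax at this
      exact this (by omega) (by omega)
    obtain ⟨w, hw⟩ : ∃ w : F.Fl, w.val = ε := ⟨⟨ε * 1, h1.sign_mul hε⟩, mul_one ε⟩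
    refine Relation.ReflTransGen.single ⟨w, h, hh, funext fun s => ?_⟩
    rw [bar_zero_fadd, fmul_fin, hw]
    rw [hw, rd_sign_mul hε, abs_sign_mul hε, rd_of_isFloat (x := (h s).val) (h s).2]
    exact (hM s).trans_lt F.top_lt_Omega
  have hfl : ∀ ε : ℝ, ε = 1 ∨ ε = -1 → ∀ s, F.IsFloat (ε * (h s).val) := fun ε hε s =>
    IsFloat.sign_mul hε (h s).2
  have hM' : ∀ ε : ℝ, ε = 1 ∨ ε = -1 → ∀ s, |ε * (h s).val| ≤ 2 ^ F.p * (2 : ℝ) ^ F.imax :=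
    fun ε hε s => (abs_sign_mul hε _).trans_le (hM s)
  have hne : (h x).val ≠ (h z).val := fun h => hxz (Subtype.ext h)
  have hsign : ∀ p q : ℝ, p ≠ q → ∃ ε : ℝ, (ε = 1 ∨ ε = -1) ∧ ε * p < ε * q := fun p q hpq => by
    rcases lt_or_gt_of_ne hpq with h | h
    · exact ⟨1, Or.inl rfl, by linarith⟩
    · exact ⟨-1, Or.inr rfl, by linarith⟩
  have hcd : c.val ≠ d.val := fun hcd => by
    have : c = d := Subtype.ext hcd
    rw [this, hv'] at hv
    exact hvv' (WithInfNaN.fin.inj hv.symm)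
  rcases lt_or_gt_of_ne hcd with hcd | hcd
  · obtain ⟨ε, hε, hlt⟩ := hsign _ _ hne
    obtain ⟨k, hk, hk1, hk2⟩ := exists_threshold ha hH (hfl ε hε) (hM' ε hε) (hG ε hε)
      (hfl ε hε z) (hM' ε hε z) hcd hcM hdM hdiff hv hv'
    exact ⟨k, hk, fun s => (lt_or_ge (ε * (h s).val) _).imp (hk2 s) (hk1 s), hk2 x hlt,
      hk1 z le_rfl⟩
  · obtain ⟨ε, hε, hlt⟩ := hsign _ _ hne.symm
    obtain ⟨k, hk, hk1, hk2⟩ := exists_threshold ha hH (hfl ε hε) (hM' ε hε) (hG ε hε)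
      (hfl ε hε x) (hM' ε hε x) hcd hdM hcM (by rwa [abs_sub_comm]) hv' hv
    exact ⟨k, hk, fun s => (le_or_gt _ (ε * (h s).val)).imp (hk1 s) (hk2 s), hk1 x le_rfl,
      hk2 z hlt⟩

/-- Starting from zero, all values but the one at `x` are raised to `2 ^ emax`. They cannot exceed
this number, at which the small steps are absorbed by rounding. -/
theorem reach_twoVal_compl [Finite ι] (ha : F.StepSeq a) (hH : HasBits H a) (x : ι) {ε : ℝ}
    (hε : ε = 1 ∨ ε = -1) : Reach H (fun _ => F.bar 0)
      fun s => F.bar (ε * twoVal {x}ᶜ 0 (2 ^ F.p * (2 : ℝ) ^ F.imax) s) := by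
  have := Fintype.ofFinite ι
  classical
  obtain ⟨M, hM⟩ : ∃ M, M = 2 ^ F.p * (2 : ℝ) ^ F.imax := ⟨_, rfl⟩
  have hMf : F.IsFloat M := hM ▸ F.isFloat_top
  have hM0 : 0 < M := by rw [hM]; positivity
  suffices h : ∀ A : Finset ι, x ∉ A → ∃ g : ι → ℝ, (∀ s, F.IsFloat (g s) ∧ 0 ≤ g s ∧ g s ≤ M) ∧
      g x = 0 ∧ (∀ s ∈ A, g s = M) ∧ Reach H (fun _ => F.bar 0) fun s => F.bar (ε * g s) by
    obtain ⟨g, -, hx, hA, hg⟩ := h {x}ᶜ (by simp)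
    have : g = twoVal {x}ᶜ 0 M := eq_twoVal (fun s hs => hA s (by simpa using hs))
      fun s hs => by rw [show s = x by simpa using hs, hx]
    rwa [← hM, ← this]
  intro A
  induction A using Finset.induction_on with
  | empty =>
    intro _
    exact ⟨fun _ => 0, fun s => ⟨F.isFloat_zero, le_rfl, hM0.le⟩, rfl, by simp, by
      simp only [mul_zero]; exact .refl⟩
  | insert z A hz ih =>
    intro hx
    rw [Finset.mem_insert, not_or] at hx
    obtain ⟨g, hg, hgx, hgA, hG⟩ := ih hx.2
    suffices h : ∃ g' : ι → ℝ, (∀ s, F.IsFloat (g' s) ∧ 0 ≤ g' s ∧ g' s ≤ M) ∧ g' x = 0 ∧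
        (∀ s ∈ A, g' s = M) ∧ g' z = M ∧ Reach H (fun _ => F.bar 0) fun s => F.bar (ε * g' s) by
      obtain ⟨g', h1, h2, h3, h4, h5⟩ := h
      refine ⟨g', h1, h2, fun s hs => ?_, h5⟩
      rcases Finset.mem_insert.mp hs with rfl | hs
      · exact h4
      · exact h3 s hs
    refine up_induction (P := fun y => ∃ g' : ι → ℝ, (∀ s, F.IsFloat (g' s) ∧ 0 ≤ g' s ∧ g' s ≤ M) ∧
      g' x = 0 ∧ (∀ s ∈ A, g' s = M) ∧ g' z = y ∧
      Reach H (fun _ => F.bar 0) fun s => F.bar (ε * g' s)) (hg z).1 hMf (hg z).2.2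
      ⟨g, hg, hgx, hgA, rfl, hG⟩ ?_
    rintro w y hwy hw hy ⟨g', h1, h2, h3, h4, h5⟩
    have himm := F.imin_add_four_le_imax
    have hM2 : M = 2 * 2 ^ F.p * (2 : ℝ) ^ (F.imax - 1) := by rw [hM, two_mul_pow_mul_pred]
    obtain ⟨i, hi1, hi2, hi3, hiy⟩ := hwy.exists_gap_le (j := F.imax - 1) (by omega)
      (by rw [← hM2]; linarith [(hg z).2.1]) (hM2 ▸ hy)
    obtain ⟨v, h, hh, u, hu, hux, huz, hvh⟩ := hH x z (fun h => hx.1 h) i hi1 hi2 ε hε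
    have hai := ha.pos hi1 hi2
    have huf : ∀ s, F.IsFloat (u s) := fun s => by
      rcases hu s with h | h <;> rw [h]
      · exact F.isFloat_zero
      · exact ha.isFloat i hi1 hi2
    have hu0 : ∀ s, 0 ≤ u s := fun s => by rcases hu s with h | h <;> rw [h]; exact hai.le
    have hle : ∀ s, F.rd (g' s + u s) ≤ M := fun s => by
      rcases hu s with h | h <;> rw [h]
      · rw [add_zero, rd_of_isFloat (h1 s).1]; exact (h1 s).2.2
      · rw [hM]
        refine (le_abs_self _).trans (ha.rd_add_mem hi1 (by omega) ?_)
        rw [← hM, abs_of_nonneg (h1 s).2.1]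
        exact (h1 s).2.2
    refine ⟨fun s => F.rd (g' s + u s), fun s => ⟨F.isFloat_rd _, ?_, hle s⟩, ?_, fun s hs => ?_,
      ?_, ?_⟩
    · exact le_rd F.isFloat_zero (add_nonneg (h1 s).2.1 (hu0 s))
    · dsimp only
      rw [hux, h2, add_zero, rd_zero]
    · refine le_antisymm (hle s) (le_rd hMf ?_)
      rw [h3 s hs]; linarith [hu0 s]
    · dsimp only
      rw [h4, huz]
      exact ha.rd_add hi1 hi2 hwy hiy
    · have := h5.tail_bar hh hvh (fun s => (h1 s).1.sign_mul hε) (fun s => (huf s).sign_mul hε)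
        fun s => by
          rw [← mul_add, abs_sign_mul hε, abs_of_nonneg (add_nonneg (h1 s).2.1 (hu0 s)), Omega_eq]
          have h6 := (h1 s).2.2
          have h7 : u s ≤ (2 : ℝ) ^ F.imax := by
            rcases hu s with h | h <;> rw [h]
            · positivity
            · exact ha.le_top hi1 hi2
          have := F.four_le_two_pow_p
          have := two_zpow_pos F.imax
          rw [hM] at h6
          nlinarith
      simpa only [← mul_add, rd_sign_mul hε] using this

/-- The indicator of a point, with two prescribed values of the activation function. -/
theorem exists_indicator [Finite ι] (ha : F.StepSeq a) (hH : HasSteps H a) (hB : HasBits H a)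
    (x : ι) {c d v v' : F.Fl} (hcM : |c.val| ≤ 2 ^ F.p * (2 : ℝ) ^ F.imax)
    (hdM : |d.val| ≤ 2 ^ F.p * (2 : ℝ) ^ F.imax)
    (hdiff : |d.val - c.val| ≤ 2 ^ F.p * (2 : ℝ) ^ F.imax) (hv : σ (.fin c) = .fin v)
    (hv' : σ (.fin d) = .fin v') (hvv' : v ≠ v') :
    ∃ h ∈ nextLayer σ H, h x = v' ∧ ∀ s, s ≠ x → h s = v := by
  have hcd : c.val ≠ d.val := fun hcd => by
    have : c = d := Subtype.ext hcd
    rw [this, hv'] at hv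
    exact hvv' (WithInfNaN.fin.inj hv.symm)
  obtain ⟨M, hM⟩ : ∃ M, M = 2 ^ F.p * (2 : ℝ) ^ F.imax := ⟨_, rfl⟩
  have hM0 : 0 < M := by rw [hM]; positivity
  have hMf : F.IsFloat M := hM ▸ F.isFloat_top
  have hx : twoVal {x}ᶜ 0 M x = 0 := twoVal_not_mem (by simp)
  have hs : ∀ s, s ≠ x → twoVal {x}ᶜ 0 M s = M := fun s hs => twoVal_mem (by simpa using hs)
  have hor : ∀ s, twoVal {x}ᶜ 0 M s = 0 ∨ twoVal {x}ᶜ 0 M s = M := fun s => by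
    by_cases h : s = x
    · exact Or.inl (h ▸ hx)
    · exact Or.inr (hs s h)
  have hfl : ∀ ε : ℝ, ε = 1 ∨ ε = -1 → ∀ s, F.IsFloat (ε * twoVal {x}ᶜ 0 M s) := fun ε hε s => by
    refine IsFloat.sign_mul hε ?_
    rcases hor s with h | h <;> rw [h]
    exacts [F.isFloat_zero, hMf]
  have hle : ∀ ε : ℝ, ε = 1 ∨ ε = -1 → ∀ s, |ε * twoVal {x}ᶜ 0 M s| ≤ M := fun ε hε s => by
    rw [abs_sign_mul hε]
    rcases hor s with h | h <;> rw [h]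
    · rw [abs_zero]; exact hM0.le
    · rw [abs_of_pos hM0]
  have hG : ∀ ε : ℝ, ε = 1 ∨ ε = -1 → Reach H (fun _ => F.bar 0)
      fun s => F.bar (ε * twoVal {x}ᶜ 0 M s) := fun ε hε => hM ▸ reach_twoVal_compl ha hB x hε
  rw [← hM] at hcM hdM hdiff
  -- If `c < d`, then `x` has to be above the threshold, and the negated function is taken.
  rcases lt_or_gt_of_ne hcd with hcd | hcd
  · obtain ⟨k, hk, hk1, hk2⟩ := exists_threshold ha hH (hfl (-1) (Or.inr rfl))
      (hM ▸ hle (-1) (Or.inr rfl)) (hG _ (Or.inr rfl)) F.isFloat_zero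
      (by rw [abs_zero, ← hM]; exact hM0.le) hcd (hM ▸ hcM) (hM ▸ hdM) (hM ▸ hdiff) hv hv'
    exact ⟨k, hk, hk1 x (by rw [hx, mul_zero]), fun s h => hk2 s (by rw [hs s h]; linarith)⟩
  · obtain ⟨k, hk, hk1, hk2⟩ := exists_threshold ha hH (hfl 1 (Or.inl rfl))
      (hM ▸ hle 1 (Or.inl rfl)) (hG _ (Or.inl rfl)) hMf
      (by rw [abs_of_pos hM0, ← hM]) hcd (hM ▸ hdM) (hM ▸ hcM)
      (by rwa [abs_sub_comm, ← hM]) hv' hv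
    exact ⟨k, hk, hk2 x (by rwa [hx, mul_zero]), fun s h => hk1 s (by rw [hs s h, one_mul])⟩

/-- Multiples of the indicator of `x` change the value at `x` from zero to any float but `NaN`. -/
theorem exists_reach_point (ha : F.StepSeq a) (hH : HasIndicators H a) (x : ι) {G : ι → F.FlBar}
    (hG : G x = F.bar 0) {y : F.FlBar} (hy : y ≠ .nan) :
    ∃ G', Reach H G G' ∧ G' x = y ∧ ∀ s, s ≠ x → G' s = G s := by
  have hstep : ∀ {ε : ℝ}, ε = 1 ∨ ε = -1 → ∀ {i : ℤ}, F.imin ≤ i → i ≤ F.imax →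
      ∀ {G' : ι → F.FlBar} {y : F.FlBar}, Reach H G G' ∧ G' x = y ∧ (∀ s, s ≠ x → G' s = G s) →
      ∃ G'', Reach H G G'' ∧ G'' x = fadd y (F.bar (ε * a i)) ∧ ∀ s, s ≠ x → G'' s = G s := by
    rintro ε hε i hi1 hi2 G' y ⟨h1, h2, h3⟩
    obtain ⟨w, h, hh, hwx, hws⟩ := hH x i hi1 hi2 ε hε
    refine ⟨_, h1.tail ⟨w, h, hh, rfl⟩, ?_, fun s hs => ?_⟩
    · rw [h2, hwx]
    · rw [hws s hs, fadd_bar_zero, h3 s hs]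
  have hfin : ∀ {ε : ℝ}, ε = 1 ∨ ε = -1 → ∀ {r : ℝ}, F.IsFloat r → 0 ≤ r →
      ∃ G', Reach H G G' ∧ G' x = F.bar (ε * r) ∧ ∀ s, s ≠ x → G' s = G s := by
    intro ε hε r hr hr0
    refine up_induction (P := fun r => ∃ G', Reach H G G' ∧ G' x = F.bar (ε * r) ∧
      ∀ s, s ≠ x → G' s = G s) F.isFloat_zero hr hr0
      ⟨G, .refl, by rw [mul_zero, hG], fun _ _ => rfl⟩ ?_
    rintro w z hwz hw - ⟨G', hG'⟩
    obtain ⟨i, hi1, hi2, hiz⟩ := hwz.exists_gap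
    obtain ⟨G'', h1, h2, h3⟩ := hstep hε hi1 hi2 hG'
    refine ⟨G'', h1, ?_, h3⟩
    have hai := ha.pos hi1 hi2
    rw [h2, fadd_bar (hwz.left.sign_mul hε) (ha.isFloat_sign_mul hi1 hi2 hε), ← mul_add, ← bar_rd,
      rd_sign_mul hε, ha.rd_add hi1 hi2 hwz hiz]
    rw [← mul_add, abs_sign_mul hε, abs_of_nonneg (by linarith)]
    have h4 := (le_abs_self _).trans hwz.right.abs_le_Omega
    have h5 := ha.le i hi1 hi2
    have h6 := two_zpow_pos (F.imax - 1)
    linarith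
  have hinf : ∀ {ε : ℝ}, ε = 1 ∨ ε = -1 → ∃ G', Reach H G G' ∧
      G' x = F.round (.fin (ε * (F.Omega + a F.imax))) ∧ ∀ s, s ≠ x → G' s = G s := by
    intro ε hε
    obtain ⟨G', hG'⟩ := hfin hε F.isFloat_Omega F.Omega_pos.le
    obtain ⟨G'', h1, h2, h3⟩ := hstep hε F.imin_le_imax le_rfl hG'
    refine ⟨G'', h1, ?_, h3⟩
    rw [h2, fadd_bar_bar (F.isFloat_Omega.sign_mul hε)
      (ha.isFloat_sign_mul F.imin_le_imax le_rfl hε), mul_add]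
  -- The step `a imax` leads from the largest float beyond the threshold for rounding to `∞`.
  have hov : F.Omega + (2 : ℝ) ^ (F.imax - 1) < F.Omega + a F.imax := by
    rw [two_zpow_pred]
    have := ha.half_lt _ F.imin_le_imax le_rfl
    linarith
  have hov' : (0 : ℝ) < F.Omega + a F.imax :=
    add_pos F.Omega_pos (ha.pos F.imin_le_imax le_rfl)
  cases y with
  | fin r =>
    rcases le_total 0 r.val with h | h
    · obtain ⟨G', h1, h2, h3⟩ := hfin (Or.inl rfl) r.2 h
      exact ⟨G', h1, by rw [h2, one_mul]; exact bar_val r, h3⟩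
    · obtain ⟨G', h1, h2, h3⟩ := hfin (Or.inr rfl) (IsFloat.neg r.2) (neg_nonneg.mpr h)
      exact ⟨G', h1, by rw [h2, neg_one_mul, neg_neg]; exact bar_val r, h3⟩
  | posInf =>
    obtain ⟨G', h1, h2, h3⟩ := hinf (Or.inl rfl)
    refine ⟨G', h1, h2.trans ?_, h3⟩
    rw [one_mul]
    refine (if_neg ?_).trans (if_pos hov')
    rw [abs_of_pos hov']
    exact hov.not_gt
  | negInf =>
    obtain ⟨G', h1, h2, h3⟩ := hinf (Or.inr rfl)
    refine ⟨G', h1, h2.trans ?_, h3⟩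
    rw [neg_one_mul]
    refine (if_neg ?_).trans (if_neg (by linarith))
    rw [abs_neg, abs_of_pos hov']
    exact hov.not_gt
  | nan => exact absurd rfl hy

/-- With indicators of all points, the values at the points are prescribed one after the other. -/
theorem reach_of_hasIndicators [Finite ι] (ha : F.StepSeq a) (hH : HasIndicators H a)
    {f : ι → F.FlBar} (hf : ∀ s, f s ≠ .nan) : Reach H (fun _ => F.bar 0) f := by
  have := Fintype.ofFinite ι
  classical
  suffices h : ∀ A : Finset ι, ∃ G, Reach H (fun _ => F.bar 0) G ∧ (∀ s ∈ A, G s = f s) ∧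
      ∀ s ∉ A, G s = F.bar 0 by
    obtain ⟨G, hG, h, -⟩ := h Finset.univ
    rwa [← funext fun s => h s (Finset.mem_univ s)]
  intro A
  induction A using Finset.induction_on with
  | empty => exact ⟨_, .refl, by simp, by simp⟩
  | insert x A hx ih =>
    obtain ⟨G, hG, h1, h2⟩ := ih
    obtain ⟨G', hG', h3, h4⟩ := exists_reach_point ha hH x (h2 x hx) (hf x)
    refine ⟨G', hG.trans hG', fun s hs => ?_, fun s hs => ?_⟩
    · by_cases hsx : s = x
      · rw [hsx, h3]
      · rw [h4 s hsx, h1 s ((Finset.mem_insert.mp hs).resolve_left hsx)]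
    · rw [Finset.mem_insert, not_or] at hs
      rw [h4 s hs.1, h2 s hs.2]

end FloatFormat

open FloatFormat in
theorem mainTheorem1 (F : FloatFormat) (S : ReductionOrder) (σ : F.FlBar → F.FlBar)
    (din dout : ℕ+) (X : Set (Fin din → F.Fl)) (f : X → Fin dout → F.FlInf)
    (hσ : ProperActivation σ) (hX : Distinguishable S σ X (boundedRange F)) :
    ∃ g : FlNetwork F din dout 4, ∀ x : X, ∀ i : Fin dout,
      g.eval σ S (flVec x.val) i = (f x i).val := by
  obtain ⟨C, v, hC, hCC, hσv, hv0, hv1, hv1', t, ⟨⟨ht, ht'⟩, -⟩, hv2⟩ := hσ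
  rw [F.zpow_emax] at hC
  simp only [F.zpow_emax] at hCC
  have : Finite F.Fl := F.finite_isFloat.to_subtype
  obtain ⟨a, ha, hav⟩ := exists_stepSeq hv1 hv1' ht ht' hv2
  -- the nonzero values of the activation function that provide the steps
  have hV : HasProducts {u | u = v 1 ∨ u = v 2} a := hasProducts ha fun i h1 h2 => by
    obtain ⟨w, h | h⟩ := hav i h1 h2
    · exact ⟨w, v 1, Or.inl rfl, h⟩
    · exact ⟨w, v 2, Or.inr rfl, h⟩
  have hVex : ∀ u, u = v 1 ∨ u = v 2 → ∃ j, u = v j ∧ v 0 ≠ v j := by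
    rintro u (rfl | rfl)
    · refine ⟨1, rfl, fun h => ?_⟩
      rw [← h, hv0, abs_zero] at hv1
      exact absurd hv1 (two_zpow_pos _).not_ge
    · refine ⟨2, rfl, fun h => ?_⟩
      rw [← h, hv0, abs_zero] at hv2
      exact absurd (ht'.trans hv2) (two_zpow_pos _).le.not_gt
  have hS₁ : HasSteps (firstLayer S σ X) a := hV.hasSteps fun u hu => by
    obtain ⟨j, rfl, -⟩ := hVex u hu
    exact const_mem_firstLayer X (hσv j)
  have hS₂ : HasSteps (nextLayer σ (firstLayer S σ X)) a := hV.hasSteps fun u hu => by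
    obtain ⟨j, rfl, -⟩ := hVex u hu
    exact const_mem_nextLayer _ (hσv j)
  have hB₂ : HasBits (nextLayer σ (firstLayer S σ X)) a := hV.hasBits hv0 fun u hu => by
    obtain ⟨j, rfl, hj⟩ := hVex u hu
    refine ⟨hj, fun x z hxz => ?_⟩
    obtain ⟨φ, hφ, hφX⟩ := hX x.val x.2 z.val z.2 fun h => hxz (Subtype.ext h)
    choose g hg hgM using fun s : X => hφX s.val s.2
    refine exists_bit ha hS₁ (h := g) ⟨φ, hg⟩ (fun s => F.zpow_emax ▸ hgM s) (fun h => hφ ?_)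
      (hC 0) (hC j) (hCC j 0) (hσv 0) (hσv j) hj
    rw [hg x, hg z, h]
  have hI₃ : HasIndicators (nextLayer σ (nextLayer σ (firstLayer S σ X))) a :=
    hV.hasIndicators hv0 fun u hu x => by
      obtain ⟨j, rfl, hj⟩ := hVex u hu
      exact exists_indicator ha hS₂ hB₂ x (hC 0) (hC j) (hCC j 0) (hσv 0) (hσv j) hj
  exact exists_network (hσv 0) fun i => reach_of_hasIndicators ha hI₃ fun x => (f x i).2
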